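/- Let $$G = \langle a,b,c,t \mid a^2=t,\ b^3=t,\ c^7=t,\ abc=t^3\rangle ,\qquad \Delta=\langle a,b,c \mid a^2=b^3=c^7=abc=1\rangle ,$$ so that $\Delta$ is the $(2,3,7)$ triangle group. Let $\mathrm{Diffeo}^+(\mathbb R^2)$ be the group of orientation-preserving $C^\infty$ diffeomorphisms of the plane. A group is left-orderable if it admits a total order $<$ such that $\alpha<\beta$ if and only if $\gamma\alpha<\gamma\beta$, for all elements $\alpha,\beta,\gamma$. 1. There is a subgroup of $\mathrm{Diffeo}^+(\mathbb R^2)$ that is isomorphic to $G$, finitely presented, torsion-free (no nontrivial element has finite order), and not left-orderable. 2. There is a Seifert fibered space $M$ (a closed connected $3$-manifold) whose base orbifold is the $2$-sphere with exactly three cone points, of orders $2$, $3$, $7$, such that $\pi_1(M)\cong G$. 3. The element $t$ is central in $G$ and has infinite order, and $a\mapsto a$, $b\mapsto b$, $c\mapsto c$, $t\mapsto 1$ defines a surjection $G\to\Delta$ with kernel $\langle t\rangle$; thus $G$ is a central extension $1\to\mathbb Z\to G\to\Delta\to 1$. -/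

import Mathlib

open scoped ContDiff

/-- A group is left-orderable if it carries a (strict) total order `<` with
`α < β ↔ γ * α < γ * β` for all `α β γ`. -/
def LeftOrderable (G : Type*) [Group G] : Prop :=
  ∃ lt : G → G → Prop, IsStrictTotalOrder G lt ∧
    ∀ α β γ : G, lt α β ↔ lt (γ * α) (γ * β)

/-- A group is torsion-free if no nontrivial element has finite order.
(For a noncommutative group Mathlib's `IsMulTorsionFree`, which asks for uniqueness of roots, is
strictly stronger.) -/
def TorsionFreeGroup (G : Type*) [Group G] : Prop :=
  ∀ g : G, g ≠ 1 → ¬ IsOfFinOrder g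

/-- The plane `ℝ²`. -/
abbrev Plane : Type := EuclideanSpace ℝ (Fin 2)

/-- `Diffeo⁺(ℝ²)`: the group, under composition, of bijections of the plane that are `C^∞` with
`C^∞` inverse and preserve the orientation (the Jacobian determinant is everywhere positive). -/
def DiffeoPlus : Subgroup (Equiv.Perm Plane) where
  carrier := {f | ContDiff ℝ ∞ (f : Plane → Plane) ∧ ContDiff ℝ ∞ (f.symm : Plane → Plane) ∧
    ∀ x : Plane, 0 < (fderiv ℝ (f : Plane → Plane) x).det}
  one_mem' := by
    refine ⟨contDiff_id, contDiff_id, fun x => ?_⟩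
    have h : fderiv ℝ ((1 : Equiv.Perm Plane) : Plane → Plane) x
        = ContinuousLinearMap.id ℝ Plane := fderiv_id
    rw [h, ContinuousLinearMap.det, ContinuousLinearMap.coe_id, LinearMap.det_id]
    exact one_pos
  mul_mem' := by
    rintro f g ⟨hf, hf', hfd⟩ ⟨hg, hg', hgd⟩
    refine ⟨hf.comp hg, hg'.comp hf', fun x => ?_⟩
    have h : fderiv ℝ ((f * g : Equiv.Perm Plane) : Plane → Plane) x
        = (fderiv ℝ f (g x)).comp (fderiv ℝ g x) :=
      fderiv_comp x (hf.differentiable (by simp) _) (hg.differentiable (by simp) _)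
    rw [h, ContinuousLinearMap.det, ContinuousLinearMap.toLinearMap_comp, LinearMap.det_comp]
    exact mul_pos (hfd _) (hgd _)
  inv_mem' := by
    rintro f ⟨hf, hf', hfd⟩
    refine ⟨hf', hf, fun x => ?_⟩
    have hc : (f : Plane → Plane) ∘ (f.symm : Plane → Plane) = id := by
      funext y; simp
    have h : (fderiv ℝ f (f.symm x)).comp (fderiv ℝ f.symm x) = ContinuousLinearMap.id ℝ Plane := by
      rw [← fderiv_comp x (hf.differentiable (by simp) _) (hf'.differentiable (by simp) _), hc,
        fderiv_id]
    have h1 : (fderiv ℝ f (f.symm x)).det * (fderiv ℝ f.symm x).det = 1 := by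
      rw [ContinuousLinearMap.det, ContinuousLinearMap.det, ← LinearMap.det_comp,
        ← ContinuousLinearMap.toLinearMap_comp, h, ContinuousLinearMap.coe_id, LinearMap.det_id]
    change 0 < (fderiv ℝ f.symm x).det
    exact (mul_pos_iff_of_pos_left (hfd _)).1 (h1 ▸ one_pos)

/-- The generators `a, b, c` of the triangle group. -/
inductive TriangleGen : Type
  | a | b | c

open FreeGroup TriangleGen in
/-- The (orientation-preserving) `(2,3,7)` triangle group
`Δ = ⟨a, b, c ∣ a² = b³ = c⁷ = abc = 1⟩`. -/
abbrev Triangle237 : Type :=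
  PresentedGroup ({of a ^ 2, of b ^ 3, of c ^ 7, of a * of b * of c} :
    Set (FreeGroup TriangleGen))

/-- The generators `a, b, c, t` of the Seifert group. -/
inductive SeifertGen : Type
  | a | b | c | t

open FreeGroup SeifertGen in
/-- The group `G = ⟨a, b, c, t ∣ a² = t, b³ = t, c⁷ = t, abc = t³⟩`. -/
abbrev Seifert237 : Type :=
  PresentedGroup ({of a ^ 2 * (of t)⁻¹, of b ^ 3 * (of t)⁻¹, of c ^ 7 * (of t)⁻¹,
    of a * of b * of c * (of t ^ 3)⁻¹} : Set (FreeGroup SeifertGen))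

/-- `f : M → B` is a Seifert fibration over a surface `B`, the fibre over `b` having multiplicity
`mult b`: every `b` has an open disc neighbourhood `U` over which `f` is homeomorphic to a fibred
solid torus. With `p = mult b ≥ 1` and `q` prime to `p`, the model is the projection
`(z, w) ↦ z ^ p * w ^ q` of the solid torus `{|z| < 1} × S¹` onto the disc; its fibres are the
orbits of the circle action `θ • (z, w) = (θ ^ (-q) * z, θ ^ p * w)`, and the core `z = 0` is the
fibre of multiplicity `p`, all other fibres of the model being regular. In particular `M` is a
`3`-manifold. -/
def IsSeifertFibration {M B : Type*} [TopologicalSpace M] [TopologicalSpace B]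
    (f : M → B) (mult : B → ℕ) : Prop :=
  Continuous f ∧ ∀ b : B, 1 ≤ mult b ∧ ∃ q : ℤ, IsCoprime (mult b : ℤ) q ∧
    ∃ U : Set B, IsOpen U ∧ ∃ hb : b ∈ U,
      ∃ (e : U ≃ₜ Metric.ball (0 : ℂ) 1)
        (E : (f ⁻¹' U : Set M) ≃ₜ (Metric.ball (0 : ℂ) 1) × Circle),
        (e ⟨b, hb⟩ : ℂ) = 0 ∧
        ∀ x : (f ⁻¹' U : Set M),
          (e ⟨f x, x.2⟩ : ℂ) = ((E x).1 : ℂ) ^ mult b * (((E x).2 ^ q : Circle) : ℂ)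

/-- The sphere `S²`. -/
abbrev Sphere2 : Type := Metric.sphere (0 : EuclideanSpace ℝ (Fin 3)) 1

/-- `f : M → S²` is a Seifert fibration whose base orbifold is the sphere with three cone points,
of orders `2`, `3` and `7`. In particular `M` is a closed connected `3`-manifold. -/
def IsSeifertOver237 {M : Type*} [TopologicalSpace M] (f : M → Sphere2) : Prop :=
  ∃ (mult : Sphere2 → ℕ) (x y z : Sphere2), IsSeifertFibration f mult ∧
    x ≠ y ∧ x ≠ z ∧ y ≠ z ∧ mult x = 2 ∧ mult y = 3 ∧ mult z = 7 ∧
    ∀ w : Sphere2, w ≠ x → w ≠ y → w ≠ z → mult w = 1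

/-!
Everything is deduced from explicit actions of the three groups involved: the reflection group `W`
of type `(2,3,7)`, the triangle group `Δ`, and the Seifert group `G`.

**The reflection group.** `W` acts on the upper half-plane `ℍ` by the reflections in the sides of a
triangle with angles `π/2`, `π/3`, `π/7`. A point is described by its three heights `ht i` over the
sides, on which `W` acts by the formulas of the geometric representation. Reflecting a point
repeatedly in sides that separate it from the triangle is a terminating (`wellFounded_reduces`) and
confluent (`loc_eq_simple_mul`) process; it attaches to a point `x` an element `loc x` of `W` and a
point `fold x = (loc x)⁻¹ • x` of the triangle. Hence the triangle is a strict fundamental domain,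
stabilizers are generated by the reflections in the sides through a point (`mem_parab_of_smul_eq`),
and the action is properly discontinuous (`exists_smul_eq_of_dist_lt`). `Δ` embeds in `W` as the
kernel of the orientation character (`toW_injective`, `mem_range_toW_of_sgn`).

**The central extension.** The generators of `Δ` are rotations by matrices in `SL₂(ℝ)`, and the
arguments of their automorphy factors `cz + d` have constant sums along the relations
(`sum_ang_pow`). Rescaling these arguments by `85/π` and subtracting `42`, `28`, `12` turns the
relations of `Δ` into those of `G`, so `G` acts on `ℍ × ℝ` over the action of `Δ` on `ℍ`, with `t`
acting as the translation by `1` (`coverHom`). Therefore `t` has infinite order, and the kernel of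
`G → Δ` is the infinite cyclic central subgroup `⟨t⟩` (`extension`).

**Left orders and torsion.** In a left order with `1 < t`, the central element `t` is larger than
each of its roots `a`, `b`, `c`, so `abc < t³` (`not_leftOrderable`). The stabilizer in `G` of a
point of `ℍ` is infinite cyclic and translates the fibre, after a change of the fibre coordinate; so
`G` acts freely and properly discontinuously on `ℍ × ℝ` (`exists_nhds_disjoint`). An element of
finite order maps to an elliptic element of `Δ`, hence fixes a point of `ℍ` and of `ℍ × ℝ`, and is
trivial (`torsionFree`).

**Diffeomorphisms of the plane.** `G` acts on `ℍ`, a smooth plane, through `Δ`. This is made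
faithful by choosing a disc whose translates under `Δ` are disjoint, and composing with powers of a
twist supported in the translates, according to the cocycle which describes the permutation
representation of `G` on the cosets of `⟨t⟩` (`exists_faithful_action`). The diffeomorphisms so
obtained preserve the orientation, because `G` is generated by squares.

**The Seifert fibered space.** It is the quotient of `ℍ × ℝ` by `G`. Its fundamental group is `G`
because `ℍ × ℝ` is contractible. The fibration is induced by `orbitMap`, an explicit quotient map
`ℍ → S²` for the action of `Δ`: the triangle and its mirror image are flattened onto the two
hemispheres. Around each fibre, the disc coordinate on `ℍ` and the straightened fibre coordinate
identify the quotient by the stabilizer with a fibred solid torus (`exists_solid_torus`).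
-/

/-! ### The `(2,3,7)` reflections of the upper half-plane -/

namespace TriangleReflection

open UpperHalfPlane Matrix
open scoped MatrixGroups

noncomputable section

/-- The function `(α|z|² + β x + γ) / y` of `z = x + iy` attached to `v = (α, β, γ)`. Up to scaling,
these are the restrictions to the hyperboloid model of the linear functions of Minkowski space. -/
def lin (v : Fin 3 → ℝ) (z : ℍ) : ℝ :=
  (v 0 * (z.re ^ 2 + z.im ^ 2) + v 1 * z.re + v 2) / z.im

/-- The Minkowski form on the coefficient vectors of `lin`. -/
def form (v w : Fin 3 → ℝ) : ℝ := v 1 * w 1 - 2 * (v 0 * w 2 + v 2 * w 0)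

/-- The matrix whose (orientation-reversing) action on `ℍ` is the reflection in the geodesic
`lin v = 0`, for a vector `v` of norm `1`. -/
def reflMatrix (v : Fin 3 → ℝ) (hv : form v v = 1) : GL (Fin 2) ℝ :=
  .mkOfDetNeZero !![-v 1, -(2 * v 2); 2 * v 0, v 1] (by
    rw [Matrix.det_fin_two_of]
    have h := hv
    unfold form at h
    intro h0
    linarith)

lemma det_reflMatrix (v : Fin 3 → ℝ) (hv : form v v = 1) : (reflMatrix v hv).det.val = -1 := by
  have h := hv
  unfold form at h
  change Matrix.det !![-v 1, -(2 * v 2); 2 * v 0, v 1] = -1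
  rw [Matrix.det_fin_two_of]
  linarith

lemma coe_reflMatrix_smul (v : Fin 3 → ℝ) (hv : form v v = 1) (z : ℍ) :
    ((reflMatrix v hv • z : ℍ) : ℂ) =
      (starRingEnd ℂ) ((-v 1 * z - 2 * v 2) / (2 * v 0 * z + v 1)) := by
  rw [coe_smul, σ, if_neg (by rw [det_reflMatrix]; norm_num)]
  simp [num, denom, reflMatrix, sub_eq_add_neg]

lemma normSq_denom_reflMatrix_pos (v : Fin 3 → ℝ) (hv : form v v = 1) (z : ℍ) :
    0 < (2 * v 0 * z.re + v 1) ^ 2 + (2 * v 0 * z.im) ^ 2 := by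
  have h := hv
  unfold form at h
  have hy := z.im_pos
  by_cases h0 : v 0 = 0
  · have : v 1 ^ 2 = 1 := by rw [h0] at h; linarith
    rw [h0]; nlinarith
  · positivity

lemma re_reflMatrix_smul (v : Fin 3 → ℝ) (hv : form v v = 1) (z : ℍ) :
    (reflMatrix v hv • z : ℍ).re = ((-v 1 * z.re - 2 * v 2) * (2 * v 0 * z.re + v 1)
      - 2 * v 0 * v 1 * z.im ^ 2) / ((2 * v 0 * z.re + v 1) ^ 2 + (2 * v 0 * z.im) ^ 2) := by
  rw [← coe_re, coe_reflMatrix_smul, Complex.conj_re, Complex.div_re, Complex.normSq_apply]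
  simp
  rw [← add_div]
  congr 1 <;> ring

lemma im_reflMatrix_smul (v : Fin 3 → ℝ) (hv : form v v = 1) (z : ℍ) :
    (reflMatrix v hv • z : ℍ).im =
      z.im / ((2 * v 0 * z.re + v 1) ^ 2 + (2 * v 0 * z.im) ^ 2) := by
  have h := hv
  unfold form at h
  rw [← coe_im, coe_reflMatrix_smul, Complex.conj_im, Complex.div_im, Complex.normSq_apply]
  simp
  rw [← sub_div]
  congr 1
  · linear_combination z.im * h
  · ring

/-- Reflecting `z` changes `lin w` by the formula for a linear reflection of Minkowski space. -/
lemma lin_reflMatrix_smul (v w : Fin 3 → ℝ) (hv : form v v = 1) (z : ℍ) :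
    lin w (reflMatrix v hv • z) = lin w z - 2 * form v w * lin v z := by
  have hD := normSq_denom_reflMatrix_pos v hv z
  have hy := z.im_pos
  unfold lin
  rw [re_reflMatrix_smul, im_reflMatrix_smul]
  set x := z.re
  set y := z.im
  set D := (2 * v 0 * x + v 1) ^ 2 + (2 * v 0 * y) ^ 2 with hDdef
  have h := hv
  unfold form at h ⊢
  have hN : ((-v 1 * x - 2 * v 2) * (2 * v 0 * x + v 1) - 2 * v 0 * v 1 * y ^ 2) ^ 2 + y ^ 2
      = ((v 1 * x + 2 * v 2) ^ 2 + (v 1 * y) ^ 2) * D := by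
    rw [hDdef]
    linear_combination (-y ^ 2) * (v 1 * v 1 - 4 * v 0 * v 2 + 1) * h
  have e1 : (((-v 1 * x - 2 * v 2) * (2 * v 0 * x + v 1) - 2 * v 0 * v 1 * y ^ 2) / D) ^ 2
      + (y / D) ^ 2 = ((v 1 * x + 2 * v 2) ^ 2 + (v 1 * y) ^ 2) / D := by
    rw [div_pow, div_pow, ← add_div, hN]
    field_simp
  rw [e1]
  field_simp
  rw [hDdef]
  linear_combination
    (w 0 * (x ^ 2 + y ^ 2) + w 1 * x + w 2) * h

lemma reflMatrix_sq_smul (v : Fin 3 → ℝ) (hv : form v v = 1) (z : ℍ) :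
    reflMatrix v hv • reflMatrix v hv • z = z := by
  have h := hv
  unfold form at h
  have : reflMatrix v hv * reflMatrix v hv = 1 := by
    ext i j
    fin_cases i <;> fin_cases j <;>
      simp [reflMatrix] <;> linarith
  rw [← mul_smul, this, one_smul]

lemma isometry_J_smul : Isometry (fun z : ℍ => UpperHalfPlane.J • z) := by
  refine Isometry.of_dist_eq fun z w => ?_
  have him : ∀ u : ℍ, (UpperHalfPlane.J • u).im = u.im := fun u => by
    rw [← coe_im, coe_J_smul]; simp
  rw [UpperHalfPlane.dist_eq, UpperHalfPlane.dist_eq, him, him, coe_J_smul, coe_J_smul,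
    dist_neg_neg, Complex.dist_conj_conj]

/-- A reflection is an isometry, being the composition of an element of `SL(2, ℝ)` with the standard
reflection `J`. -/
lemma isometry_reflMatrix_smul (v : Fin 3 → ℝ) (hv : form v v = 1) :
    Isometry (fun z : ℍ => reflMatrix v hv • z) := by
  have hdet : ((reflMatrix v hv * UpperHalfPlane.J : GL (Fin 2) ℝ).val).det = 1 := by
    have h1 := det_reflMatrix v hv
    rw [Units.val_mul, Matrix.det_mul]
    have h2 : (UpperHalfPlane.J : GL (Fin 2) ℝ).val.det = -1 := by
      rw [val_J, Matrix.det_fin_two_of]; norm_num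
    rw [h2]
    change (reflMatrix v hv).val.det = -1 at h1
    rw [h1]; norm_num
  let g : SL(2, ℝ) := ⟨(reflMatrix v hv * UpperHalfPlane.J : GL (Fin 2) ℝ).val, hdet⟩
  have hg : (g : GL (Fin 2) ℝ) = reflMatrix v hv * UpperHalfPlane.J := by ext; rfl
  have key : (fun z : ℍ => reflMatrix v hv • z) =
      (fun z : ℍ => g • z) ∘ fun z : ℍ => UpperHalfPlane.J • z := by
    funext z
    change _ = (g : GL (Fin 2) ℝ) • UpperHalfPlane.J • z
    rw [hg, mul_smul, ← mul_smul UpperHalfPlane.J UpperHalfPlane.J, ← sq, J_sq, one_smul]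
  rw [key]
  exact (isometry_smul ℍ g).comp isometry_J_smul

/-! ### The constants of the triangle -/

/-- `2 cos (π/7)`. -/
def lam : ℝ := 2 * Real.cos (Real.pi / 7)

/-- The minimal polynomial of `2 cos (π/7)`. -/
lemma lam_poly : lam ^ 3 - lam ^ 2 - 2 * lam + 1 = 0 := by
  -- `sin (3π/7) = sin (4π/7)`, divided by `sin (π/7)`
  have hs : 0 < Real.sin (Real.pi / 7) :=
    Real.sin_pos_of_pos_of_lt_pi (by positivity) (by linarith [Real.pi_pos])
  have h : Real.sin (3 * (Real.pi / 7)) = Real.sin (4 * (Real.pi / 7)) := by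
    rw [← Real.sin_pi_sub]; congr 1; ring
  have h4 : Real.sin (4 * (Real.pi / 7)) = 2 * (2 * Real.sin (Real.pi / 7) *
      Real.cos (Real.pi / 7)) * (2 * Real.cos (Real.pi / 7) ^ 2 - 1) := by
    rw [show 4 * (Real.pi / 7) = 2 * (2 * (Real.pi / 7)) by ring, Real.sin_two_mul,
      Real.sin_two_mul, Real.cos_two_mul]
  have hsq := Real.sin_sq_add_cos_sq (Real.pi / 7)
  rw [Real.sin_three_mul, h4] at h
  apply mul_left_cancel₀ hs.ne'
  unfold lam
  linear_combination (-h) + (-4 * Real.sin (Real.pi / 7)) * hsq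

lemma three_lt_lam_sq : 3 < lam ^ 2 := by
  have h : Real.cos (Real.pi / 6) < Real.cos (Real.pi / 7) :=
    Real.cos_lt_cos_of_nonneg_of_le_pi (by positivity) (by linarith [Real.pi_pos])
      (by linarith [Real.pi_pos])
  rw [Real.cos_pi_div_six] at h
  have h3 : √3 < lam := by unfold lam; linarith
  have := Real.sq_sqrt (show (0 : ℝ) ≤ 3 by norm_num)
  nlinarith [Real.sqrt_nonneg 3]

lemma lam_lt_two : lam < 2 := by
  have h : Real.cos (Real.pi / 7) < Real.cos 0 :=
    Real.cos_lt_cos_of_nonneg_of_le_pi le_rfl (by linarith [Real.pi_pos])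
      (by positivity)
  rw [Real.cos_zero] at h
  unfold lam; linarith

lemma one_lt_lam : 1 < lam := by
  have h : 0 < lam := by
    have := Real.cos_pos_of_mem_Ioo (x := Real.pi / 7)
      ⟨by linarith [Real.pi_pos], by linarith [Real.pi_pos]⟩
    unfold lam; linarith
  nlinarith [three_lt_lam_sq]

/-- The square root of `lam² - 3`, positive because the triangle is hyperbolic. -/
def del : ℝ := √(lam ^ 2 - 3)

lemma del_sq : del ^ 2 = lam ^ 2 - 3 := Real.sq_sqrt (by linarith [three_lt_lam_sq])

lemma del_pos : 0 < del := Real.sqrt_pos.2 (by linarith [three_lt_lam_sq])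

lemma del_lt_one : del < 1 := by
  nlinarith [del_sq, del_pos, lam_lt_two, one_lt_lam]

/-- The larger root of `X² - lam X + 3/4`. -/
def rr : ℝ := (lam + del) / 2

/-- Minus the smaller root of `X² - lam X + 3/4`. -/
def qq : ℝ := -(lam - del) / 2

lemma rr_mul_qq : rr * qq = -3 / 4 := by
  unfold rr qq; linear_combination (1 / 4) * del_sq

lemma rr_sub_qq : rr - qq = lam := by unfold rr qq; ring

lemma rr_add_qq : rr + qq = del := by unfold rr qq; ring

lemma rr_pos : 0 < rr := by unfold rr; linarith [one_lt_lam, del_pos]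

lemma rr_lt : rr < 3 / 2 := by unfold rr; linarith [lam_lt_two, del_lt_one]

lemma qq_neg : qq < 0 := by unfold qq; linarith [one_lt_lam, del_lt_one]

/-- The inward unit normal vectors of the three sides of the triangle. -/
def wallVec : Fin 3 → (Fin 3 → ℝ) :=
  ![![0, -1, 0], ![-1 / 2, 0, 1 / 2], ![rr / 2, 1 / 2, qq / 2]]

/-- The Coxeter matrix of the `(2,3,7)` reflection group. -/
def cox : CoxeterMatrix (Fin 3) where
  M := !![1, 2, 3; 2, 1, 7; 3, 7, 1]
  isSymm := by decide
  diagonal := by decide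
  off_diagonal := by
    intro i j h
    fin_cases i <;> fin_cases j <;> simp_all

/-- The numbers `2 cos (π/m)` for the entries `m` of the Coxeter matrix, with `-2` on the
diagonal. -/
def wallCoef : Fin 3 → Fin 3 → ℝ := ![![-2, 0, 1], ![0, -2, lam], ![1, lam, -2]]

lemma two_form_wallVec (i j : Fin 3) : 2 * form (wallVec i) (wallVec j) = -wallCoef i j := by
  have h1 := rr_mul_qq
  have h2 := rr_sub_qq
  fin_cases i <;> fin_cases j <;> simp [form, wallVec, wallCoef] <;> linarith

lemma form_wallVec_self (i : Fin 3) : form (wallVec i) (wallVec i) = 1 := by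
  have := two_form_wallVec i i
  fin_cases i <;> simp [wallCoef] at this ⊢ <;> linarith

/-- The height of `z` over the `i`-th side of the triangle. -/
def ht (i : Fin 3) (z : ℍ) : ℝ := lin (wallVec i) z

/-- The reflection in the `i`-th side, as a matrix. -/
def wallMatrix (i : Fin 3) : GL (Fin 2) ℝ := reflMatrix (wallVec i) (form_wallVec_self i)

lemma mul_self_of_det_eq_one (M : Matrix (Fin 2) (Fin 2) ℝ) (h : M.det = 1) :
    M * M = M.trace • M - 1 := by
  rw [Matrix.det_fin_two] at h
  ext i j
  fin_cases i <;> fin_cases j <;>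
    simp [Matrix.mul_apply, Fin.sum_univ_two, Matrix.trace_fin_two] <;> linarith

/-- The Cayley-Hamilton relation for the product of two reflections. -/
lemma wallMatrix_mul_sq (i j : Fin 3) :
    (wallMatrix i * wallMatrix j).val * (wallMatrix i * wallMatrix j).val
      = (-wallCoef i j) • (wallMatrix i * wallMatrix j).val - 1 := by
  have hi : (wallMatrix i).val.det = -1 := det_reflMatrix _ (form_wallVec_self i)
  have hj : (wallMatrix j).val.det = -1 := det_reflMatrix _ (form_wallVec_self j)
  have htr : (wallMatrix i * wallMatrix j).val.trace = -wallCoef i j := by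
    rw [← two_form_wallVec]
    simp [wallMatrix, reflMatrix, form, Matrix.trace_fin_two]
    ring
  rw [mul_self_of_det_eq_one _ (by rw [Units.val_mul, Matrix.det_mul, hi, hj]; norm_num), htr]

lemma wallMatrix_mul_pow_two {i j : Fin 3} (h0 : wallCoef i j = 0) :
    (wallMatrix i * wallMatrix j) ^ 2 = -1 := by
  have key := wallMatrix_mul_sq i j
  refine Units.ext ?_
  rw [Units.val_pow_eq_pow_val, sq, key, h0, neg_zero, zero_smul, zero_sub]
  rfl

lemma wallMatrix_mul_pow_three {i j : Fin 3} (h0 : wallCoef i j = 1) :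
    (wallMatrix i * wallMatrix j) ^ 3 = 1 := by
  have key := wallMatrix_mul_sq i j
  refine Units.ext ?_
  rw [h0] at key
  rw [Units.val_pow_eq_pow_val, pow_succ, sq, key, sub_mul, smul_mul_assoc, key, one_mul,
    Units.val_one]
  module

lemma wallMatrix_mul_pow_seven {i j : Fin 3} (h0 : wallCoef i j = lam) :
    (wallMatrix i * wallMatrix j) ^ 7 = 1 := by
  have key := wallMatrix_mul_sq i j
  refine Units.ext ?_
  rw [h0] at key
  rw [Units.val_pow_eq_pow_val, Units.val_one]
  generalize (wallMatrix i * wallMatrix j).val = M at key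
  have e3 : M * M * M = (lam ^ 2 - 1) • M + lam • (1 : Matrix (Fin 2) (Fin 2) ℝ) := by
    rw [key, sub_mul, smul_mul_assoc, key, one_mul]; module
  have : M ^ 7 = (M * M * M) * (M * M * M) * M := by noncomm_ring
  rw [this, e3]
  simp only [add_mul, mul_add, smul_mul_assoc, mul_smul_comm, one_mul, mul_one, key, sub_mul,
    smul_sub, smul_add, smul_smul]
  match_scalars
  · linear_combination (lam ^ 3 + lam ^ 2 - 2 * lam - 1) * lam_poly
  · linear_combination (lam ^ 2 + lam - 1) * lam_poly

lemma wallMatrix_mul_pow_smul (i j : Fin 3) (z : ℍ) :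
    (wallMatrix i * wallMatrix j) ^ (cox i j) • z = z := by
  have two : wallCoef i j = 0 → (wallMatrix i * wallMatrix j) ^ 2 • z = z := fun h0 => by
    rw [wallMatrix_mul_pow_two h0, UpperHalfPlane.neg_smul, one_smul]
  have three : wallCoef i j = 1 → (wallMatrix i * wallMatrix j) ^ 3 • z = z := fun h0 => by
    rw [wallMatrix_mul_pow_three h0, one_smul]
  have seven : wallCoef i j = lam → (wallMatrix i * wallMatrix j) ^ 7 • z = z := fun h0 => by
    rw [wallMatrix_mul_pow_seven h0, one_smul]
  have one : i = j → (wallMatrix i * wallMatrix j) ^ 1 • z = z := fun h0 => by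
    rw [pow_one, h0, mul_smul]
    exact reflMatrix_sq_smul _ _ z
  fin_cases i <;> fin_cases j
  · exact one rfl
  · exact two rfl
  · exact three rfl
  · exact two rfl
  · exact one rfl
  · exact seven rfl
  · exact three rfl
  · exact seven rfl
  · exact one rfl

/-! ### The reflection group acting on the upper half-plane -/

/-- The abstract Coxeter group of type `(2,3,7)`. -/
abbrev W : Type := cox.Group

/-- The tautological Coxeter system of `W`. -/
def cs : CoxeterSystem cox W := cox.toCoxeterSystem

lemma isLiftable_wallMatrix :
    cox.IsLiftable fun i => MulAction.toPermHom (GL (Fin 2) ℝ) ℍ (wallMatrix i) := by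
  intro i j
  rw [← map_mul, ← map_pow]
  ext1 z
  exact wallMatrix_mul_pow_smul i j z

/-- The action of `W` on `ℍ`, the simple reflections acting as the reflections in the sides of the
triangle. -/
def actHom : W →* Equiv.Perm ℍ :=
  cs.lift ⟨_, isLiftable_wallMatrix⟩

instance : MulAction W ℍ := MulAction.compHom ℍ actHom

lemma simple_smul (i : Fin 3) (z : ℍ) : cs.simple i • z = wallMatrix i • z := by
  change actHom (cs.simple i) z = _
  rw [actHom, cs.lift_apply_simple isLiftable_wallMatrix]
  rfl

lemma ht_simple_smul (i j : Fin 3) (z : ℍ) :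
    ht j (cs.simple i • z) = ht j z + wallCoef i j * ht i z := by
  rw [simple_smul]
  unfold ht
  rw [wallMatrix, lin_reflMatrix_smul, two_form_wallVec]
  ring

lemma ht_simple_smul_self (i : Fin 3) (z : ℍ) : ht i (cs.simple i • z) = -ht i z := by
  rw [ht_simple_smul]
  have : wallCoef i i = -2 := by fin_cases i <;> rfl
  rw [this]; ring

instance : IsIsometricSMul W ℍ := ⟨fun w => by
  induction w using cs.simple_induction_left with
  | one =>
    simp only [one_smul]
    exact isometry_id
  | mul_simple_left w i hw =>
    have h := (isometry_reflMatrix_smul (wallVec i) (form_wallVec_self i)).comp hw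
    convert h using 1
    funext z
    rw [mul_smul, simple_smul]
    rfl⟩

lemma ht_zero (z : ℍ) : ht 0 z = -z.re / z.im := by
  simp [ht, lin, wallVec]

lemma ht_one (z : ℍ) : ht 1 z = (1 - (z.re ^ 2 + z.im ^ 2)) / (2 * z.im) := by
  have := z.im_pos
  simp [ht, lin, wallVec]
  field_simp
  ring

lemma ht_two (z : ℍ) : ht 2 z = (rr * (z.re ^ 2 + z.im ^ 2) + z.re + qq) / (2 * z.im) := by
  have := z.im_pos
  simp [ht, lin, wallVec]
  field_simp

lemma ht_linear_combination (z : ℍ) :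
    2 * ht 2 z + ht 0 z + 2 * rr * ht 1 z = del / z.im := by
  have := z.im_pos
  rw [ht_zero, ht_one, ht_two, ← rr_add_qq]
  field_simp
  ring

/-- The equation of the hyperboloid in the coordinates `ht`. -/
lemma ht_quadratic (z : ℍ) :
    (2 * ht 2 z + ht 0 z + 2 * rr * ht 1 z) * (2 * ht 2 z + ht 0 z - 2 * qq * ht 1 z)
      = del ^ 2 * (1 + ht 0 z ^ 2) := by
  have := z.im_pos
  have h : 2 * ht 2 z + ht 0 z - 2 * qq * ht 1 z = del * (z.re ^ 2 + z.im ^ 2) / z.im := by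
    rw [ht_zero, ht_one, ht_two, ← rr_add_qq]
    field_simp
    ring
  rw [h, ht_linear_combination, ht_zero]
  field_simp
  ring

/-- The three heights of a point determine it. -/
lemma eq_of_ht_eq {z w : ℍ} (h : ∀ i, ht i z = ht i w) : z = w := by
  have him : z.im = w.im := by
    have h1 := ht_linear_combination z
    rw [h, h, h, ht_linear_combination] at h1
    have := z.im_pos
    have := w.im_pos
    have hd := del_pos
    field_simp at h1
    linarith
  have hre : z.re = w.re := by
    have h0 := h 0
    have := w.im_pos
    rw [ht_zero, ht_zero, him] at h0
    field_simp at h0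
    linarith
  exact UpperHalfPlane.ext (Complex.ext hre him)

/-- No point lies on all three sides. -/
lemma exists_ht_ne_zero (z : ℍ) : ∃ i, ht i z ≠ 0 := by
  by_contra! h
  have h1 := ht_linear_combination z
  rw [h, h, h] at h1
  have : 0 < del / z.im := div_pos del_pos z.im_pos
  linarith

lemma simple_smul_eq_self_iff (i : Fin 3) (z : ℍ) : cs.simple i • z = z ↔ ht i z = 0 := by
  constructor
  · intro h
    have := ht_simple_smul_self i z
    rw [h] at this
    linarith
  · intro h
    refine eq_of_ht_eq fun j => ?_
    rw [ht_simple_smul, h, mul_zero, add_zero]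

lemma continuous_lin (v : Fin 3 → ℝ) : Continuous (lin v) := by
  unfold lin
  have h1 : Continuous fun z : ℍ => z.re := UpperHalfPlane.continuous_re
  have h2 : Continuous fun z : ℍ => z.im := UpperHalfPlane.continuous_im
  exact Continuous.div (by fun_prop) h2 fun z => z.im_pos.ne'

@[fun_prop]
lemma continuous_ht (i : Fin 3) : Continuous (ht i) := continuous_lin _

/-- Every wall has empty interior: arbitrarily small horizontal translations leave it. -/
lemma exists_ht_ne_zero_near (i : Fin 3) (z : ℍ) {ε : ℝ} (hε : 0 < ε) :
    ∃ w, dist w z < ε ∧ ht i w ≠ 0 := by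
  have hcont : Continuous fun t : ℝ => t +ᵥ z := by
    rw [UpperHalfPlane.isEmbedding_coe.continuous_iff]
    simp only [Function.comp_def, coe_vadd]
    fun_prop
  obtain ⟨d, hd, hball⟩ := Metric.continuousAt_iff.1 (hcont.continuousAt (x := 0)) ε hε
  by_contra! hall
  have hz : ∀ t : ℝ, |t| < d → ht i (t +ᵥ z) = 0 := fun t ht => by
    refine hall _ ?_
    have := hball (x := t) (by simpa using ht)
    simpa using this
  have hy := z.im_pos
  have e : ∀ t : ℝ, |t| < d → wallVec i 0 * ((t + z.re) ^ 2 + z.im ^ 2)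
      + wallVec i 1 * (t + z.re) + wallVec i 2 = 0 := fun t ht' => by
    have := hz t ht'
    unfold ht lin at this
    rw [vadd_im, vadd_re, div_eq_zero_iff] at this
    exact this.resolve_right hy.ne'
  have h0 := e 0 (by simpa using hd)
  have h1 := e (d / 2) (by rw [abs_of_pos] <;> linarith)
  have h2 := e (-(d / 2)) (by rw [abs_neg, abs_of_pos] <;> linarith)
  -- a quadratic polynomial with three zeros vanishes, but the vector has norm one
  have hv := form_wallVec_self i
  have hv0 : wallVec i 0 = 0 := by
    have : wallVec i 0 * (d ^ 2 / 2) = 0 := by linear_combination h1 + h2 - 2 * h0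
    rcases mul_eq_zero.1 this with h | h
    · exact h
    · exact absurd h (by positivity)
  have hv1 : wallVec i 1 = 0 := by
    rw [hv0] at h0 h1
    have : wallVec i 1 * (d / 2) = 0 := by linear_combination h1 - h0
    rcases mul_eq_zero.1 this with h | h
    · exact h
    · exact absurd h (by positivity)
  unfold form at hv
  rw [hv0, hv1] at hv
  norm_num at hv

/-- A vector inside the cone over the triangle, so that `lin heightVec` is a multiple of the
hyperbolic cosine of the distance to an interior point of the triangle. -/
def heightVec : Fin 3 → ℝ := ![1, del / 2, 1 - del / 4]

lemma form_wallVec_heightVec_neg (i : Fin 3) : form (wallVec i) heightVec < 0 := by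
  have h1 := rr_mul_qq
  have h2 := rr_add_qq
  have hd := del_pos
  have hr := rr_lt
  fin_cases i <;> simp [form, wallVec, heightVec] <;> nlinarith

/-- The sublevel sets of `lin heightVec` are bounded. The point `I`, a vertex of the triangle, is
good enough as a centre for this. -/
lemma cosh_dist_I_le (z : ℍ) : Real.cosh (dist z I) ≤ lin heightVec z := by
  have hy := z.im_pos
  have hd := del_pos
  have hd1 := del_lt_one
  rw [UpperHalfPlane.cosh_dist, Complex.dist_eq, ← Complex.normSq_eq_norm_sq,
    Complex.normSq_apply]
  simp [lin, heightVec]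
  rw [add_comm, div_add' _ _ _ (by positivity), div_le_div_iff₀ (by positivity) hy]
  nlinarith [mul_pos hy hy, mul_nonneg hd.le (sq_nonneg (z.re + 1)), sq_nonneg z.re,
    mul_nonneg (sub_nonneg.2 hd1.le) (sq_nonneg z.re)]

lemma dist_I_le (z : ℍ) : dist z I ≤ lin heightVec z := by
  exact ((Real.self_le_sinh_iff.2 dist_nonneg).trans (Real.sinh_lt_cosh _).le).trans
    (cosh_dist_I_le z)

end

end TriangleReflection

/-! ### Reduction to the triangle -/

namespace TriangleReflection

open UpperHalfPlane Filter Topology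

noncomputable section

/-- `x'` arises from `x` by reflecting in a side which separates `x` from the triangle. -/
def Reduces (x' x : ℍ) : Prop := ∃ i, ht i x < 0 ∧ x' = cs.simple i • x

lemma height_simple_smul (i : Fin 3) (z : ℍ) :
    lin heightVec (cs.simple i • z)
      = lin heightVec z + (-2 * form (wallVec i) heightVec) * ht i z := by
  rw [simple_smul, wallMatrix, lin_reflMatrix_smul, ht]
  ring

/-- Heights which are positive at `y` are positive near `y`. -/
lemma exists_ball_ht_pos (y : ℍ) :
    ∃ r > 0, ∀ z, dist z y < r → ∀ i, 0 < ht i y → 0 < ht i z := by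
  have : ∀ᶠ z in 𝓝 y, ∀ i, 0 < ht i y → 0 < ht i z := by
    rw [eventually_all]
    intro i
    by_cases h : 0 < ht i y
    · filter_upwards [(continuous_ht i).continuousAt.eventually_const_lt h] with z hz _ using hz
    · exact Eventually.of_forall fun z h' => absurd h' h
  obtain ⟨r, hr, hball⟩ := Metric.eventually_nhds_iff.1 this
  exact ⟨r, hr, fun z hz => hball hz⟩

/-- Three indices, consecutive ones distinct, which avoid some index, alternate. -/
lemma fin_three_alternate : ∀ l a b c : Fin 3, a ≠ l → b ≠ l → c ≠ l → a ≠ b → b ≠ c → c = a := by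
  intros; omega

/-- A sequence of reductions cannot be infinite. The heights decrease, so it stays in a compact set;
near a cluster point `y` only reflections fixing `y` can be used from some time on, and there are at
most two of these, which must then alternate and generate a finite group. -/
lemma wellFounded_reduces : WellFounded Reduces := by
  rw [wellFounded_iff_isEmpty_descending_chain]
  refine ⟨fun ⟨x, hx⟩ => ?_⟩
  choose idx hneg hstep using hx
  set c : Fin 3 → ℝ := fun i => -2 * form (wallVec i) heightVec with hc
  have hcpos : ∀ i, 0 < c i := fun i => by
    have := form_wallVec_heightVec_neg i
    simp only [hc]; linarith
  have hh : ∀ n, lin heightVec (x (n + 1))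
      = lin heightVec (x n) + c (idx n) * ht (idx n) (x n) := fun n => by
    rw [hstep n, height_simple_smul]
  have hlt : ∀ n, lin heightVec (x (n + 1)) < lin heightVec (x n) := fun n => by
    rw [hh]
    have := mul_neg_of_pos_of_neg (hcpos (idx n)) (hneg n)
    linarith
  have hanti : StrictAnti fun n => lin heightVec (x n) := strictAnti_nat_of_succ_lt hlt
  have hmem : ∀ n, x n ∈ Metric.closedBall I (lin heightVec (x 0)) := fun n =>
    (dist_I_le (x n)).trans (hanti.antitone (Nat.zero_le n))
  obtain ⟨y, -, φ, hφ, hlim⟩ := (isCompact_closedBall I (lin heightVec (x 0))).tendsto_subseq hmem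
  have hconv : Tendsto (fun n => lin heightVec (x n)) atTop
      (𝓝 (⨅ n, lin heightVec (x n))) :=
    tendsto_atTop_ciInf hanti.antitone
      ⟨0, by rintro _ ⟨n, rfl⟩; exact dist_nonneg.trans (dist_I_le (x n))⟩
  -- the heights converge, so the amounts by which they drop tend to zero
  have hdrop : Tendsto (fun n => c (idx n) * ht (idx n) (x n)) atTop (𝓝 0) := by
    have h1 := (hconv.comp (tendsto_add_atTop_nat 1)).sub hconv
    rw [sub_self] at h1
    refine h1.congr fun n => ?_
    simp only [Function.comp_apply]
    rw [hh]; ring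
  have hev : ∀ᶠ n in atTop, ∀ i, ht i y < 0 →
      c i * ht i y / 2 < c (idx n) * ht (idx n) (x n) := by
    rw [eventually_all]
    intro i
    by_cases h : ht i y < 0
    · have : c i * ht i y / 2 < 0 := by
        have := mul_neg_of_pos_of_neg (hcpos i) h
        linarith
      filter_upwards [hdrop.eventually_const_lt this] with n hn _ using hn
    · exact Eventually.of_forall fun z h' => absurd h' h
  obtain ⟨N, hN⟩ := eventually_atTop.1 hev
  have hnear : ∀ᶠ z in 𝓝 y, ∀ i, ht i y < 0 → c i * ht i z < c i * ht i y / 2 := by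
    rw [eventually_all]
    intro i
    by_cases h : ht i y < 0
    · have hlt : c i * ht i y < c i * ht i y / 2 := by
        have := mul_neg_of_pos_of_neg (hcpos i) h
        linarith
      have hcont : Continuous fun z => c i * ht i z := by fun_prop
      filter_upwards [hcont.continuousAt.eventually_lt_const hlt] with z hz _ using hz
    · exact Eventually.of_forall fun z h' => absurd h' h
  obtain ⟨r₁, hr₁, hball₁⟩ := Metric.eventually_nhds_iff.1 hnear
  obtain ⟨r₂, hr₂, hball₂⟩ := exists_ball_ht_pos y
  set r := min r₁ r₂
  have hr : 0 < r := lt_min hr₁ hr₂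
  obtain ⟨n₀, hn₀, hx₀⟩ : ∃ n, N ≤ n ∧ dist (x n) y < r := by
    obtain ⟨k, hk, hk'⟩ := ((hφ.tendsto_atTop.eventually_ge_atTop N).and
      (hlim.eventually (Metric.ball_mem_nhds y hr))).exists
    exact ⟨φ k, hk, hk'⟩
  -- near `y`, a reflection in a wall that misses `y` is impossible: a wall with `y` on its positive
  -- side does not separate, and one with `y` on its negative side causes too large a drop
  have hzero : ∀ n, N ≤ n → dist (x n) y < r → ht (idx n) y = 0 := fun n hn hd => by
    by_contra hne
    rcases lt_or_gt_of_ne hne with h | h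
    · have h1 := hN n hn (idx n) h
      have h2 := hball₁ (hd.trans_le (min_le_left _ _)) (idx n) h
      linarith
    · have := hball₂ (x n) (hd.trans_le (min_le_right _ _)) (idx n) h
      linarith [hneg n]
  -- the reflections in walls through `y` preserve the distance to `y`
  have hstay : ∀ k, dist (x (n₀ + k)) y < r := by
    intro k
    induction k with
    | zero => exact hx₀
    | succ k ih =>
      have h0 := (simple_smul_eq_self_iff _ _).2 (hzero (n₀ + k) (by omega) ih)
      rw [← add_assoc, hstep, ← h0, dist_smul]
      exact ih
  have hz : ∀ k, ht (idx (n₀ + k)) y = 0 := fun k => hzero _ (by omega) (hstay k)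
  have hne : ∀ n, idx n ≠ idx (n + 1) := fun n h => by
    have h1 := hneg (n + 1)
    rw [← h, hstep, ht_simple_smul_self] at h1
    linarith [hneg n]
  obtain ⟨l, hl⟩ := exists_ht_ne_zero y
  have hnl : ∀ k, idx (n₀ + k) ≠ l := fun k h => hl (h ▸ hz k)
  -- consecutive reflections differ, and the walls through `y` are at most two, so they alternate
  have hper : ∀ k, idx (n₀ + k + 2) = idx (n₀ + k) := fun k =>
    fin_three_alternate l _ (idx (n₀ + k + 1)) _ (hnl k) (hnl (k + 1)) (hnl (k + 2)) (hne _) (hne _)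
  have heven : ∀ k, idx (n₀ + 2 * k) = idx n₀ ∧ idx (n₀ + 2 * k + 1) = idx (n₀ + 1) := by
    intro k
    induction k with
    | zero => exact ⟨rfl, rfl⟩
    | succ k ih =>
      refine ⟨(hper (2 * k)).trans ih.1, ?_⟩
      have := hper (2 * k + 1)
      rw [show n₀ + 2 * (k + 1) + 1 = n₀ + (2 * k + 1) + 2 by ring, this]
      exact ih.2
  have hpow : ∀ k, x (n₀ + 2 * k) =
      (cs.simple (idx (n₀ + 1)) * cs.simple (idx n₀)) ^ k • x n₀ := by
    intro k
    induction k with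
    | zero => simp
    | succ k ih =>
      rw [show n₀ + 2 * (k + 1) = n₀ + 2 * k + 1 + 1 by ring, hstep, hstep, (heven k).1,
        (heven k).2, ih, pow_succ', ← mul_smul, ← mul_smul, mul_assoc]
  -- the product of the two reflections has finite order, so the sequence returns to `x n₀`
  have hcyc := hpow (cox (idx (n₀ + 1)) (idx n₀))
  rw [cs.simple_mul_simple_pow, one_smul] at hcyc
  have hm : 0 < cox (idx (n₀ + 1)) (idx n₀) := by
    generalize idx (n₀ + 1) = a
    generalize idx n₀ = b
    fin_cases a <;> fin_cases b <;> exact Nat.succ_pos _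
  have := hanti (show n₀ < n₀ + 2 * cox (idx (n₀ + 1)) (idx n₀) by omega)
  simp only [hcyc] at this
  exact lt_irrefl _ this

open scoped Classical in
/-- The group element which the reduction process finds for `x`: the triangle is moved by it to a
translate containing `x`. -/
def loc : ℍ → W := wellFounded_reduces.fix fun x ih =>
  if h : ∃ i, ht i x < 0 then
    cs.simple h.choose * ih (cs.simple h.choose • x) ⟨_, h.choose_spec, rfl⟩
  else 1

lemma loc_of_nonneg {x : ℍ} (h : ∀ i, 0 ≤ ht i x) : loc x = 1 := by
  rw [loc, WellFounded.fix_eq, dif_neg]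
  push Not
  exact h

lemma exists_loc_eq {x : ℍ} (h : ∃ i, ht i x < 0) :
    ∃ i, ht i x < 0 ∧ loc x = cs.simple i * loc (cs.simple i • x) := by
  refine ⟨h.choose, h.choose_spec, ?_⟩
  rw [loc, WellFounded.fix_eq, dif_pos h]

/-- The Chebyshev sequence `sin (l π/m) / sin (π/m)`, where `t = 2 cos (π/m)`. -/
def cheb (t : ℝ) : ℕ → ℝ
  | 0 => 0
  | 1 => 1
  | l + 2 => t * cheb t (l + 1) - cheb t l

lemma cheb_nonneg {i j : Fin 3} (hij : i ≠ j) :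
    ∀ l < cox i j, 0 ≤ cheb (wallCoef i j) l ∧ 0 ≤ cheb (wallCoef i j) (l + 1) ∧
      0 < cheb (wallCoef i j) l + cheb (wallCoef i j) (l + 1) := by
  have two : ∀ l < 2, 0 ≤ cheb 0 l ∧ 0 ≤ cheb 0 (l + 1) ∧ 0 < cheb 0 l + cheb 0 (l + 1) := by
    intro l hl
    interval_cases l <;> norm_num [cheb]
  have three : ∀ l < 3, 0 ≤ cheb 1 l ∧ 0 ≤ cheb 1 (l + 1) ∧ 0 < cheb 1 l + cheb 1 (l + 1) := by
    intro l hl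
    interval_cases l <;> norm_num [cheb]
  have seven : ∀ l < 7, 0 ≤ cheb lam l ∧ 0 ≤ cheb lam (l + 1) ∧
      0 < cheb lam l + cheb lam (l + 1) := by
    have h1 := one_lt_lam
    have hp := lam_poly
    have c2 : cheb lam 2 = lam := by simp [cheb]
    have c3 : cheb lam 3 = lam ^ 2 - 1 := by simp [cheb]; ring
    have c4 : cheb lam 4 = lam ^ 2 - 1 := by
      rw [cheb, c3, c2]; linear_combination hp
    have c5 : cheb lam 5 = lam := by
      rw [cheb, c4, c3]; linear_combination hp
    have c6 : cheb lam 6 = 1 := by rw [cheb, c5, c4]; ring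
    have c7 : cheb lam 7 = 0 := by rw [cheb, c6, c5]; ring
    intro l hl
    have hsq : 0 < lam ^ 2 - 1 := by nlinarith
    interval_cases l <;>
      simp only [c2, c3, c4, c5, c6, c7, cheb.eq_1, cheb.eq_2, zero_add, Nat.reduceAdd] <;>
      refine ⟨?_, ?_, ?_⟩ <;> linarith
  fin_cases i <;> fin_cases j
  · exact absurd rfl hij
  · exact two
  · exact three
  · exact two
  · exact absurd rfl hij
  · exact seven
  · exact three
  · exact seven
  · exact absurd rfl hij

/-- Descending `k` times along alternating reflections, at points where the reduction is already
known to be independent of the choices. -/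
lemma loc_eq_alternating (i j : Fin 3) (k : ℕ) (z : ℍ)
    (hz : ∀ z', Relation.ReflTransGen Reduces z' z → ∀ i, ht i z' < 0 →
      loc z' = cs.simple i * loc (cs.simple i • z'))
    (hneg : ∀ l < k, cheb (wallCoef i j) (l + 1) * ht i z + cheb (wallCoef i j) l * ht j z < 0) :
    loc z = (cs.wordProd (CoxeterSystem.alternatingWord j i k))⁻¹ *
      loc (cs.wordProd (CoxeterSystem.alternatingWord j i k) • z) := by
  induction k generalizing i j z with
  | zero => simp [CoxeterSystem.alternatingWord]
  | succ k ih =>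
    have h0 : ht i z < 0 := by simpa [cheb] using hneg 0 (Nat.succ_pos k)
    have hsymm : wallCoef j i = wallCoef i j := by
      fin_cases i <;> fin_cases j <;> rfl
    rw [CoxeterSystem.alternatingWord_succ, cs.wordProd_concat, mul_inv_rev, cs.inv_simple,
      mul_smul, mul_assoc, ← ih j i (cs.simple i • z), ← hz z .refl i h0]
    · exact fun z' hz' => hz z' (hz'.tail ⟨i, h0, rfl⟩)
    · intro l hl
      have := hneg (l + 1) (by omega)
      rw [cheb] at this
      rw [ht_simple_smul, ht_simple_smul_self, hsymm]
      linarith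

/-- Local confluence, hence confluence, of the reduction process: `loc x` may be computed by
reflecting in any of the sides separating `x` from the triangle. If two sides `i` and `j` separate,
then both reductions pass through the point opposite to `x` in the vertex angle of these sides. -/
lemma loc_eq_simple_mul {i : Fin 3} {x : ℍ} (h : ht i x < 0) :
    loc x = cs.simple i * loc (cs.simple i • x) := by
  induction x using wellFounded_reduces.transGen.induction generalizing i with
  | _ x ih =>
  obtain ⟨j, hj, hloc⟩ := exists_loc_eq ⟨i, h⟩
  by_cases hij : i = j
  · rw [hij]; exact hloc
  have key : ∀ a b : Fin 3, a ≠ b → ht a x < 0 → ht b x < 0 →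
      cs.simple a * loc (cs.simple a • x) =
        (cs.wordProd (CoxeterSystem.braidWord cox b a))⁻¹ *
          loc (cs.wordProd (CoxeterSystem.braidWord cox b a) • x) := by
    intro a b hab ha hb
    have hsymm : wallCoef b a = wallCoef a b := by
      fin_cases a <;> fin_cases b <;> rfl
    obtain ⟨m, hm⟩ : ∃ m, cox b a = m + 1 := by
      refine ⟨cox b a - 1, ?_⟩
      fin_cases a <;> fin_cases b <;> rfl
    rw [CoxeterSystem.braidWord, hm, CoxeterSystem.alternatingWord_succ, cs.wordProd_concat,
      mul_inv_rev, cs.inv_simple, mul_smul, mul_assoc,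
      ← loc_eq_alternating b a m (cs.simple a • x)]
    · intro z' hz' i hi
      exact ih z' (Relation.TransGen.tail' hz' ⟨a, ha, rfl⟩) hi
    · intro l hl
      obtain ⟨h1, h2, h3⟩ := cheb_nonneg (Ne.symm hab) (l + 1) (by omega)
      rw [hsymm] at *
      rw [ht_simple_smul, ht_simple_smul_self]
      have e : cheb (wallCoef a b) (l + 2)
        = wallCoef a b * cheb (wallCoef a b) (l + 1) - cheb (wallCoef a b) l := by rw [cheb]
      have e2 : cheb (wallCoef a b) (l + 1) * (ht b x + wallCoef a b * ht a x)
          + cheb (wallCoef a b) l * -ht a x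
          = cheb (wallCoef a b) (l + 1) * ht b x + cheb (wallCoef a b) (l + 2) * ht a x := by
        rw [e]; ring
      rw [e2]
      rcases h1.eq_or_lt with h1 | h1
      · rw [← h1] at h3 ⊢
        rw [zero_mul, zero_add]
        exact mul_neg_of_pos_of_neg (by linarith) ha
      · have := mul_neg_of_pos_of_neg h1 hb
        have := mul_nonpos_of_nonneg_of_nonpos h2 ha.le
        linarith
  rw [hloc, key i j hij h hj, key j i (Ne.symm hij) hj h, cs.wordProd_braidWord_eq]

/-! ### The triangle is a strict fundamental domain -/

/-- The point of the triangle to which `x` reduces. -/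
def fold (x : ℍ) : ℍ := (loc x)⁻¹ • x

/-- The parabolic subgroup generated by the reflections in the sides through `y`. -/
def parab (y : ℍ) : Subgroup W := Subgroup.closure {w | ∃ i, ht i y = 0 ∧ w = cs.simple i}

lemma simple_mem_parab {i : Fin 3} {y : ℍ} (h : ht i y = 0) : cs.simple i ∈ parab y :=
  Subgroup.subset_closure ⟨i, h, rfl⟩

lemma smul_eq_of_mem_parab {w : W} {y : ℍ} (h : w ∈ parab y) : w • y = y := by
  have : parab y ≤ MulAction.stabilizer W y := by
    rw [parab, Subgroup.closure_le]
    rintro _ ⟨i, hi, rfl⟩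
    exact (simple_smul_eq_self_iff i y).2 hi
  exact this h

lemma fold_of_nonneg {x : ℍ} (h : ∀ i, 0 ≤ ht i x) : fold x = x := by
  rw [fold, loc_of_nonneg h, inv_one, one_smul]

lemma loc_simple_smul_of_ne {i : Fin 3} {x : ℍ} (h : ht i x ≠ 0) :
    loc (cs.simple i • x) = cs.simple i * loc x := by
  rcases lt_or_gt_of_ne h with h | h
  · rw [loc_eq_simple_mul h, ← mul_assoc, cs.simple_mul_simple_self, one_mul]
  · rw [loc_eq_simple_mul (i := i) (x := cs.simple i • x)
      (by rw [ht_simple_smul_self]; linarith), smul_smul, cs.simple_mul_simple_self, one_smul]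

lemma fold_simple_smul (i : Fin 3) (x : ℍ) : fold (cs.simple i • x) = fold x := by
  by_cases h : ht i x = 0
  · rw [(simple_smul_eq_self_iff i x).2 h]
  · rw [fold, loc_simple_smul_of_ne h, mul_inv_rev, mul_smul, inv_smul_smul]
    rfl

lemma fold_smul (w : W) (x : ℍ) : fold (w • x) = fold x := by
  induction w using cs.simple_induction_left with
  | one => rw [one_smul]
  | mul_simple_left w i hw => rw [mul_smul, fold_simple_smul, hw]

lemma fold_nonneg (x : ℍ) (i : Fin 3) : 0 ≤ ht i (fold x) := by
  induction x using wellFounded_reduces.induction with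
  | _ x ih =>
  by_cases h : ∃ j, ht j x < 0
  · obtain ⟨j, hj⟩ := h
    have := ih _ ⟨j, hj, rfl⟩
    rwa [fold_simple_smul] at this
  · push Not at h
    rw [fold_of_nonneg h]
    exact h i

lemma loc_smul_fold (x : ℍ) : loc x • fold x = x := smul_inv_smul _ _

/-- Near a point `x` the value of `loc` is locally constant up to the parabolic subgroup of the
sides through `fold x`. -/
lemma exists_loc_near (x : ℍ) :
    ∃ ε > 0, ∀ z, dist z x < ε → (loc x)⁻¹ * loc z ∈ parab (fold x) := by
  induction x using wellFounded_reduces.induction with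
  | _ x ih =>
  by_cases h : ∃ j, ht j x < 0
  · obtain ⟨j, hj⟩ := h
    obtain ⟨ε, hε, H⟩ := ih _ ⟨j, hj, rfl⟩
    have hev : ∀ᶠ z in 𝓝 x, ht j z < 0 :=
      (continuous_ht j).continuousAt.eventually_lt_const hj
    obtain ⟨δ, hδ, hball⟩ := Metric.eventually_nhds_iff.1 hev
    refine ⟨min ε δ, lt_min hε hδ, fun z hz => ?_⟩
    have h1 := H (cs.simple j • z) (by rw [dist_smul]; exact hz.trans_le (min_le_left _ _))
    rw [fold_simple_smul, loc_simple_smul_of_ne hj.ne,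
      loc_simple_smul_of_ne (hball (hz.trans_le (min_le_right _ _))).ne] at h1
    simpa [mul_assoc] using h1
  · push Not at h
    rw [fold_of_nonneg h, loc_of_nonneg h, inv_one]
    obtain ⟨r, hr, hball⟩ := exists_ball_ht_pos x
    refine ⟨r, hr, fun z hz => ?_⟩
    rw [one_mul]
    -- a point near `x` reduces by reflections in walls through `x` only, which do not change its
    -- distance to `x`
    induction z using wellFounded_reduces.induction with
    | _ z ihz =>
    by_cases h' : ∃ j, ht j z < 0
    · obtain ⟨j, hj⟩ := h'
      have h0 : ht j x = 0 := by
        by_contra hne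
        have := hball z hz j ((h j).lt_of_ne (Ne.symm hne))
        linarith
      rw [loc_eq_simple_mul hj]
      refine mul_mem (simple_mem_parab h0) (ihz _ ⟨j, hj, rfl⟩ ?_)
      rw [← (simple_smul_eq_self_iff j x).2 h0, dist_smul]
      exact hz
    · push Not at h'
      rw [loc_of_nonneg h']
      exact one_mem _

lemma loc_simple_smul_mem (i : Fin 3) (x : ℍ) :
    (loc (cs.simple i • x))⁻¹ * (cs.simple i * loc x) ∈ parab (fold x) := by
  by_cases h : ht i x = 0
  · -- move `x` slightly off the wall
    obtain ⟨ε, hε, H⟩ := exists_loc_near x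
    obtain ⟨w, hw, hw0⟩ := exists_ht_ne_zero_near i x hε
    have hfix := (simple_smul_eq_self_iff i x).2 h
    have h1 := H w hw
    have h2 := H (cs.simple i • w) (by rw [← hfix, dist_smul]; exact hw)
    rw [loc_simple_smul_of_ne hw0] at h2
    have := mul_mem h2 (inv_mem h1)
    rw [hfix]
    simpa [mul_assoc] using this
  · rw [loc_simple_smul_of_ne h, inv_mul_cancel]
    exact one_mem _

/-- `loc` is equivariant up to the parabolic subgroup of the folded point. -/
lemma loc_smul_mem (w : W) (x : ℍ) : (loc (w • x))⁻¹ * (w * loc x) ∈ parab (fold x) := by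
  induction w using cs.simple_induction_left with
  | one => simp
  | mul_simple_left w i hw =>
    have h := loc_simple_smul_mem i (w • x)
    rw [fold_smul] at h
    have := mul_mem h hw
    rw [mul_smul]
    simpa [mul_assoc] using this

/-- The stabilizer of a point of the triangle is a parabolic subgroup. -/
lemma mem_parab_of_smul_eq {w : W} {y : ℍ} (hy : ∀ i, 0 ≤ ht i y) (h : w • y = y) :
    w ∈ parab y := by
  have := loc_smul_mem w y
  rwa [h, loc_of_nonneg hy, fold_of_nonneg hy, inv_one, one_mul, mul_one] at this

lemma mem_parab_fold_of_smul_eq {w : W} {x : ℍ} (h : w • x = x) :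
    (loc x)⁻¹ * w * loc x ∈ parab (fold x) := by
  refine mem_parab_of_smul_eq (fold_nonneg x) ?_
  rw [mul_smul, mul_smul, loc_smul_fold, h]
  rfl

lemma smul_eq_of_fold_eq {x y : ℍ} (h : fold x = fold y) : (loc x * (loc y)⁻¹) • y = x := by
  rw [mul_smul]
  change loc x • fold y = x
  rw [← h, loc_smul_fold]

/-- The action of the reflection group is properly discontinuous. -/
lemma exists_smul_eq_of_dist_lt (z : ℍ) :
    ∃ ε > 0, ∀ (w : W) (x : ℍ), dist x z < ε → dist (w • x) z < ε → w • z = z := by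
  obtain ⟨ε, hε, H⟩ := exists_loc_near z
  obtain ⟨r, hr, hball⟩ := exists_ball_ht_pos (fold z)
  -- near `z`, the point `fold x` is at the same distance from `fold z` as `x` from `z`
  have hdist : ∀ x, dist x z < ε → dist (fold x) (fold z) = dist x z := fun x hx => by
    have h1 := smul_eq_of_mem_parab (H x hx)
    rw [mul_smul, inv_smul_eq_iff, loc_smul_fold] at h1
    rw [← dist_smul (loc x) (fold x), loc_smul_fold, h1]
  refine ⟨min ε r, lt_min hε hr, fun w x hx hwx => ?_⟩
  have hxε := hx.trans_le (min_le_left ε r)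
  have hsub : parab (fold x) ≤ parab (fold z) := by
    refine Subgroup.closure_mono ?_
    rintro _ ⟨i, hi, rfl⟩
    refine ⟨i, ?_, rfl⟩
    by_contra hne
    have := hball (fold x) (by rw [hdist x hxε]; exact hx.trans_le (min_le_right _ _)) i
      ((fold_nonneg z i).lt_of_ne (Ne.symm hne))
    exact this.ne' hi
  have h1 := H x hxε
  have h2 := H (w • x) (hwx.trans_le (min_le_left _ _))
  have h3 := mul_mem (mul_mem h2 (hsub (loc_smul_mem w x))) (inv_mem h1)
  have h4 : (loc z)⁻¹ * w * loc z ∈ parab (fold z) := by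
    convert h3 using 1
    group
  have h5 := smul_eq_of_mem_parab h4
  rw [mul_smul, mul_smul, loc_smul_fold, inv_smul_eq_iff, loc_smul_fold] at h5
  exact h5

end

end TriangleReflection

/-! ### The triangle group inside the reflection group -/

namespace TriangleReflection

open PresentedGroup

noncomputable section

lemma tri_rel_a : (of TriangleGen.a : Triangle237) ^ 2 = 1 := one_of_mem (by simp)

lemma tri_rel_b : (of TriangleGen.b : Triangle237) ^ 3 = 1 := one_of_mem (by simp)

lemma tri_rel_c : (of TriangleGen.c : Triangle237) ^ 7 = 1 := one_of_mem (by simp)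

lemma tri_rel_abc :
    (of TriangleGen.a : Triangle237) * of TriangleGen.b * of TriangleGen.c = 1 :=
  one_of_mem (by simp)

/-- Homomorphisms out of the triangle group. -/
def triLift {K : Type*} [Group K] (x y z : K) (hx : x ^ 2 = 1) (hy : y ^ 3 = 1) (hz : z ^ 7 = 1)
    (h : x * y * z = 1) : Triangle237 →* K :=
  toGroup (f := fun g => match g with
    | .a => x
    | .b => y
    | .c => z) (by
    rintro r (rfl | rfl | rfl | rfl) <;> simpa)

section

variable {K : Type*} [Group K] {x y z : K} {hx : x ^ 2 = 1} {hy : y ^ 3 = 1} {hz : z ^ 7 = 1}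
  {h : x * y * z = 1}

@[simp] lemma triLift_a : triLift x y z hx hy hz h (of TriangleGen.a) = x := toGroup.of _

@[simp] lemma triLift_b : triLift x y z hx hy hz h (of TriangleGen.b) = y := toGroup.of _

@[simp] lemma triLift_c : triLift x y z hx hy hz h (of TriangleGen.c) = z := toGroup.of _

end

lemma triHom_ext {K : Type*} [Group K] {f g : Triangle237 →* K}
    (ha : f (of .a) = g (of .a)) (hb : f (of .b) = g (of .b)) (hc : f (of .c) = g (of .c)) :
    f = g :=
  PresentedGroup.ext fun x => match x with
    | .a => ha
    | .b => hb
    | .c => hc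

lemma simple_rel_a : (cs.simple 1 * cs.simple 0) ^ 2 = 1 := cs.simple_mul_simple_pow 1 0

lemma simple_rel_b : (cs.simple 0 * cs.simple 2) ^ 3 = 1 := cs.simple_mul_simple_pow 0 2

lemma simple_rel_c : (cs.simple 2 * cs.simple 1) ^ 7 = 1 := cs.simple_mul_simple_pow 2 1

/-- The triangle group as the group of orientation-preserving elements of the reflection group. -/
def toW : Triangle237 →* W :=
  triLift (cs.simple 1 * cs.simple 0) (cs.simple 0 * cs.simple 2) (cs.simple 2 * cs.simple 1)
    simple_rel_a simple_rel_b simple_rel_c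
    (by
      have h := cs.simple_mul_simple_self
      calc cs.simple 1 * cs.simple 0 * (cs.simple 0 * cs.simple 2) * (cs.simple 2 * cs.simple 1)
          = cs.simple 1 * (cs.simple 0 * cs.simple 0) * (cs.simple 2 * cs.simple 2)
            * cs.simple 1 := by group
        _ = 1 := by rw [h, h, mul_one, mul_one, h])

lemma toW_a : toW (of .a) = cs.simple 1 * cs.simple 0 := triLift_a

lemma toW_b : toW (of .b) = cs.simple 0 * cs.simple 2 := triLift_b

lemma toW_c : toW (of .c) = cs.simple 2 * cs.simple 1 := triLift_c

/-- Conjugation by the reflection `simple 0`, as an automorphism of the triangle group. -/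
def conjRefl : Triangle237 →* Triangle237 :=
  triLift (of .a)⁻¹ (of .b)⁻¹ (of .b * of .a) (by rw [inv_pow, tri_rel_a, inv_one])
    (by rw [inv_pow, tri_rel_b, inv_one])
    (by
      have h : (of .b : Triangle237) * of .a = (of .a)⁻¹ * (of .c)⁻¹ * (of .a) := by
        rw [inv_eq_of_mul_eq_one_left tri_rel_abc]
        group
      have h2 := conj_pow (i := 7) (a := (of .a : Triangle237)⁻¹) (b := (of .c)⁻¹)
      rw [inv_inv] at h2
      rw [h, h2, inv_pow, tri_rel_c]
      group)
    (by group)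

lemma conjRefl_a : conjRefl (of .a) = (of .a)⁻¹ := triLift_a

lemma conjRefl_b : conjRefl (of .b) = (of .b)⁻¹ := triLift_b

lemma conjRefl_c : conjRefl (of .c) = of .b * of .a := triLift_c

lemma conjRefl_conjRefl (x : Triangle237) : conjRefl (conjRefl x) = x := by
  have : conjRefl.comp conjRefl = MonoidHom.id _ := by
    apply triHom_ext
    · simp [conjRefl_a]
    · simp [conjRefl_b]
    · simp only [MonoidHom.comp_apply, conjRefl_a, conjRefl_b, conjRefl_c, map_mul,
        MonoidHom.id_apply]
      rw [← mul_inv_rev]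
      exact inv_eq_of_mul_eq_one_right tri_rel_abc
  exact DFunLike.congr_fun this x

/-- The action of the simple reflections on the triangle group, which extends left translation. -/
def reflPerm : Fin 3 → Equiv.Perm Triangle237 :=
  let s : Equiv.Perm Triangle237 := ⟨conjRefl, conjRefl, conjRefl_conjRefl, conjRefl_conjRefl⟩
  ![s, Equiv.mulLeft (of .a) * s, s * Equiv.mulLeft (of .b)]

lemma reflPerm_zero (x : Triangle237) : reflPerm 0 x = conjRefl x := rfl

lemma reflPerm_one (x : Triangle237) : reflPerm 1 x = of .a * conjRefl x := rfl

lemma reflPerm_two (x : Triangle237) : reflPerm 2 x = (of .b)⁻¹ * conjRefl x := by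
  change conjRefl (of .b * x) = _
  rw [map_mul, conjRefl_b]

lemma isLiftable_reflPerm : cox.IsLiftable reflPerm := by
  have h00 : reflPerm 0 * reflPerm 0 = 1 := by
    ext x; simp [reflPerm_zero, conjRefl_conjRefl]
  have h11 : reflPerm 1 * reflPerm 1 = 1 := by
    ext x; simp [reflPerm_one, conjRefl_conjRefl, conjRefl_a]
  have h22 : reflPerm 2 * reflPerm 2 = 1 := by
    ext x; simp [reflPerm_two, conjRefl_conjRefl, conjRefl_b]
  have hL : ∀ (g : Triangle237) (n : ℕ), Equiv.mulLeft g ^ n = Equiv.mulLeft (g ^ n) :=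
      fun g n => by
    rw [Equiv.pow_mulLeft]
  have h10 : reflPerm 1 * reflPerm 0 = Equiv.mulLeft (of .a) := by
    ext x; simp [reflPerm_zero, reflPerm_one, conjRefl_conjRefl]
  have h02 : reflPerm 0 * reflPerm 2 = Equiv.mulLeft (of .b) := by
    ext x; simp [reflPerm_zero, reflPerm_two, conjRefl_conjRefl, conjRefl_b]
  have h21 : reflPerm 2 * reflPerm 1 = Equiv.mulLeft (of .c) := by
    ext x
    have : (of .b : Triangle237)⁻¹ * (of .a)⁻¹ = of .c := by
      rw [← mul_inv_rev]; exact inv_eq_of_mul_eq_one_right tri_rel_abc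
    simp [reflPerm_one, reflPerm_two, conjRefl_conjRefl, conjRefl_a, ← this]
  have hrev : ∀ (i j : Fin 3) (n : ℕ), reflPerm i * reflPerm i = 1 → reflPerm j * reflPerm j = 1 →
      (reflPerm i * reflPerm j) ^ n = 1 → (reflPerm j * reflPerm i) ^ n = 1 := by
    intro i j n hi hj h
    have : reflPerm j * reflPerm i = (reflPerm i * reflPerm j)⁻¹ := by
      rw [mul_inv_rev, inv_eq_of_mul_eq_one_right hi, inv_eq_of_mul_eq_one_right hj]
    rw [this, inv_pow, h, inv_one]
  have e10 : (reflPerm 1 * reflPerm 0) ^ 2 = 1 := by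
    rw [h10, hL, tri_rel_a]; exact Equiv.mulLeft_one
  have e02 : (reflPerm 0 * reflPerm 2) ^ 3 = 1 := by
    rw [h02, hL, tri_rel_b]; exact Equiv.mulLeft_one
  have e21 : (reflPerm 2 * reflPerm 1) ^ 7 = 1 := by
    rw [h21, hL, tri_rel_c]; exact Equiv.mulLeft_one
  intro i j
  fin_cases i <;> fin_cases j
  · exact (pow_one _).trans h00
  · exact hrev 1 0 2 h11 h00 e10
  · exact e02
  · exact e10
  · exact (pow_one _).trans h11
  · exact hrev 2 1 7 h22 h11 e21
  · exact hrev 0 2 3 h00 h22 e02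
  · exact e21
  · exact (pow_one _).trans h22

/-- `W` acts on the triangle group by `reflPerm`, in such a way that the triangle group acts on
itself by left translations. -/
lemma toW_injective : Function.Injective toW := by
  have key : (cs.lift ⟨reflPerm, isLiftable_reflPerm⟩).comp toW =
      MulAction.toPermHom Triangle237 Triangle237 := by
    apply triHom_ext <;> ext x <;>
      simp only [MonoidHom.comp_apply, toW_a, toW_b, toW_c, map_mul,
        cs.lift_apply_simple isLiftable_reflPerm, Equiv.Perm.mul_apply, reflPerm_zero,
        reflPerm_one, reflPerm_two, conjRefl_conjRefl, MulAction.toPermHom_apply,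
        MulAction.toPerm_apply, smul_eq_mul]
    · rw [map_inv, conjRefl_b, inv_inv]
    · rw [conjRefl_a, ← mul_assoc, ← mul_inv_rev,
        inv_eq_of_mul_eq_one_right tri_rel_abc]
  intro x y hxy
  have h : MulAction.toPermHom Triangle237 Triangle237 x
      = MulAction.toPermHom Triangle237 Triangle237 y := by
    rw [← key, MonoidHom.comp_apply, hxy, MonoidHom.comp_apply]
  have := DFunLike.congr_fun h 1
  simpa using this

/-- The orientation character of the reflection group. -/
def sgn : W →* ℤˣ := cs.lift ⟨fun _ => -1, fun i j => by simp⟩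

lemma sgn_simple (i : Fin 3) : sgn (cs.simple i) = -1 :=
  cs.lift_apply_simple (f := fun _ => (-1 : ℤˣ)) (fun i j => by simp) i

lemma sgn_toW (x : Triangle237) : sgn (toW x) = 1 := by
  have : sgn.comp toW = 1 := by
    apply triHom_ext <;> simp [toW_a, toW_b, toW_c, sgn_simple]
  exact DFunLike.congr_fun this x

lemma simple_zero_conj_toW (x : Triangle237) :
    cs.simple 0 * toW x * cs.simple 0 = toW (conjRefl x) := by
  have h := cs.simple_mul_simple_self
  have : ((MulAut.conj (cs.simple 0)).toMonoidHom).comp toW = toW.comp conjRefl := by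
    apply triHom_ext <;>
      simp [toW_a, toW_b, toW_c, conjRefl_a, conjRefl_b, conjRefl_c, mul_assoc]
  have := DFunLike.congr_fun this x
  simpa using this

/-- The triangle group has index two in the reflection group. -/
lemma mem_range_toW_or (w : W) : w ∈ toW.range ∨ w * cs.simple 0 ∈ toW.range := by
  have h0 : ∀ i, cs.simple i * cs.simple 0 ∈ toW.range := by
    intro i
    fin_cases i
    · exact ⟨1, by simp⟩
    · exact ⟨of .a, toW_a⟩
    · exact ⟨(of .b)⁻¹, by simp [toW_b]⟩
  have hstep : ∀ i w, w ∈ toW.range → cs.simple i * w * cs.simple 0 ∈ toW.range := by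
    rintro i _ ⟨x, rfl⟩
    have := mul_mem (h0 i) (⟨_, (simple_zero_conj_toW x).symm⟩ : _ ∈ toW.range)
    simpa [mul_assoc] using this
  induction w using cs.simple_induction_left with
  | one => exact Or.inl (one_mem _)
  | mul_simple_left w i hw =>
    rcases hw with hw | hw
    · exact Or.inr (hstep i w hw)
    · left
      have := hstep i _ hw
      simpa [mul_assoc] using this

lemma mem_range_toW_of_sgn {w : W} (h : sgn w = 1) : w ∈ toW.range := by
  rcases mem_range_toW_or w with hw | ⟨x, hx⟩
  · exact hw
  · have := sgn_toW x
    rw [hx, map_mul, h, sgn_simple] at this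
    exact absurd this (by decide)

/-! ### The Seifert group as a central extension -/

lemma sei_rel_a : (of SeifertGen.a : Seifert237) ^ 2 = of .t :=
  mk_eq_mk_of_mul_inv_mem (by simp)

lemma sei_rel_b : (of SeifertGen.b : Seifert237) ^ 3 = of .t :=
  mk_eq_mk_of_mul_inv_mem (by simp)

lemma sei_rel_c : (of SeifertGen.c : Seifert237) ^ 7 = of .t :=
  mk_eq_mk_of_mul_inv_mem (by simp)

lemma sei_rel_abc : (of SeifertGen.a : Seifert237) * of .b * of .c = of .t ^ 3 :=
  mk_eq_mk_of_mul_inv_mem (by simp)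

/-- Homomorphisms out of the Seifert group. -/
def seiLift {K : Type*} [Group K] (x y z t : K) (hx : x ^ 2 = t) (hy : y ^ 3 = t) (hz : z ^ 7 = t)
    (h : x * y * z = t ^ 3) : Seifert237 →* K :=
  toGroup (f := fun g => match g with
    | .a => x
    | .b => y
    | .c => z
    | .t => t) (by
    rintro r (rfl | rfl | rfl | rfl) <;> simpa [mul_inv_eq_one])

section

variable {K : Type*} [Group K] {x y z t : K} {hx : x ^ 2 = t} {hy : y ^ 3 = t} {hz : z ^ 7 = t}
  {h : x * y * z = t ^ 3}

@[simp] lemma seiLift_a : seiLift x y z t hx hy hz h (of SeifertGen.a) = x := toGroup.of _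

@[simp] lemma seiLift_b : seiLift x y z t hx hy hz h (of SeifertGen.b) = y := toGroup.of _

@[simp] lemma seiLift_c : seiLift x y z t hx hy hz h (of SeifertGen.c) = z := toGroup.of _

@[simp] lemma seiLift_t : seiLift x y z t hx hy hz h (of SeifertGen.t) = t := toGroup.of _

end

lemma sei_induction {H : Subgroup Seifert237} (ha : of .a ∈ H) (hb : of .b ∈ H) (hc : of .c ∈ H)
    (ht : of .t ∈ H) (g : Seifert237) : g ∈ H :=
  generated_by _ H (fun j => match j with
    | .a => ha
    | .b => hb
    | .c => hc
    | .t => ht) g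

/-- The fibre class. -/
abbrev tt : Seifert237 := of .t

lemma tt_mem_center : tt ∈ Subgroup.center Seifert237 := by
  rw [Subgroup.mem_center_iff]
  intro g
  have : g ∈ Subgroup.centralizer {tt} := by
    apply sei_induction <;> rw [Subgroup.mem_centralizer_singleton_iff]
    · rw [tt, ← sei_rel_a]; exact ((Commute.refl _).pow_right 2).eq
    · rw [tt, ← sei_rel_b]; exact ((Commute.refl _).pow_right 3).eq
    · rw [tt, ← sei_rel_c]; exact ((Commute.refl _).pow_right 7).eq
  exact Subgroup.mem_centralizer_singleton_iff.1 this

lemma tt_zpow_comm (k : ℤ) (g : Seifert237) : g * tt ^ k = tt ^ k * g :=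
  Subgroup.mem_center_iff.1 (Subgroup.zpow_mem _ tt_mem_center k) g

/-- The projection to the triangle group killing the fibre class. -/
def proj : Seifert237 →* Triangle237 :=
  seiLift (of .a) (of .b) (of .c) 1 tri_rel_a tri_rel_b tri_rel_c
    (by rw [one_pow]; exact tri_rel_abc)

lemma proj_tt : proj tt = 1 := seiLift_t

instance normal_zpowers_tt : (Subgroup.zpowers tt).Normal := ⟨fun n hn g => by
  obtain ⟨k, rfl⟩ := Subgroup.mem_zpowers_iff.1 hn
  rw [tt_zpow_comm, mul_inv_cancel_right]
  exact hn⟩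

/-- The presentation of `G` becomes that of the triangle group when `t` is killed. -/
lemma ker_proj : proj.ker = Subgroup.zpowers tt := by
  apply le_antisymm
  · let q := QuotientGroup.mk' (Subgroup.zpowers tt)
    have hq : q tt = 1 := (QuotientGroup.eq_one_iff _).2 (Subgroup.mem_zpowers tt)
    let φ : Triangle237 →* Seifert237 ⧸ Subgroup.zpowers tt :=
      triLift (q (of .a)) (q (of .b)) (q (of .c))
        (by rw [← map_pow, sei_rel_a]; exact hq) (by rw [← map_pow, sei_rel_b]; exact hq)
        (by rw [← map_pow, sei_rel_c]; exact hq)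
        (by rw [← map_mul, ← map_mul, sei_rel_abc, map_pow]; erw [hq]; exact one_pow _)
    have hφ : φ.comp proj = q := by
      refine PresentedGroup.ext fun x => ?_
      match x with
      | .a => simp [φ, proj]
      | .b => simp [φ, proj]
      | .c => simp [φ, proj]
      | .t =>
        rw [MonoidHom.comp_apply]
        erw [proj_tt, hq]
        exact map_one _
    intro g hg
    have : q g = 1 := by rw [← hφ, MonoidHom.comp_apply, MonoidHom.mem_ker.1 hg, map_one]
    exact (QuotientGroup.eq_one_iff g).1 this
  · rw [Subgroup.zpowers_le]
    exact proj_tt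

lemma proj_surjective : Function.Surjective proj := by
  rw [← MonoidHom.range_eq_top, eq_top_iff]
  intro x _
  refine generated_by _ proj.range (fun j => ?_) x
  match j with
  | .a => exact ⟨of .a, seiLift_a⟩
  | .b => exact ⟨of .b, seiLift_b⟩
  | .c => exact ⟨of .c, seiLift_c⟩

/-- The Seifert group is generated by squares. -/
lemma sei_mem_of_sq_mem {H : Subgroup Seifert237} (h : ∀ g : Seifert237, g ^ 2 ∈ H)
    (g : Seifert237) : g ∈ H := by
  have ht : tt ∈ H := by rw [tt, ← sei_rel_a]; exact h _
  have hb : of .b ∈ H := by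
    have e : (of .b : Seifert237) = tt * ((of .b) ^ 2)⁻¹ := by rw [tt, ← sei_rel_b]; group
    rw [e]; exact mul_mem ht (inv_mem (h _))
  have hc : of .c ∈ H := by
    have e : (of .c : Seifert237) = tt * (((of .c) ^ 3) ^ 2)⁻¹ := by rw [tt, ← sei_rel_c]; group
    rw [e]; exact mul_mem ht (inv_mem (h _))
  have ha : of .a ∈ H := by
    have e : (of .a : Seifert237) = tt ^ 3 * (of .c)⁻¹ * (of .b)⁻¹ := by
      rw [tt, ← sei_rel_abc]; group
    rw [e]; exact mul_mem (mul_mem (pow_mem ht 3) (inv_mem hc)) (inv_mem hb)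
  exact sei_induction ha hb hc ht g

end

end TriangleReflection

/-! ### Rotation angles -/

namespace TriangleReflection

open UpperHalfPlane PresentedGroup
open scoped MatrixGroups

noncomputable section

/-- The rotation matrix of the generator `a`, normalised to have positive lower left entry. -/
def rotA : GL (Fin 2) ℝ := -(wallMatrix 1 * wallMatrix 0)

/-- The rotation matrix of the generator `b`, normalised to have positive lower left entry. -/
def rotB : GL (Fin 2) ℝ := -(wallMatrix 0 * wallMatrix 2)

/-- The rotation matrix of the generator `c`, normalised to have positive lower left entry. -/
def rotC : GL (Fin 2) ℝ := -(wallMatrix 2 * wallMatrix 1)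

lemma det_neg_wallMatrix_mul (i j : Fin 3) : (-(wallMatrix i * wallMatrix j)).det.val = 1 := by
  have hi : (wallMatrix i).val.det = -1 := det_reflMatrix _ (form_wallVec_self i)
  have hj : (wallMatrix j).val.det = -1 := det_reflMatrix _ (form_wallVec_self j)
  change (-(wallMatrix i * wallMatrix j) : GL (Fin 2) ℝ).val.det = 1
  rw [Units.val_neg, Matrix.det_neg, Units.val_mul, Matrix.det_mul, hi, hj]
  norm_num

lemma rotA_smul (z : ℍ) : rotA • z = toW (of .a) • z := by
  rw [rotA, UpperHalfPlane.neg_smul, toW_a, mul_smul, mul_smul, simple_smul, simple_smul]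

lemma rotB_smul (z : ℍ) : rotB • z = toW (of .b) • z := by
  rw [rotB, UpperHalfPlane.neg_smul, toW_b, mul_smul, mul_smul, simple_smul, simple_smul]

lemma rotC_smul (z : ℍ) : rotC • z = toW (of .c) • z := by
  rw [rotC, UpperHalfPlane.neg_smul, toW_c, mul_smul, mul_smul, simple_smul, simple_smul]

lemma rotA_pow : rotA ^ 2 = -1 := by
  rw [rotA, neg_sq, wallMatrix_mul_pow_two rfl]

lemma rotB_pow : rotB ^ 3 = -1 := by
  rw [rotB, Odd.neg_pow (by decide), wallMatrix_mul_pow_three rfl]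

lemma rotC_pow : rotC ^ 7 = -1 := by
  rw [rotC, Odd.neg_pow (by decide), wallMatrix_mul_pow_seven rfl]

lemma wallMatrix_mul_self (i : Fin 3) : wallMatrix i * wallMatrix i = 1 := by
  have h := form_wallVec_self i
  unfold form at h
  ext k l
  fin_cases k <;> fin_cases l <;> simp [wallMatrix, reflMatrix] <;> linarith

lemma rotA_mul_rotB_mul_rotC : rotA * rotB * rotC = -1 := by
  have h := wallMatrix_mul_self
  rw [rotA, rotB, rotC, neg_mul_neg, mul_neg]
  congr 1
  calc wallMatrix 1 * wallMatrix 0 * (wallMatrix 0 * wallMatrix 2) * (wallMatrix 2 * wallMatrix 1)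
      = wallMatrix 1 * (wallMatrix 0 * wallMatrix 0) * (wallMatrix 2 * wallMatrix 2)
        * wallMatrix 1 := by group
    _ = 1 := by rw [h, h, mul_one, mul_one, h]

lemma denom_rotA (z : ℂ) : denom rotA z = z := by
  simp [denom, rotA, wallMatrix, reflMatrix, wallVec]
  ring

lemma denom_rotB (z : ℂ) : denom rotB z = rr * z + 1 / 2 := by
  simp [denom, rotB, wallMatrix, reflMatrix, wallVec]
  left; ring

lemma denom_rotC (z : ℂ) : denom rotC z = 1 / 2 * z + rr := by
  simp [denom, rotC, wallMatrix, reflMatrix, wallVec]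
  ring

/-- The rotation angle of the automorphy factor `cz + d` of a matrix at `z`. -/
def ang (g : GL (Fin 2) ℝ) (z : ℍ) : ℝ := (denom g z).arg

lemma im_denom (g : GL (Fin 2) ℝ) (z : ℍ) : (denom g z).im = g 1 0 * z.im := by
  simp [denom]

lemma ang_mem {g : GL (Fin 2) ℝ} (hc : 0 < g 1 0) (z : ℍ) : 0 < ang g z ∧ ang g z < Real.pi := by
  have him : 0 < (denom g z).im := by rw [im_denom]; exact mul_pos hc z.im_pos
  refine ⟨lt_of_le_of_ne (Complex.arg_nonneg_iff.2 him.le) fun h => ?_,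
    lt_of_le_of_ne (Complex.arg_le_pi _) fun h => ?_⟩
  · exact him.ne' (Complex.arg_eq_zero_iff.1 h.symm).2
  · exact him.ne' (Complex.arg_eq_pi_iff.1 h).2

lemma continuous_ang {g : GL (Fin 2) ℝ} (hc : 0 < g 1 0) : Continuous (ang g) := by
  have h : Continuous fun z : ℍ => denom g z := by
    unfold denom
    have : Continuous fun z : ℍ => (z : ℂ) := UpperHalfPlane.continuous_coe
    fun_prop
  refine continuous_iff_continuousAt.2 fun z => ?_
  refine ContinuousAt.comp (g := Complex.arg) (Complex.continuousAt_arg ?_) h.continuousAt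
  refine Or.inr ?_
  rw [im_denom]
  exact (mul_pos hc z.im_pos).ne'

/-- If complex numbers have product `-1`, then their arguments add up to an odd multiple of `π`. -/
lemma cos_sum_arg {ι : Type*} (s : Finset ι) (w : ι → ℂ) (h : ∏ k ∈ s, w k = -1) :
    Real.cos (∑ k ∈ s, (w k).arg) = -1 := by
  have h1 : ((∏ k ∈ s, ‖w k‖ : ℝ) : ℂ) * Complex.exp ((∑ k ∈ s, (w k).arg : ℝ) * Complex.I) =
      -1 := by
    rw [← h]
    push_cast
    rw [Finset.sum_mul, Complex.exp_sum, ← Finset.prod_mul_distrib]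
    exact Finset.prod_congr rfl fun k _ => Complex.norm_mul_exp_arg_mul_I (w k)
  have h2 : (∏ k ∈ s, ‖w k‖ : ℝ) = 1 := by
    rw [← norm_prod, h]; simp
  rw [h2, Complex.ofReal_one, one_mul] at h1
  have := congrArg Complex.re h1
  rwa [Complex.exp_ofReal_mul_I_re] at this

lemma denom_mul_of_det_pos (g h : GL (Fin 2) ℝ) (hh : 0 < h.det.val) (z : ℍ) :
    denom (g * h) z = denom g (h • z : ℍ) * denom h z := by
  rw [denom_cocycle g h z.im_ne_zero, coe_smul_of_det_pos hh]

lemma denom_pow (g : GL (Fin 2) ℝ) (hg : 0 < g.det.val) (p : ℕ) (z : ℍ) :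
    denom (g ^ p) z = ∏ k ∈ Finset.range p, denom g (g ^ k • z : ℍ) := by
  induction p with
  | zero => simp
  | succ p ih =>
    have : 0 < (g ^ p).det.val := by
      rw [map_pow, Units.val_pow_eq_pow_val]; positivity
    rw [Finset.prod_range_succ, ← ih, pow_succ', denom_mul_of_det_pos _ _ this, mul_comm]

lemma denom_neg_one (z : ℂ) : denom (-1) z = -1 := by simp [denom]

/-- The angles of the iterates of a rotation of order `p` sum up to `π` at every point: the sum is
an odd multiple of `π` everywhere, and it is `π` at the fixed point. -/
lemma sum_ang_pow {g : GL (Fin 2) ℝ} (hg : 0 < g.det.val) (hc : 0 < g 1 0) {p : ℕ} (hp : p ≠ 0)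
    (hpow : g ^ p = -1) {z₀ : ℍ} (hfix : g • z₀ = z₀) (hang : ang g z₀ = Real.pi / p) (z : ℍ) :
    ∑ k ∈ Finset.range p, ang g (g ^ k • z) = Real.pi := by
  set S : ℍ → ℝ := fun z => ∑ k ∈ Finset.range p, ang g (g ^ k • z) with hS
  have hcont : Continuous S :=
    continuous_finsetSum _ fun k _ => (continuous_ang hc).comp (continuous_const_smul _)
  have hcos : ∀ z, Real.cos (S z) = -1 := fun z =>
    cos_sum_arg _ _ (by rw [← denom_pow g hg, hpow, denom_neg_one])
  have h₀ : S z₀ = Real.pi := by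
    have : ∀ k : ℕ, g ^ k • z₀ = z₀ := fun k => by
      induction k with
      | zero => simp
      | succ k ih => rw [pow_succ, mul_smul, hfix, ih]
    simp only [hS, this, hang, Finset.sum_const, Finset.card_range, nsmul_eq_mul]
    field_simp
  have hrange : ∀ v, (S z₀ ≤ v ∧ v ≤ S z ∨ S z ≤ v ∧ v ≤ S z₀) → Real.cos v = -1 := by
    rintro v (⟨h1, h2⟩ | ⟨h1, h2⟩)
    · obtain ⟨u, rfl⟩ := mem_range_of_exists_le_of_exists_ge hcont ⟨z₀, h1⟩ ⟨z, h2⟩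
      exact hcos u
    · obtain ⟨u, rfl⟩ := mem_range_of_exists_le_of_exists_ge hcont ⟨z, h1⟩ ⟨z₀, h2⟩
      exact hcos u
  have huniq : ∀ v, 0 ≤ v → v ≤ 2 * Real.pi → Real.cos v = -1 → v = Real.pi := by
    intro v h1 h2 h3
    have h4 : Real.cos (v - Real.pi) = 1 := by rw [Real.cos_sub_pi, h3, neg_neg]
    have := (Real.cos_eq_one_iff_of_lt_of_lt (by linarith [Real.pi_pos])
      (by linarith [Real.pi_pos])).1 h4
    linarith
  by_contra hne
  have hpi := Real.pi_pos
  rcases lt_or_gt_of_ne hne with h | h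
  · have h1 := huniq (max (S z) 0) (le_max_right _ _) (max_le (by linarith) (by linarith))
      (hrange _ (Or.inr ⟨le_max_left _ _, by rw [h₀]; exact max_le h.le hpi.le⟩))
    exact (max_lt h hpi).ne h1
  · have h1 := huniq (min (S z) (2 * Real.pi)) (le_min (by linarith) (by linarith))
      (min_le_right _ _) (hrange _ (Or.inl ⟨by rw [h₀]; exact le_min h.le (by linarith),
        min_le_left _ _⟩))
    exact (lt_min h (by linarith)).ne' h1

/-! ### The vertices of the triangle -/

/-- The vertex at which the angle is `π/2`. -/
def vA : ℍ := I

/-- The vertex at which the angle is `π/3`. -/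
def vB : ℍ := ⟨⟨0, √3 / (2 * rr)⟩, by
  have := rr_pos
  have : 0 < √3 := by positivity
  change 0 < √3 / (2 * rr)
  positivity⟩

/-- The vertex at which the angle is `π/7`. -/
def vC : ℍ := ⟨⟨2 * (Real.cos (Real.pi / 7) - rr), 2 * Real.sin (Real.pi / 7)⟩, by
  have : 0 < Real.sin (Real.pi / 7) :=
    Real.sin_pos_of_pos_of_lt_pi (by positivity) (by linarith [Real.pi_pos])
  change 0 < 2 * Real.sin (Real.pi / 7)
  linarith⟩

lemma ht_vA : ht 0 vA = 0 ∧ ht 1 vA = 0 := by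
  rw [ht_zero, ht_one]
  simp [vA]

lemma ht_vB : ht 0 vB = 0 ∧ ht 2 vB = 0 := by
  have hr := rr_pos
  have hre : vB.re = 0 := rfl
  have him : vB.im = √3 / (2 * rr) := rfl
  have h3 : √3 ^ 2 = 3 := Real.sq_sqrt (by norm_num)
  refine ⟨by rw [ht_zero, hre]; simp, ?_⟩
  rw [ht_two, hre, him, div_pow, mul_pow, h3, div_eq_zero_iff]
  left
  have := rr_mul_qq
  field_simp
  linarith

lemma ht_vC : ht 1 vC = 0 ∧ ht 2 vC = 0 := by
  have hre : vC.re = 2 * (Real.cos (Real.pi / 7) - rr) := rfl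
  have him : vC.im = 2 * Real.sin (Real.pi / 7) := rfl
  have h1 := Real.sin_sq_add_cos_sq (Real.pi / 7)
  have h2 := rr_mul_qq
  have h3 := rr_sub_qq
  have hl : Real.cos (Real.pi / 7) = lam / 2 := by unfold lam; ring
  have hN : vC.re ^ 2 + vC.im ^ 2 = 1 := by
    rw [hre, him]
    linear_combination 4 * h1 - 8 * rr * hl + 4 * h2 + 4 * rr * h3
  rw [ht_one, ht_two, hN, hre, hl]
  refine ⟨by simp, ?_⟩
  rw [div_eq_zero_iff]
  left
  linear_combination -h3

lemma ang_rotA_vA : ang rotA vA = Real.pi / (2 : ℕ) := by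
  rw [ang, denom_rotA]
  simp [vA]

lemma ang_rotB_vB : ang rotB vB = Real.pi / (3 : ℕ) := by
  have hr := rr_pos
  have : denom rotB vB = Complex.exp ((Real.pi / 3 : ℝ) * Complex.I) := by
    rw [denom_rotB]
    apply Complex.ext
    · rw [Complex.exp_ofReal_mul_I_re, Real.cos_pi_div_three]; simp [vB]
    · rw [Complex.exp_ofReal_mul_I_im, Real.sin_pi_div_three]
      simp [vB]
      field_simp
  rw [ang, this, Complex.arg_exp_mul_I, (toIocMod_eq_self Real.two_pi_pos).2]
  · norm_num
  · constructor <;> linarith [Real.pi_pos]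

lemma ang_rotC_vC : ang rotC vC = Real.pi / (7 : ℕ) := by
  have : denom rotC vC = Complex.exp ((Real.pi / 7 : ℝ) * Complex.I) := by
    rw [denom_rotC]
    apply Complex.ext
    · rw [Complex.exp_ofReal_mul_I_re]; simp [vC]
    · rw [Complex.exp_ofReal_mul_I_im]
      simp [vC]
  rw [ang, this, Complex.arg_exp_mul_I, (toIocMod_eq_self Real.two_pi_pos).2]
  · norm_num
  · constructor <;> linarith [Real.pi_pos]

lemma toW_a_smul_vA : toW (of .a) • vA = vA := by
  rw [toW_a, mul_smul, (simple_smul_eq_self_iff 0 _).2 ht_vA.1,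
    (simple_smul_eq_self_iff 1 _).2 ht_vA.2]

lemma toW_b_smul_vB : toW (of .b) • vB = vB := by
  rw [toW_b, mul_smul, (simple_smul_eq_self_iff 2 _).2 ht_vB.2,
    (simple_smul_eq_self_iff 0 _).2 ht_vB.1]

lemma toW_c_smul_vC : toW (of .c) • vC = vC := by
  rw [toW_c, mul_smul, (simple_smul_eq_self_iff 1 _).2 ht_vC.1,
    (simple_smul_eq_self_iff 2 _).2 ht_vC.2]

/-! ### The Seifert group acting on `ℍ × ℝ` -/

/-- The homeomorphism `(z, s) ↦ (w • z, s + φ z)`. -/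
def shear (w : W) (φ : ℍ → ℝ) (hφ : Continuous φ) : (ℍ × ℝ) ≃ₜ (ℍ × ℝ) where
  toFun x := (w • x.1, x.2 + φ x.1)
  invFun x := (w⁻¹ • x.1, x.2 - φ (w⁻¹ • x.1))
  left_inv x := by simp
  right_inv x := by simp
  continuous_toFun := by
    have := isometry_smul ℍ w |>.continuous
    fun_prop
  continuous_invFun := by
    have := isometry_smul ℍ w⁻¹ |>.continuous
    fun_prop

@[simp] lemma shear_apply (w : W) (φ : ℍ → ℝ) (hφ : Continuous φ) (x : ℍ × ℝ) :
    shear w φ hφ x = (w • x.1, x.2 + φ x.1) := rfl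

lemma shear_pow_apply (w : W) (φ : ℍ → ℝ) (hφ : Continuous φ) (p : ℕ) (x : ℍ × ℝ) :
    (shear w φ hφ ^ p) x = (w ^ p • x.1, x.2 + ∑ k ∈ Finset.range p, φ (w ^ k • x.1)) := by
  induction p with
  | zero => simp
  | succ p ih =>
    rw [pow_succ']
    change shear w φ hφ ((shear w φ hφ ^ p) x) = _
    rw [ih, shear_apply, pow_succ', mul_smul, Finset.sum_range_succ, add_assoc]

/-- The angle function of a rotation, rescaled so that an angle of `π` becomes `85`, and shifted
by `n`. -/
def shift (g : GL (Fin 2) ℝ) (n : ℝ) (z : ℍ) : ℝ := 85 / Real.pi * ang g z - n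

lemma continuous_shift {g : GL (Fin 2) ℝ} (hc : 0 < g 1 0) (n : ℝ) : Continuous (shift g n) :=
  ((continuous_ang hc).const_mul _).sub continuous_const

lemma rotA_pos : 0 < rotA 1 0 := by
  simp [rotA, wallMatrix, reflMatrix, wallVec]
  norm_num

lemma rotB_pos : 0 < rotB 1 0 := by simp [rotB, wallMatrix, reflMatrix, wallVec, rr_pos]

lemma rotC_pos : 0 < rotC 1 0 := by
  simp [rotC, wallMatrix, reflMatrix, wallVec]
  norm_num

/-- A rotation of order `p` lifts to a `p`-th root of the translation by `1`: its angles sum up to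
`π`, which `shift` rescales to `85`, so `n` has to be `84 / p`. -/
lemma shear_pow_eq {x : Triangle237} {g : GL (Fin 2) ℝ} (hgx : ∀ z : ℍ, g • z = toW x • z)
    (hg : 0 < g.det.val) (hc : 0 < g 1 0) {p : ℕ} (hp : p ≠ 0) (hpow : g ^ p = -1)
    (hx : x ^ p = 1) {z₀ : ℍ} (hfix : toW x • z₀ = z₀) (hang : ang g z₀ = Real.pi / p) {n : ℝ}
    (hn : 85 - p * n = 1) :
    shear (toW x) (shift g n) (continuous_shift hc n) ^ p
      = shear 1 (fun _ => 1) continuous_const := by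
  have hk : ∀ (k : ℕ) (z : ℍ), toW x ^ k • z = g ^ k • z := fun k z => by
    induction k with
    | zero => simp
    | succ k ih => rw [pow_succ' (toW x), pow_succ' g, mul_smul, mul_smul, ih, hgx]
  have hsum := sum_ang_pow hg hc hp hpow ((hgx z₀).trans hfix) hang
  ext1 y
  rw [shear_pow_apply, ← map_pow, hx, map_one, shear_apply]
  congr 2
  simp only [shift, hk, Finset.sum_sub_distrib, ← Finset.mul_sum, hsum, Finset.sum_const,
    Finset.card_range, nsmul_eq_mul]
  rw [div_mul_cancel₀ _ Real.pi_ne_zero, hn]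

/-- The action of the Seifert group on `ℍ × ℝ`, covering the action of the triangle group on `ℍ`.
The constants are `84 / 2`, `84 / 3` and `84 / 7`; since `85 - (42 + 28 + 12) = 3`, the product of
the three lifts is the translation by `3`. -/
def coverHom : Seifert237 →* ((ℍ × ℝ) ≃ₜ (ℍ × ℝ)) :=
  seiLift (shear (toW (of .a)) (shift rotA 42) (continuous_shift rotA_pos _))
    (shear (toW (of .b)) (shift rotB 28) (continuous_shift rotB_pos _))
    (shear (toW (of .c)) (shift rotC 12) (continuous_shift rotC_pos _))
    (shear 1 (fun _ => 1) continuous_const)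
    (shear_pow_eq rotA_smul (by rw [rotA, det_neg_wallMatrix_mul]; norm_num) rotA_pos two_ne_zero
      rotA_pow tri_rel_a toW_a_smul_vA ang_rotA_vA (by norm_num))
    (shear_pow_eq rotB_smul (by rw [rotB, det_neg_wallMatrix_mul]; norm_num) rotB_pos three_ne_zero
      rotB_pow tri_rel_b toW_b_smul_vB ang_rotB_vB (by norm_num))
    (shear_pow_eq rotC_smul (by rw [rotC, det_neg_wallMatrix_mul]; norm_num) rotC_pos (by norm_num)
      rotC_pow tri_rel_c toW_c_smul_vC ang_rotC_vC (by norm_num))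
    (by
      have hB : 0 < rotB.det.val := by rw [rotB, det_neg_wallMatrix_mul]; norm_num
      have hC : 0 < rotC.det.val := by rw [rotC, det_neg_wallMatrix_mul]; norm_num
      ext1 y
      rw [shear_pow_apply]
      simp only [Homeomorph.mul_apply, shear_apply]
      have h1 : toW (of .a) • toW (of .b) • toW (of .c) • y.1 = y.1 := by
        rw [smul_smul, smul_smul, ← map_mul, ← map_mul, tri_rel_abc, map_one, one_smul]
      have hsum : ang rotC y.1 + ang rotB (rotC • y.1) + ang rotA (rotB • rotC • y.1)
          = Real.pi := by
        -- the sum is an odd multiple of `π` strictly between `0` and `3π`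
        have hcos := cos_sum_arg Finset.univ
          ![denom rotC y.1, denom rotB (rotC • y.1 : ℍ), denom rotA (rotB • rotC • y.1 : ℍ)] (by
            rw [Fin.prod_univ_three]
            change denom rotC y.1 * denom rotB (rotC • y.1 : ℍ) *
              denom rotA (rotB • rotC • y.1 : ℍ) = -1
            rw [← denom_neg_one y.1, ← rotA_mul_rotB_mul_rotC, denom_mul_of_det_pos _ _ hC,
              denom_mul_of_det_pos _ _ hB]
            ring)
        rw [Fin.sum_univ_three] at hcos
        change Real.cos (ang rotC y.1 + ang rotB (rotC • y.1) + ang rotA (rotB • rotC • y.1))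
          = -1 at hcos
        obtain ⟨c1, c2⟩ := ang_mem rotC_pos y.1
        obtain ⟨b1, b2⟩ := ang_mem rotB_pos (rotC • y.1)
        obtain ⟨a1, a2⟩ := ang_mem rotA_pos (rotB • rotC • y.1)
        set v := ang rotC y.1 + ang rotB (rotC • y.1) + ang rotA (rotB • rotC • y.1)
        have h4 : Real.cos (v - Real.pi) = 1 := by rw [Real.cos_sub_pi, hcos, neg_neg]
        have := (Real.cos_eq_one_iff_of_lt_of_lt (by linarith) (by linarith)).1 h4
        linarith
      rw [h1, one_pow, one_smul]
      congr 1
      rw [rotC_smul, rotB_smul] at hsum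
      simp only [shift, Finset.sum_const, Finset.card_range]
      have hpi := Real.pi_ne_zero
      have e : ang rotA (toW (of .b) • toW (of .c) • y.1) = Real.pi - ang rotC y.1
        - ang rotB (toW (of .c) • y.1) := by linarith
      rw [e]
      field_simp
      ring)

end

end TriangleReflection

/-! ### The Seifert group: central extension, left orders -/

namespace TriangleReflection

open UpperHalfPlane PresentedGroup
open scoped MatrixGroups

noncomputable section

instance : MulAction Triangle237 ℍ := MulAction.compHom ℍ toW

lemma tri_smul_def (x : Triangle237) (z : ℍ) : x • z = toW x • z := rfl

instance : IsIsometricSMul Triangle237 ℍ := ⟨fun x => isometry_smul ℍ (toW x)⟩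

instance : MulAction Seifert237 (ℍ × ℝ) where
  smul g x := coverHom g x
  one_smul x := by change coverHom 1 x = x; rw [map_one]; rfl
  mul_smul g h x := by change coverHom (g * h) x = coverHom g (coverHom h x); rw [map_mul]; rfl

lemma cover_smul_def (g : Seifert237) (x : ℍ × ℝ) : g • x = coverHom g x := rfl

instance : ContinuousConstSMul Seifert237 (ℍ × ℝ) := ⟨fun g => (coverHom g).continuous⟩

/-- The height by which `g` moves the fibre over `z`. -/
def tilt (g : Seifert237) (z : ℍ) : ℝ := (g • ((z, 0) : ℍ × ℝ)).2

lemma continuous_tilt (g : Seifert237) : Continuous (tilt g) := by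
  have := (coverHom g).continuous
  change Continuous fun z : ℍ => (coverHom g (z, 0)).2
  fun_prop

/-- Every element of `G` acts by a shear over the action of its image in the triangle group. -/
lemma exists_cover_smul (g : Seifert237) :
    ∃ φ : ℍ → ℝ, ∀ y : ℍ × ℝ, g • y = (proj g • y.1, y.2 + φ y.1) := by
  let H : Subgroup Seifert237 :=
    { carrier := {g | ∃ φ : ℍ → ℝ, ∀ y : ℍ × ℝ, g • y = (proj g • y.1, y.2 + φ y.1)}
      one_mem' := ⟨fun _ => 0, fun y => by simp⟩
      mul_mem' := by
        rintro g h ⟨φ, hφ⟩ ⟨ψ, hψ⟩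
        refine ⟨fun z => ψ z + φ (proj h • z), fun y => ?_⟩
        rw [mul_smul g h y, hψ, hφ, map_mul proj g h, mul_smul, add_assoc]
      inv_mem' := by
        rintro g ⟨φ, hφ⟩
        refine ⟨fun z => -φ ((proj g)⁻¹ • z), fun y => ?_⟩
        rw [inv_smul_eq_iff, hφ, map_inv proj g, smul_inv_smul, neg_add_cancel_right] }
  refine sei_induction (H := H) ⟨shift rotA 42, fun y => ?_⟩ ⟨shift rotB 28, fun y => ?_⟩
    ⟨shift rotC 12, fun y => ?_⟩ ⟨fun _ => 1, fun y => ?_⟩ g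
  · rw [cover_smul_def, coverHom, seiLift_a, proj, seiLift_a]; rfl
  · rw [cover_smul_def, coverHom, seiLift_b, proj, seiLift_b]; rfl
  · rw [cover_smul_def, coverHom, seiLift_c, proj, seiLift_c]; rfl
  · rw [cover_smul_def, coverHom, seiLift_t, proj, seiLift_t, shear_apply, one_smul, one_smul]

lemma cover_smul (g : Seifert237) (y : ℍ × ℝ) : g • y = (proj g • y.1, y.2 + tilt g y.1) := by
  obtain ⟨φ, hφ⟩ := exists_cover_smul g
  rw [hφ, tilt, hφ, zero_add]

lemma tilt_one (z : ℍ) : tilt 1 z = 0 := by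
  rw [tilt, one_smul]

lemma tilt_mul (g h : Seifert237) (z : ℍ) : tilt (g * h) z = tilt h z + tilt g (proj h • z) := by
  rw [tilt, mul_smul g h, cover_smul h, cover_smul g, zero_add]

lemma tilt_tt (z : ℍ) : tilt tt z = 1 := by
  rw [tilt, cover_smul_def, coverHom, seiLift_t, shear_apply, zero_add]

lemma proj_tt_zpow (k : ℤ) : proj (tt ^ k) = 1 := by
  rw [map_zpow proj tt k, proj_tt, one_zpow]

lemma tilt_tt_zpow (k : ℤ) (z : ℍ) : tilt (tt ^ k) z = k := by
  have hnat : ∀ n : ℕ, tilt (tt ^ n) z = n := fun n => by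
    induction n with
    | zero => rw [pow_zero, tilt_one, Nat.cast_zero]
    | succ n ih => rw [pow_succ' tt n, tilt_mul, ih, tilt_tt, Nat.cast_succ]
  obtain ⟨n, rfl | rfl⟩ := k.eq_nat_or_neg
  · rw [zpow_natCast, hnat, Int.cast_natCast]
  · have h := tilt_mul (tt ^ n) (tt ^ (-(n : ℤ))) z
    rw [proj_tt_zpow, one_smul, hnat, zpow_neg tt, zpow_natCast tt n, mul_inv_cancel (tt ^ n),
      tilt_one] at h
    rw [zpow_neg tt, zpow_natCast tt n]
    push_cast
    linarith

lemma tt_zpow_injective : Function.Injective fun k : ℤ => tt ^ k := fun k l h => by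
  have := congrArg (fun g => tilt g I) h
  simp only [tilt_tt_zpow] at this
  exact_mod_cast this

lemma exists_tt_zpow {g : Seifert237} (h : proj g = 1) : ∃ k : ℤ, tt ^ k = g := by
  have : g ∈ Subgroup.zpowers tt := ker_proj ▸ MonoidHom.mem_ker.2 h
  exact Subgroup.mem_zpowers_iff.1 this

/-- The Seifert group as an extension of the triangle group by `ℤ`. -/
def extension : GroupExtension (Multiplicative ℤ) Seifert237 Triangle237 where
  inl := zpowersHom Seifert237 tt
  rightHom := proj
  inl_injective := fun k l h => Multiplicative.toAdd.injective (tt_zpow_injective h)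
  range_inl_eq_ker_rightHom := by
    rw [ker_proj]
    ext g
    rw [MonoidHom.mem_range, Subgroup.mem_zpowers_iff]
    exact ⟨fun ⟨k, hk⟩ => ⟨k.toAdd, hk⟩, fun ⟨k, hk⟩ => ⟨Multiplicative.ofAdd k, hk⟩⟩
  rightHom_surjective := proj_surjective

/-- In a left-ordered group with `t` central, `t > 1` and `g ^ p = t` with `p ≥ 2`, one has
`1 < g < t`; so the relation `abc = t³` is impossible. -/
lemma not_leftOrderable : ¬ LeftOrderable Seifert237 := by
  rintro ⟨lt, hlt, hmul⟩
  have hcen : ∀ g, g * tt = tt * g := fun g => by simpa using tt_zpow_comm 1 g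
  -- the argument for an order in which `t` is positive
  have key : ∀ r : Seifert237 → Seifert237 → Prop, IsStrictTotalOrder Seifert237 r →
      (∀ α β γ : Seifert237, r α β ↔ r (γ * α) (γ * β)) → ¬ r 1 tt := by
    intro r hr hm h1
    have pos : ∀ (g : Seifert237) (p : ℕ), g ^ (p + 2) = tt → r g tt := fun g p hg => by
      have hpow : ∀ n : ℕ, r 1 g → r 1 (g ^ (n + 1)) := fun n h => by
        induction n with
        | zero => simpa using h
        | succ n ih =>
          refine _root_.trans h ?_
          have := (hm _ _ g).1 ih
          rwa [mul_one, ← pow_succ'] at this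
      have hneg : ∀ n : ℕ, r g 1 → r (g ^ (n + 1)) 1 := fun n h => by
        induction n with
        | zero => simpa using h
        | succ n ih =>
          refine _root_.trans ?_ h
          have := (hm _ _ g).1 ih
          rwa [mul_one, ← pow_succ'] at this
      rcases trichotomous_of r 1 g with h | h | h
      · have := (hm _ _ g).1 (hpow p h)
        rwa [mul_one, ← pow_succ', hg] at this
      · rw [← hg, ← h, one_pow] at h1
        exact absurd h1 (irrefl _)
      · have := hneg (p + 1) h
        rw [hg] at this
        exact absurd (_root_.trans h1 this) (irrefl _)
    have ha := pos (of .a) 0 sei_rel_a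
    have hb := pos (of .b) 1 sei_rel_b
    have hc := pos (of .c) 5 sei_rel_c
    have e1 : r (of .a * of .b) (tt * tt) :=
      _root_.trans ((hm _ _ (of .a)).1 hb) (by rw [hcen]; exact (hm _ _ tt).1 ha)
    have e2 : r (of .a * of .b * of .c) (tt * (tt * tt)) :=
      _root_.trans ((hm _ _ (of .a * of .b)).1 hc) (by rw [hcen]; exact (hm _ _ tt).1 e1)
    rw [sei_rel_abc] at e2
    exact irrefl _ ((show (of .t : Seifert237) ^ 3 = tt * (tt * tt) from pow_three tt) ▸ e2)
  have hne : (tt : Seifert237) ≠ 1 := fun h => by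
    have := tt_zpow_injective (a₁ := 1) (a₂ := 0) (by simpa using h)
    exact one_ne_zero this
  rcases trichotomous_of lt 1 tt with h | h | h
  · exact key lt hlt hmul h
  · exact hne h.symm
  · exact key (fun x y => lt y x) inferInstance (fun α β γ => hmul β α γ) h

/-! ### Stabilizers -/

/-- The elements of a dihedral group. -/
lemma mem_closure_pair_involutions {K : Type*} [Group K] {x y : K} (hx : x * x = 1)
    (hy : y * y = 1) {w : K} (hw : w ∈ Subgroup.closure {x, y}) :
    ∃ n : ℤ, w = (x * y) ^ n ∨ w = (x * y) ^ n * x := by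
  have hx' : x⁻¹ = x := inv_eq_of_mul_eq_one_left hx
  have hy' : y⁻¹ = y := inv_eq_of_mul_eq_one_left hy
  have hconj : ∀ n : ℤ, x * (x * y) ^ n = (x * y) ^ (-n) * x := fun n => by
    have h1 : x * (x * y) * x⁻¹ = (x * y)⁻¹ := by
      rw [mul_inv_rev, hx', hy', ← mul_assoc, hx, one_mul]
    have h2 : x * (x * y) ^ n * x⁻¹ = (x * y) ^ (-n) := by
      rw [← conj_zpow, h1, inv_zpow, zpow_neg]
    rw [← h2, inv_mul_cancel_right]
  have hstepx : ∀ w, (∃ n : ℤ, w = (x * y) ^ n ∨ w = (x * y) ^ n * x) →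
      ∃ n : ℤ, x * w = (x * y) ^ n ∨ x * w = (x * y) ^ n * x := by
    rintro w ⟨n, rfl | rfl⟩
    · exact ⟨-n, Or.inr (hconj n)⟩
    · exact ⟨-n, Or.inl (by rw [← mul_assoc, hconj, mul_assoc, hx, mul_one])⟩
  have hstepy : ∀ w, (∃ n : ℤ, w = (x * y) ^ n ∨ w = (x * y) ^ n * x) →
      ∃ n : ℤ, y * w = (x * y) ^ n ∨ y * w = (x * y) ^ n * x := by
    intro w hw
    have e : y * w = x * (x * y * w) := by rw [← mul_assoc, ← mul_assoc, hx, one_mul]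
    rw [e]
    refine hstepx _ ?_
    rcases hw with ⟨n, rfl | rfl⟩
    · exact ⟨1 + n, Or.inl (by rw [zpow_add, zpow_one])⟩
    · exact ⟨1 + n, Or.inr (by rw [zpow_add, zpow_one]; simp only [mul_assoc])⟩
  induction hw using Subgroup.closure_induction_left with
  | one => exact ⟨0, Or.inl (by simp)⟩
  | mul_left g hg w _ ih =>
    rcases hg with rfl | rfl
    · exact hstepx _ ih
    · exact hstepy _ ih
  | inv_mul_cancel g hg w _ ih =>
    rcases hg with rfl | rfl
    · rw [hx']; exact hstepx _ ih
    · rw [hy']; exact hstepy _ ih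

/-- The orientation-preserving elements fixing a point which misses the `k`-th wall are rotations
around the intersection of the other two walls. -/
lemma mem_zpowers_of_mem_parab {y : ℍ} {i j k : Fin 3} (hk : ht k y ≠ 0)
    (hall : ∀ l, l = i ∨ l = j ∨ l = k) {w : W} (hw : w ∈ parab y) (hs : sgn w = 1) :
    w ∈ Subgroup.zpowers (cs.simple i * cs.simple j) := by
  have h1 : parab y ≤ Subgroup.closure {cs.simple i, cs.simple j} := by
    rw [parab]
    refine Subgroup.closure_mono ?_
    rintro _ ⟨l, hl, rfl⟩
    rcases hall l with rfl | rfl | rfl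
    · simp
    · simp
    · exact absurd hl hk
  obtain ⟨n, rfl | rfl⟩ := mem_closure_pair_involutions (cs.simple_mul_simple_self i)
    (cs.simple_mul_simple_self j) (h1 hw)
  · exact ⟨n, rfl⟩
  · rw [map_mul, map_zpow, map_mul, sgn_simple, sgn_simple] at hs
    simp at hs

lemma ht_two_vA_pos : 0 < ht 2 vA := by
  have h1 := ht_linear_combination vA
  rw [ht_vA.1, ht_vA.2] at h1
  have : 0 < del / vA.im := div_pos del_pos vA.im_pos
  linarith

lemma ht_one_vB_pos : 0 < ht 1 vB := by
  have h1 := ht_linear_combination vB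
  rw [ht_vB.1, ht_vB.2] at h1
  have : 0 < del / vB.im := div_pos del_pos vB.im_pos
  have := rr_pos
  by_contra! h
  nlinarith

lemma ht_zero_vC_pos : 0 < ht 0 vC := by
  have h1 := ht_linear_combination vC
  rw [ht_vC.1, ht_vC.2] at h1
  have : 0 < del / vC.im := div_pos del_pos vC.im_pos
  linarith

/-- Two heights zero and one nonnegative determine a point, as the third height is then found from
`ht_quadratic`. -/
lemma eq_vA {y : ℍ} (h0 : ht 0 y = 0) (h1 : ht 1 y = 0) (h2 : 0 ≤ ht 2 y) : y = vA := by
  have e1 := ht_quadratic y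
  have e2 := ht_quadratic vA
  rw [h0, h1] at e1
  rw [ht_vA.1, ht_vA.2] at e2
  have hp := ht_two_vA_pos
  refine eq_of_ht_eq fun i => ?_
  fin_cases i
  · exact h0.trans ht_vA.1.symm
  · exact h1.trans ht_vA.2.symm
  · change ht 2 y = ht 2 vA
    nlinarith

lemma eq_vB {y : ℍ} (h0 : ht 0 y = 0) (h2 : ht 2 y = 0) (h1 : 0 ≤ ht 1 y) : y = vB := by
  have e1 := ht_quadratic y
  have e2 := ht_quadratic vB
  rw [h0, h2] at e1
  rw [ht_vB.1, ht_vB.2] at e2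
  have hp := ht_one_vB_pos
  have hrq := rr_mul_qq
  have e3 : ht 1 y ^ 2 = ht 1 vB ^ 2 := by
    have : (rr * qq) * ht 1 y ^ 2 = (rr * qq) * ht 1 vB ^ 2 := by linarith
    rw [hrq] at this
    linarith
  refine eq_of_ht_eq fun i => ?_
  fin_cases i
  · exact h0.trans ht_vB.1.symm
  · exact (pow_left_inj₀ h1 hp.le two_ne_zero).1 e3
  · exact h2.trans ht_vB.2.symm

lemma eq_vC {y : ℍ} (h1 : ht 1 y = 0) (h2 : ht 2 y = 0) (h0 : 0 ≤ ht 0 y) : y = vC := by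
  have e1 := ht_quadratic y
  have e2 := ht_quadratic vC
  rw [h1, h2] at e1
  rw [ht_vC.1, ht_vC.2] at e2
  have hp := ht_zero_vC_pos
  have hd : 0 < 1 - del ^ 2 := by nlinarith [del_pos, del_lt_one]
  have e3 : ht 0 y ^ 2 = ht 0 vC ^ 2 := by
    have : (1 - del ^ 2) * ht 0 y ^ 2 = (1 - del ^ 2) * ht 0 vC ^ 2 := by linarith
    exact mul_left_cancel₀ hd.ne' this
  refine eq_of_ht_eq fun i => ?_
  fin_cases i
  · exact (pow_left_inj₀ h0 hp.le two_ne_zero).1 e3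
  · exact h1.trans ht_vC.1.symm
  · exact h2.trans ht_vC.2.symm

/-- A nontrivial orientation-preserving element of the stabilizer of a point of the triangle exists
only at the vertices, where it is a power of the rotation. -/
lemma mem_parab_cases {y : ℍ} (hy : ∀ i, 0 ≤ ht i y) {w : W} (hw : w ∈ parab y)
    (hs : sgn w = 1) (hne : w ≠ 1) :
    (y = vA ∧ w ∈ Subgroup.zpowers (toW (of .a))) ∨
    (y = vB ∧ w ∈ Subgroup.zpowers (toW (of .b))) ∨
    (y = vC ∧ w ∈ Subgroup.zpowers (toW (of .c))) := by
  -- with at most one wall through `y` the element is trivial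
  have one : ∀ i j k : Fin 3, (∀ l, l = i ∨ l = j ∨ l = k) → ht j y ≠ 0 → ht k y ≠ 0 →
      False := by
    intro i j k hall hj hk
    have h1 : parab y ≤ Subgroup.closure {cs.simple i, cs.simple i} := by
      rw [parab]
      refine Subgroup.closure_mono ?_
      rintro _ ⟨l, hl, rfl⟩
      rcases hall l with rfl | rfl | rfl
      · simp
      · exact absurd hl hj
      · exact absurd hl hk
    obtain ⟨n, rfl | rfl⟩ := mem_closure_pair_involutions (cs.simple_mul_simple_self i)
      (cs.simple_mul_simple_self i) (h1 hw)
    · rw [cs.simple_mul_simple_self, one_zpow] at hne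
      exact hne rfl
    · rw [cs.simple_mul_simple_self, one_zpow, one_mul, sgn_simple] at hs
      exact absurd hs (by decide)
  by_cases h0 : ht 0 y = 0
  · by_cases h1 : ht 1 y = 0
    · left
      refine ⟨eq_vA h0 h1 (hy 2), ?_⟩
      have h2 : ht 2 y ≠ 0 := by rw [eq_vA h0 h1 (hy 2)]; exact ht_two_vA_pos.ne'
      rw [toW_a]
      exact mem_zpowers_of_mem_parab h2 (by decide) hw hs
    · by_cases h2 : ht 2 y = 0
      · right; left
        refine ⟨eq_vB h0 h2 (hy 1), ?_⟩
        rw [toW_b]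
        exact mem_zpowers_of_mem_parab h1 (by decide) hw hs
      · exact (one 0 1 2 (by decide) h1 h2).elim
  · by_cases h1 : ht 1 y = 0
    · by_cases h2 : ht 2 y = 0
      · right; right
        refine ⟨eq_vC h1 h2 (hy 0), ?_⟩
        rw [toW_c]
        exact mem_zpowers_of_mem_parab h0 (by decide) hw hs
      · exact (one 1 0 2 (by decide) h0 h2).elim
    · exact (one 2 0 1 (by decide) h0 h1).elim

lemma tri_smul_vA : (of .a : Triangle237) • vA = vA := toW_a_smul_vA

lemma tri_smul_vB : (of .b : Triangle237) • vB = vB := toW_b_smul_vB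

lemma tri_smul_vC : (of .c : Triangle237) • vC = vC := toW_c_smul_vC

/-- `ConeAt p g z`: the stabilizer of `z` in the Seifert group is the cyclic group generated by
`g`, where `g ^ p` is the fibre class. -/
structure ConeAt (p : ℕ) (g : Seifert237) (z : ℍ) : Prop where
  pos : p ≠ 0
  pow : g ^ p = tt
  fix : proj g • z = z
  stab : ∀ h : Seifert237, proj h • z = z → h ∈ Subgroup.zpowers g

lemma ConeAt.of_stab {p : ℕ} {g : Seifert237} {z : ℍ} (pos : p ≠ 0) (pow : g ^ p = tt)
    (fix : proj g • z = z)
    (stab : ∀ x : Triangle237, x • z = z → x ∈ Subgroup.zpowers (proj g)) : ConeAt p g z := by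
  refine ⟨pos, pow, fix, fun h hh => ?_⟩
  obtain ⟨n, hn⟩ := Subgroup.mem_zpowers_iff.1 (stab _ hh)
  obtain ⟨k, hk⟩ := exists_tt_zpow (g := (g ^ n)⁻¹ * h) (by
    rw [map_mul proj, map_inv proj, map_zpow proj, hn, inv_mul_cancel (proj h)])
  refine Subgroup.mem_zpowers_iff.2 ⟨n + p * k, ?_⟩
  rw [zpow_add g, zpow_mul g, zpow_natCast g, pow, hk, mul_inv_cancel_left]

lemma mem_zpowers_of_toW {x g : Triangle237} (h : toW x ∈ Subgroup.zpowers (toW g)) :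
    x ∈ Subgroup.zpowers g := by
  obtain ⟨n, hn⟩ := Subgroup.mem_zpowers_iff.1 h
  exact Subgroup.mem_zpowers_iff.2 ⟨n, toW_injective (by rw [map_zpow toW, hn])⟩

lemma ht_vA_nonneg (i : Fin 3) : 0 ≤ ht i vA := by
  fin_cases i
  · exact ht_vA.1.ge
  · exact ht_vA.2.ge
  · exact ht_two_vA_pos.le

lemma ht_vB_nonneg (i : Fin 3) : 0 ≤ ht i vB := by
  fin_cases i
  · exact ht_vB.1.ge
  · exact ht_one_vB_pos.le
  · exact ht_vB.2.ge

lemma ht_vC_nonneg (i : Fin 3) : 0 ≤ ht i vC := by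
  fin_cases i
  · exact ht_zero_vC_pos.le
  · exact ht_vC.1.ge
  · exact ht_vC.2.ge

lemma vA_ne_vB : vA ≠ vB := fun h => ht_one_vB_pos.ne' (h ▸ ht_vA.2)

lemma vA_ne_vC : vA ≠ vC := fun h => ht_zero_vC_pos.ne' (h ▸ ht_vA.1)

lemma vB_ne_vC : vB ≠ vC := fun h => ht_zero_vC_pos.ne' (h ▸ ht_vB.1)

lemma proj_a : proj (of .a) = of .a := seiLift_a

lemma proj_b : proj (of .b) = of .b := seiLift_b

lemma proj_c : proj (of .c) = of .c := seiLift_c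

lemma coneAt_vA : ConeAt 2 (of .a) vA := by
  refine .of_stab two_ne_zero sei_rel_a (by rw [proj_a]; exact tri_smul_vA) fun x hx => ?_
  rw [proj_a]
  by_cases h1 : x = 1
  · rw [h1]; exact one_mem _
  rcases mem_parab_cases ht_vA_nonneg (mem_parab_of_smul_eq ht_vA_nonneg hx) (sgn_toW x)
    (fun h => h1 (toW_injective (by rw [h, map_one toW]))) with h | h | h
  · exact mem_zpowers_of_toW h.2
  · exact absurd h.1 vA_ne_vB
  · exact absurd h.1 vA_ne_vC

lemma coneAt_vB : ConeAt 3 (of .b) vB := by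
  refine .of_stab three_ne_zero sei_rel_b (by rw [proj_b]; exact tri_smul_vB) fun x hx => ?_
  rw [proj_b]
  by_cases h1 : x = 1
  · rw [h1]; exact one_mem _
  rcases mem_parab_cases ht_vB_nonneg (mem_parab_of_smul_eq ht_vB_nonneg hx) (sgn_toW x)
    (fun h => h1 (toW_injective (by rw [h, map_one toW]))) with h | h | h
  · exact absurd h.1.symm vA_ne_vB
  · exact mem_zpowers_of_toW h.2
  · exact absurd h.1 vB_ne_vC

lemma coneAt_vC : ConeAt 7 (of .c) vC := by
  refine .of_stab (by norm_num) sei_rel_c (by rw [proj_c]; exact tri_smul_vC) fun x hx => ?_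
  rw [proj_c]
  by_cases h1 : x = 1
  · rw [h1]; exact one_mem _
  rcases mem_parab_cases ht_vC_nonneg (mem_parab_of_smul_eq ht_vC_nonneg hx) (sgn_toW x)
    (fun h => h1 (toW_injective (by rw [h, map_one toW]))) with h | h | h
  · exact absurd h.1.symm vA_ne_vC
  · exact absurd h.1.symm vB_ne_vC
  · exact mem_zpowers_of_toW h.2

/-- A point is in the same orbit as a given point of the triangle as soon as it folds to it, and
some wall passes through that point. -/
lemma exists_tri_smul_eq {z y : ℍ} {i : Fin 3} (hi : ht i y = 0) (h : fold z = y) :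
    ∃ x : Triangle237, x • y = z := by
  have hz : loc z • y = z := by rw [← h, loc_smul_fold]
  have hiy := (simple_smul_eq_self_iff i y).2 hi
  by_cases hs : sgn (loc z) = 1
  · obtain ⟨x, hx⟩ := mem_range_toW_of_sgn hs
    exact ⟨x, by rw [tri_smul_def, hx, hz]⟩
  · have hs' : sgn (loc z * cs.simple i) = 1 := by
      rw [map_mul, sgn_simple, (Int.units_eq_one_or _).resolve_left hs]
      decide
    obtain ⟨x, hx⟩ := mem_range_toW_of_sgn hs'
    exact ⟨x, by rw [tri_smul_def, hx, mul_smul, hiy, hz]⟩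

/-- Every point either lies in the orbit of a vertex or has trivial stabilizer in the triangle
group. -/
lemma exists_vertex_or_coneAt (z : ℍ) :
    (fold z = vA ∨ fold z = vB ∨ fold z = vC) ∨ ConeAt 1 tt z := by
  by_contra! h
  obtain ⟨⟨hA, hB, hC⟩, h⟩ := h
  refine h (.of_stab one_ne_zero (pow_one _) (by rw [proj_tt, one_smul]) fun x hx => ?_)
  suffices x = 1 by rw [this]; exact one_mem _
  by_contra hne
  have h1 : toW x • z = z := hx
  rcases mem_parab_cases (fold_nonneg z) (mem_parab_fold_of_smul_eq h1)
    (by rw [map_mul, map_mul, sgn_toW, mul_one, map_inv, inv_mul_cancel]) (fun h2 => hne (by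
      apply toW_injective
      rw [map_one toW]
      rw [mul_assoc, inv_mul_eq_one] at h2
      exact mul_eq_right.1 h2.symm)) with h2 | h2 | h2
  · exact hA h2.1
  · exact hB h2.1
  · exact hC h2.1

end

end TriangleReflection

/-! ### The Seifert group acts freely and properly discontinuously on `ℍ × ℝ` -/

namespace TriangleReflection

open UpperHalfPlane PresentedGroup Topology
open scoped MatrixGroups

noncomputable section

lemma ConeAt.conj {p : ℕ} {g : Seifert237} {z : ℍ} (hg : ConeAt p g z) (h : Seifert237) :
    ConeAt p (h * g * h⁻¹) (proj h • z) := by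
  refine ⟨hg.pos, ?_, ?_, fun k hk => ?_⟩
  · rw [conj_pow, hg.pow, ← zpow_one tt, tt_zpow_comm, mul_inv_cancel_right]
  · rw [map_mul proj, map_mul proj, map_inv proj, mul_smul, mul_smul, inv_smul_smul, hg.fix]
  · obtain ⟨n, hn⟩ := Subgroup.mem_zpowers_iff.1 (hg.stab (h⁻¹ * k * h) (by
      rw [map_mul proj, map_mul proj, map_inv proj, mul_smul, mul_smul, hk, inv_smul_smul]))
    refine Subgroup.mem_zpowers_iff.2 ⟨n, ?_⟩
    rw [conj_zpow, hn]
    group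

/-- All stabilizers are of the form described by `ConeAt`. -/
lemma exists_coneAt (z : ℍ) : ∃ p g, ConeAt p g z := by
  have main : ∀ {y : ℍ} {i : Fin 3} {p : ℕ} {g : Seifert237}, ht i y = 0 → ConeAt p g y →
      fold z = y → ∃ p g, ConeAt p g z := fun hi hg h => by
    obtain ⟨x, rfl⟩ := exists_tri_smul_eq hi h
    obtain ⟨k, rfl⟩ := proj_surjective x
    exact ⟨_, _, hg.conj k⟩
  rcases exists_vertex_or_coneAt z with (h | h | h) | h
  · exact main ht_vA.1 coneAt_vA h
  · exact main ht_vB.1 coneAt_vB h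
  · exact main ht_vC.1 coneAt_vC h
  · exact ⟨_, _, h⟩

/-- The average of the heights of the powers of `g`; adding it to the fibre coordinate turns `g`
into the translation by `1 / p`. -/
def straight (p : ℕ) (g : Seifert237) (z : ℍ) : ℝ :=
  (∑ k ∈ Finset.range p, tilt (g ^ k) z) / p

lemma continuous_straight (p : ℕ) (g : Seifert237) : Continuous (straight p g) :=
  (continuous_finsetSum _ fun _ _ => continuous_tilt _).div_const _

/-- The sum defining `straight` is shifted cyclically by `g`, up to the height `1` of `g ^ p`. -/
lemma straight_smul {p : ℕ} {g : Seifert237} (hp : p ≠ 0) (hg : g ^ p = tt) (z : ℍ) :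
    tilt g z + straight p g (proj g • z) = straight p g z + 1 / p := by
  have hp' : (p : ℝ) ≠ 0 := Nat.cast_ne_zero.2 hp
  have h1 : ∀ k : ℕ, tilt (g ^ k) (proj g • z) = tilt (g ^ (k + 1)) z - tilt g z := fun k => by
    rw [pow_succ g, tilt_mul]; ring
  have h2 := Finset.sum_range_succ' (fun k => tilt (g ^ k) z) p
  rw [Finset.sum_range_succ, hg, tilt_tt, pow_zero, tilt_one, add_zero] at h2
  unfold straight
  simp only [h1, Finset.sum_sub_distrib, Finset.sum_const, Finset.card_range, nsmul_eq_mul]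
  rw [← h2]
  field_simp
  ring

lemma straight_zpow_smul {p : ℕ} {g : Seifert237} (hp : p ≠ 0) (hg : g ^ p = tt) (n : ℤ)
    (x : ℍ × ℝ) :
    (g ^ n • x).2 + straight p g (g ^ n • x).1 = x.2 + straight p g x.1 + n / p := by
  have h1 : ∀ x : ℍ × ℝ, (g • x).2 + straight p g (g • x).1 = x.2 + straight p g x.1 + 1 / p :=
    fun x => by
      rw [cover_smul]
      have := straight_smul hp hg x.1
      simp only
      linarith
  have hnat : ∀ (n : ℕ) (x : ℍ × ℝ),
      (g ^ n • x).2 + straight p g (g ^ n • x).1 = x.2 + straight p g x.1 + n / p := fun n x => by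
    induction n with
    | zero => simp
    | succ n ih =>
      rw [pow_succ' g, mul_smul g, h1, ih]
      push_cast
      ring
  obtain ⟨n, rfl | rfl⟩ := n.eq_nat_or_neg
  · rw [zpow_natCast g, Int.cast_natCast]
    exact hnat n x
  · have h := hnat n (g ^ (-(n : ℤ)) • x)
    rw [zpow_neg g, zpow_natCast g, smul_inv_smul] at h
    rw [zpow_neg g, zpow_natCast g]
    push_cast
    rw [h]
    ring

/-- Every point of `ℍ × ℝ` has a neighbourhood whose translates are disjoint. -/
lemma exists_nhds_disjoint (e : ℍ × ℝ) :
    ∃ U ∈ 𝓝 e, ∀ g : Seifert237, ((g • ·) '' U ∩ U).Nonempty → g = 1 := by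
  -- only elements of the stabilizer of `e.1` move points near `e.1` to points near `e.1`; these are
  -- powers of `g`, which translate the straightened fibre coordinate `F` by multiples of `1 / p`
  obtain ⟨p, g, hg⟩ := exists_coneAt e.1
  obtain ⟨ε, hε, H⟩ := exists_smul_eq_of_dist_lt e.1
  have hp : (0 : ℝ) < p := Nat.cast_pos.2 (Nat.pos_of_ne_zero hg.pos)
  set F : ℍ × ℝ → ℝ := fun x => x.2 + straight p g x.1 with hF
  have hFc : Continuous F := by
    have := continuous_straight p g
    fun_prop
  refine ⟨{x | dist x.1 e.1 < ε} ∩ {x | dist (F x) (F e) < 1 / (2 * p)}, ?_, ?_⟩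
  · refine (IsOpen.inter ?_ ?_).mem_nhds ⟨by simpa using hε, ?_⟩
    · exact isOpen_lt (by fun_prop) continuous_const
    · exact isOpen_lt (by fun_prop) continuous_const
    · change dist (F e) (F e) < _
      rw [dist_self]; positivity
  · rintro h ⟨_, ⟨x, ⟨hx1, hx2⟩, rfl⟩, hy1, hy2⟩
    simp only [Set.mem_ofPred_eq, cover_smul h] at hy1
    obtain ⟨n, rfl⟩ := Subgroup.mem_zpowers_iff.1 (hg.stab h (H _ _ hx1 hy1))
    simp only [Set.mem_ofPred_eq, hF, straight_zpow_smul hg.pos hg.pow] at hy2 hx2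
    rw [Real.dist_eq, abs_lt] at hx2 hy2
    have h1 : |(n : ℝ) / p| < 1 / p := by
      have e2 : (1 : ℝ) / p = 1 / (2 * p) + 1 / (2 * p) := by field_simp; ring
      rw [abs_lt, e2]
      constructor <;> linarith [hx2.1, hx2.2, hy2.1, hy2.2]
    rw [abs_div, abs_of_pos hp, div_lt_div_iff_of_pos_right hp] at h1
    have : n = 0 := by
      have : |n| < 1 := by exact_mod_cast h1
      exact Int.abs_lt_one_iff.1 this
    rw [this, zpow_zero]

lemma eq_one_of_cover_smul_eq {g : Seifert237} {x : ℍ × ℝ} (h : g • x = x) : g = 1 := by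
  obtain ⟨U, hU, H⟩ := exists_nhds_disjoint x
  have hx := mem_of_mem_nhds hU
  exact H g ⟨x, ⟨x, hx, h⟩, hx⟩

/-! ### Torsion -/

/-- The action of the triangle group is by matrices of determinant one. -/
lemma exists_matrix (x : Triangle237) :
    ∃ M : GL (Fin 2) ℝ, M.val.det = 1 ∧ ∀ z : ℍ, M • z = x • z := by
  let H : Subgroup Triangle237 :=
    { carrier := {x | ∃ M : GL (Fin 2) ℝ, M.val.det = 1 ∧ ∀ z : ℍ, M • z = x • z}
      one_mem' := ⟨1, by simp, fun z => by simp⟩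
      mul_mem' := by
        rintro x y ⟨M, hM, hx⟩ ⟨N, hN, hy⟩
        refine ⟨M * N, by rw [Units.val_mul, Matrix.det_mul, hM, hN, one_mul], fun z => ?_⟩
        rw [mul_smul, mul_smul, hx, hy]
      inv_mem' := by
        rintro x ⟨M, hM, hx⟩
        refine ⟨M⁻¹, ?_, fun z => ?_⟩
        · have := congrArg (fun N : GL (Fin 2) ℝ => N.val.det) (inv_mul_cancel M)
          simp only [Units.val_mul, Matrix.det_mul, hM, mul_one, Units.val_one,
            Matrix.det_one] at this
          exact this
        · rw [inv_smul_eq_iff, hx, smul_inv_smul] }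
  refine generated_by _ H (fun j => ?_) x
  match j with
  | .a => exact ⟨rotA, det_neg_wallMatrix_mul 1 0, rotA_smul⟩
  | .b => exact ⟨rotB, det_neg_wallMatrix_mul 0 2, rotB_smul⟩
  | .c => exact ⟨rotC, det_neg_wallMatrix_mul 2 1, rotC_smul⟩

lemma pow_eq_cheb {M : Matrix (Fin 2) (Fin 2) ℝ} (hM : M.det = 1) (n : ℕ) :
    M ^ (n + 1) = cheb M.trace (n + 1) • M - cheb M.trace n • 1 := by
  induction n with
  | zero => simp [cheb]
  | succ n ih =>
    have e : cheb M.trace (n + 1 + 1) = M.trace * cheb M.trace (n + 1) - cheb M.trace n := rfl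
    rw [pow_succ, ih, sub_mul, smul_mul_assoc, mul_self_of_det_eq_one M hM, smul_mul_assoc, one_mul,
      e, smul_sub, sub_smul, smul_smul, mul_comm (cheb M.trace (n + 1))]
    abel

/-- The Chebyshev sequence grows in the non-elliptic case. -/
lemma cheb_growth {t : ℝ} (ht : 2 ≤ |t|) (n : ℕ) : |cheb t n| + 1 ≤ |cheb t (n + 1)| := by
  induction n with
  | zero => simp [cheb]
  | succ n ih =>
    have e : cheb t (n + 2) = t * cheb t (n + 1) - cheb t n := rfl
    have h1 := abs_sub_abs_le_abs_sub (t * cheb t (n + 1)) (cheb t n)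
    rw [abs_mul] at h1
    rw [e]
    nlinarith [abs_nonneg (cheb t (n + 1)), abs_nonneg (cheb t n)]

/-- An element of finite order of the triangle group is elliptic: the powers of a matrix of
determinant one and trace at least two in absolute value are not scalar, unless it is scalar. -/
lemma exists_fixed_of_pow_eq_one {x : Triangle237} {n : ℕ} (hx : x ^ (n + 1) = 1) :
    ∃ z : ℍ, x • z = z := by
  obtain ⟨M, hM, hact⟩ := exists_matrix x
  by_cases hell : M.IsElliptic
  · exact ⟨fixedPt M hell, by
      rw [← hact, gl_smul_eq_self_iff_eq_fixedPt (by rw [hM]; norm_num) hell]⟩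
  · have htr : 2 ≤ |M.val.trace| := by
      have h : 0 ≤ M.val.discr := not_lt.1 hell
      rw [Matrix.discr_fin_two, hM] at h
      rw [← sq_abs] at h
      nlinarith [abs_nonneg M.val.trace]
    have hpow : ∀ (k : ℕ) (z : ℍ), M ^ k • z = x ^ k • z := fun k z => by
      induction k with
      | zero => simp
      | succ k ih => rw [pow_succ' M, pow_succ' x, mul_smul, mul_smul, ih, hact]
    have hcen : ∀ z : ℍ, M ^ (n + 1) • z = z := fun z => by rw [hpow, hx, one_smul]
    rw [forall_smul_eq_self_iff_mem_center,
      Matrix.GeneralLinearGroup.mem_center_iff_val_mem_range_scalar] at hcen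
    obtain ⟨c, hc⟩ := hcen
    rw [Units.val_pow_eq_pow_val, pow_eq_cheb hM] at hc
    have hne : cheb M.val.trace (n + 1) ≠ 0 := fun h => by
      have := cheb_growth htr n
      rw [h, abs_zero] at this
      linarith [abs_nonneg (cheb M.val.trace n)]
    have hscal : ∀ z : ℍ, M • z = z := by
      rw [forall_smul_eq_self_iff_mem_center,
        Matrix.GeneralLinearGroup.mem_center_iff_val_mem_range_scalar]
      refine ⟨(c + cheb M.val.trace n) / cheb M.val.trace (n + 1), ?_⟩
      have h2 : M.val = (cheb M.val.trace (n + 1))⁻¹ •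
          (Matrix.scalar (Fin 2) c + cheb M.val.trace n • 1) := by
        rw [hc, sub_add_cancel, smul_smul, inv_mul_cancel₀ hne, one_smul]
      refine Eq.trans ?_ h2.symm
      rw [div_eq_inv_mul]
      ext i j
      fin_cases i <;> fin_cases j <;> simp
    exact ⟨I, by rw [← hact, hscal]⟩

/-- An element of finite order fixes a point of `ℍ`, and moves the fibre over it by a height
which is zero because some multiple of it is; so it has a fixed point in `ℍ × ℝ`. -/
lemma torsionFree : TorsionFreeGroup Seifert237 := by
  intro g hg hfin
  obtain ⟨n, hn, hpow⟩ := isOfFinOrder_iff_pow_eq_one.1 hfin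
  obtain ⟨m, rfl⟩ := Nat.exists_eq_succ_of_ne_zero hn.ne'
  obtain ⟨z, hz⟩ := exists_fixed_of_pow_eq_one (x := proj g) (n := m) (by
    rw [← map_pow proj g, hpow, map_one proj])
  have hk : ∀ k : ℕ, proj (g ^ k) • z = z ∧ tilt (g ^ k) z = k * tilt g z := fun k => by
    induction k with
    | zero => rw [pow_zero, map_one proj, one_smul, tilt_one]; simp
    | succ k ih =>
      rw [pow_succ' g, map_mul proj, mul_smul, ih.1, hz, tilt_mul, ih.1, ih.2]
      refine ⟨rfl, ?_⟩
      push_cast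
      ring
  have h0 := (hk (m + 1)).2
  rw [hpow, tilt_one] at h0
  have ht0 : tilt g z = 0 := by
    rcases mul_eq_zero.1 h0.symm with h | h
    · exact absurd h (by positivity)
    · exact h
  exact hg (eq_one_of_cover_smul_eq (x := (z, 0)) (by rw [cover_smul, hz, ht0, add_zero]))

/-! ### The quotient manifold and its fundamental group -/

/-- The quotient of `ℍ × ℝ` by the Seifert group. -/
abbrev SeifertManifold : Type := MulAction.orbitRel.Quotient Seifert237 (ℍ × ℝ)

/-- The covering map. -/
def quot : ℍ × ℝ → SeifertManifold := Quotient.mk _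

lemma isQuotientCoveringMap_quot : IsQuotientCoveringMap quot Seifert237 where
  toIsQuotientMap := isQuotientMap_quotient_mk'
  continuous_const_smul := continuous_const_smul
  apply_eq_iff_mem_orbit := Quotient.eq''
  disjoint := exists_nhds_disjoint

lemma nonempty_fundamentalGroup_mulEquiv (m : SeifertManifold) :
    Nonempty (FundamentalGroup SeifertManifold m ≃* Seifert237) := by
  obtain ⟨x, hx⟩ := Quotient.exists_rep m
  -- `G` acts from the left, and loops compose in the opposite order
  exact ⟨(isQuotientCoveringMap_quot.fundamentalGroupEquiv ⟨x, hx⟩).trans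
    (MulEquiv.inv' Seifert237).symm⟩

end

end TriangleReflection

/-! ### Smooth coordinates on the upper half-plane -/

namespace TriangleReflection

open UpperHalfPlane PresentedGroup Topology
open scoped MatrixGroups

noncomputable section

/-- The global coordinates `(re z, log (im z))` on the upper half-plane. -/
def chart : ℍ ≃ₜ Plane where
  toFun z := !₂[z.re, Real.log z.im]
  invFun v := ⟨⟨v 0, Real.exp (v 1)⟩, Real.exp_pos _⟩
  left_inv z := by
    refine UpperHalfPlane.ext (Complex.ext rfl ?_)
    change Real.exp (Real.log z.im) = z.im
    exact Real.exp_log z.im_pos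
  right_inv v := by
    ext i
    fin_cases i
    · rfl
    · exact Real.log_exp _
  continuous_toFun := by
    have h : Continuous fun z : ℍ => Real.log z.im :=
      UpperHalfPlane.continuous_im.log fun z => z.im_pos.ne'
    have h' : Continuous fun z : ℍ => z.re := UpperHalfPlane.continuous_re
    refine (PiLp.continuous_toLp 2 _).comp (continuous_pi fun i => ?_)
    fin_cases i
    · exact h'
    · exact h
  continuous_invFun := by
    rw [UpperHalfPlane.isEmbedding_coe.continuous_iff]
    have h : Continuous fun v : Plane => (⟨v 0, Real.exp (v 1)⟩ : ℂ) := by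
      have h0 : Continuous fun v : Plane => ((v 0 : ℝ) : ℂ) + (Real.exp (v 1) : ℝ) * Complex.I := by
        fun_prop
      convert h0 using 2 with v
      exact Complex.mk_eq_add_mul_I _ _
    exact h

lemma chart_zero (z : ℍ) : chart z 0 = z.re := rfl

lemma chart_one (z : ℍ) : chart z 1 = Real.log z.im := rfl

lemma re_chart_symm (v : Plane) : (chart.symm v).re = v 0 := rfl

lemma im_chart_symm (v : Plane) : (chart.symm v).im = Real.exp (v 1) := rfl

/-- Smoothness of a self-map of the upper half-plane at a point, in the coordinates `chart`. -/
def SmoothAt (f : ℍ → ℍ) (z : ℍ) : Prop :=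
  ContDiffAt ℝ ∞ (chart ∘ f ∘ chart.symm) (chart z)

lemma smoothAt_id (z : ℍ) : SmoothAt id z := by
  have : (chart ∘ id ∘ chart.symm : Plane → Plane) = id := by ext1 v; simp
  rw [SmoothAt, this]
  exact contDiffAt_id

lemma SmoothAt.comp {f g : ℍ → ℍ} {z : ℍ} (hf : SmoothAt f (g z)) (hg : SmoothAt g z) :
    SmoothAt (f ∘ g) z := by
  have e : (chart ∘ (f ∘ g) ∘ chart.symm : Plane → Plane)
      = (chart ∘ f ∘ chart.symm) ∘ (chart ∘ g ∘ chart.symm) := by ext1 v; simp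
  rw [SmoothAt, e]
  refine ContDiffAt.comp _ ?_ hg
  simpa [SmoothAt] using hf

lemma SmoothAt.congr {f g : ℍ → ℍ} {z : ℍ} (hf : SmoothAt f z) (h : g =ᶠ[𝓝 z] f) :
    SmoothAt g z := by
  refine ContDiffAt.congr_of_eventuallyEq hf ?_
  have h1 : Filter.Tendsto chart.symm (𝓝 (chart z)) (𝓝 z) := by
    have := chart.symm.continuous.tendsto (chart z)
    rwa [chart.symm_apply_apply] at this
  filter_upwards [h1.eventually h] with v hv
  simp only [Function.comp_apply, hv]

lemma smoothAt_simple_smul (i : Fin 3) (z : ℍ) : SmoothAt (fun y => cs.simple i • y) z := by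
  refine ContDiff.contDiffAt ?_
  have hD : ∀ v : Plane, (2 * wallVec i 0 * v 0 + wallVec i 1) ^ 2
      + (2 * wallVec i 0 * Real.exp (v 1)) ^ 2 ≠ 0 := fun v =>
    (normSq_denom_reflMatrix_pos _ (form_wallVec_self i) (chart.symm v)).ne'
  rw [contDiff_euclidean]
  intro j
  fin_cases j
  · have : (fun v : Plane => (chart ∘ (fun y : ℍ => cs.simple i • y) ∘ chart.symm) v 0) =
        fun v => ((-wallVec i 1 * v 0 - 2 * wallVec i 2) * (2 * wallVec i 0 * v 0 + wallVec i 1)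
          - 2 * wallVec i 0 * wallVec i 1 * Real.exp (v 1) ^ 2) /
          ((2 * wallVec i 0 * v 0 + wallVec i 1) ^ 2 + (2 * wallVec i 0 * Real.exp (v 1)) ^ 2) := by
      ext1 v
      simp only [Function.comp_apply, chart_zero, simple_smul, wallMatrix, re_reflMatrix_smul,
        re_chart_symm, im_chart_symm]
    refine this ▸ ContDiff.div ?_ ?_ hD <;> fun_prop
  · have : (fun v : Plane => (chart ∘ (fun y : ℍ => cs.simple i • y) ∘ chart.symm) v 1) =
        fun v => Real.log (Real.exp (v 1) /
          ((2 * wallVec i 0 * v 0 + wallVec i 1) ^ 2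
            + (2 * wallVec i 0 * Real.exp (v 1)) ^ 2)) := by
      ext1 v
      simp only [Function.comp_apply, chart_one, simple_smul, wallMatrix, im_reflMatrix_smul,
        re_chart_symm, im_chart_symm]
    refine this ▸ ContDiff.log (ContDiff.div ?_ ?_ hD) fun v =>
      div_ne_zero (Real.exp_pos _).ne' (hD v) <;> fun_prop

lemma smoothAt_smul (w : W) (z : ℍ) : SmoothAt (fun y => w • y) z := by
  induction w using cs.simple_induction_left with
  | one => exact (smoothAt_id z).congr (.of_forall fun y => one_smul W y)
  | mul_simple_left w i hw =>
    refine (SmoothAt.comp (smoothAt_simple_smul i (w • z)) hw).congr (.of_forall fun y => ?_)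
    simp [mul_smul]

lemma smoothAt_tri_smul (x : Triangle237) (z : ℍ) : SmoothAt (fun y => x • y) z :=
  smoothAt_smul _ z

/-! ### A compactly supported twist -/

/-- The angle profile of the twist around `P`: one on the disc of radius `R`, zero outside the disc
of radius `√2 R`. -/
def profile (P : Plane) (R : ℝ) (v : Plane) : ℝ :=
  Real.smoothTransition (2 - ((v 0 - P 0) ^ 2 + (v 1 - P 1) ^ 2) / R ^ 2)

/-- The rotation by `s` radians of the disc of radius `R` around `P`, damped to the identity outside
the disc of radius `√2 R`. -/
def twist (P : Plane) (R s : ℝ) (v : Plane) : Plane :=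
  !₂[P 0 + (Real.cos (s * profile P R v) * (v 0 - P 0)
      - Real.sin (s * profile P R v) * (v 1 - P 1)),
    P 1 + (Real.sin (s * profile P R v) * (v 0 - P 0)
      + Real.cos (s * profile P R v) * (v 1 - P 1))]

variable {P : Plane} {R : ℝ}

lemma twist_apply_zero (s : ℝ) (v : Plane) : twist P R s v 0 =
    P 0 + (Real.cos (s * profile P R v) * (v 0 - P 0)
      - Real.sin (s * profile P R v) * (v 1 - P 1)) := rfl

lemma twist_apply_one (s : ℝ) (v : Plane) : twist P R s v 1 =
    P 1 + (Real.sin (s * profile P R v) * (v 0 - P 0)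
      + Real.cos (s * profile P R v) * (v 1 - P 1)) := rfl

lemma profile_twist (s : ℝ) (v : Plane) : profile P R (twist P R s v) = profile P R v := by
  conv_lhs => rw [profile, twist_apply_zero, twist_apply_one]
  conv_rhs => rw [profile]
  congr 3
  have := Real.sin_sq_add_cos_sq (s * profile P R v)
  linear_combination ((v 0 - P 0) ^ 2 + (v 1 - P 1) ^ 2) * this

lemma twist_add (s t : ℝ) (v : Plane) : twist P R (s + t) v = twist P R s (twist P R t v) := by
  ext i
  fin_cases i
  · change twist P R (s + t) v 0 = twist P R s (twist P R t v) 0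
    rw [twist_apply_zero, twist_apply_zero, profile_twist, twist_apply_zero, twist_apply_one,
      add_mul, Real.cos_add, Real.sin_add]
    ring
  · change twist P R (s + t) v 1 = twist P R s (twist P R t v) 1
    rw [twist_apply_one, twist_apply_one, profile_twist, twist_apply_zero, twist_apply_one,
      add_mul, Real.cos_add, Real.sin_add]
    ring

lemma twist_of_profile_eq_zero {s : ℝ} {v : Plane} (h : s * profile P R v = 0) :
    twist P R s v = v := by
  ext i
  fin_cases i
  · change twist P R s v 0 = v 0
    rw [twist_apply_zero, h, Real.cos_zero, Real.sin_zero]; ring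
  · change twist P R s v 1 = v 1
    rw [twist_apply_one, h, Real.cos_zero, Real.sin_zero]; ring

lemma twist_of_le (hR : 0 < R) {s : ℝ} {v : Plane} (h : 2 * R ≤ dist v P) : twist P R s v = v := by
  refine twist_of_profile_eq_zero ?_
  have h2 : (2 * R) ^ 2 ≤ (v 0 - P 0) ^ 2 + (v 1 - P 1) ^ 2 := by
    have := EuclideanSpace.dist_eq v P
    rw [this, Fin.sum_univ_two, Real.dist_eq, Real.dist_eq, sq_abs, sq_abs] at h
    exact Real.le_sqrt' (by positivity) |>.1 h
  rw [profile, Real.smoothTransition.zero_of_nonpos, mul_zero]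
  rw [sub_nonpos, le_div_iff₀ (by positivity)]
  nlinarith

lemma twist_center (s : ℝ) : twist P R s P = P := by
  ext i
  fin_cases i
  · change twist P R s P 0 = P 0
    rw [twist_apply_zero]; ring
  · change twist P R s P 1 = P 1
    rw [twist_apply_one]; ring

lemma contDiff_twist (s : ℝ) : ContDiff ℝ ∞ (twist P R s) := by
  have h : ContDiff ℝ ∞ (profile P R) := by
    unfold profile
    refine Real.smoothTransition.contDiff.comp ?_
    fun_prop
  rw [contDiff_euclidean]
  intro i
  fin_cases i
  · change ContDiff ℝ ∞ fun v => twist P R s v 0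
    simp only [twist_apply_zero]
    fun_prop
  · change ContDiff ℝ ∞ fun v => twist P R s v 1
    simp only [twist_apply_one]
    fun_prop

/-- As `π` is irrational, the rotation by one radian has infinite order. -/
lemma exists_twist_ne (hR : 0 < R) {k : ℤ} (hk : k ≠ 0) : ∃ v, twist P R k v ≠ v := by
  refine ⟨!₂[P 0 + R, P 1], fun h => hk ?_⟩
  have hp : profile P R !₂[P 0 + R, P 1] = 1 := by
    refine Real.smoothTransition.one_of_one_le ?_
    simp
    rw [div_self (by positivity)]
    norm_num
  have h0 := congrArg (fun v : Plane => v 0) h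
  simp only [twist_apply_zero, hp] at h0
  simp at h0
  have hcos : Real.cos k = 1 := by
    have : Real.cos k * R = 1 * R := by linarith
    exact mul_right_cancel₀ hR.ne' this
  obtain ⟨n, hn⟩ := (Real.cos_eq_one_iff _).1 hcos
  by_contra hk
  have hn0 : n ≠ 0 := by
    rintro rfl
    rw [Int.cast_zero, zero_mul] at hn
    exact hk (by exact_mod_cast hn.symm)
  refine irrational_pi ⟨(k : ℚ) / (n * 2), ?_⟩
  have : (n : ℝ) ≠ 0 := by exact_mod_cast hn0
  push_cast
  rw [← hn]
  field_simp

/-- Around every point of `ℍ` there is an action of `ℤ` by diffeomorphisms with small support. -/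
lemma exists_twist (z₀ : ℍ) {r : ℝ} (hr : 0 < r) :
    ∃ τ : ℤ → ℍ → ℍ, (∀ z, τ 0 z = z) ∧ (∀ m n z, τ (m + n) z = τ m (τ n z)) ∧
      (∀ n z, SmoothAt (τ n) z) ∧ (∀ n z, r ≤ dist z z₀ → τ n z = z) ∧ (∀ n, τ n z₀ = z₀) ∧
      ∀ n, n ≠ 0 → ∃ z, τ n z ≠ z := by
  obtain ⟨R, hR, hball⟩ : ∃ R > 0, ∀ z, r ≤ dist z z₀ → 2 * R ≤ dist (chart z) (chart z₀) := by
    have h := chart.symm.continuous.continuousAt (x := chart z₀)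
    obtain ⟨ε, hε, H⟩ := Metric.continuousAt_iff.1 h r hr
    refine ⟨ε / 2, by positivity, fun z hz => ?_⟩
    by_contra! hlt
    have := H (x := chart z) (by linarith)
    rw [chart.symm_apply_apply, chart.symm_apply_apply] at this
    linarith
  refine ⟨fun n z => chart.symm (twist (chart z₀) R n (chart z)), fun z => ?_, fun m n z => ?_,
    fun n z => ?_, fun n z hz => ?_, fun n => ?_, fun n hn => ?_⟩
  · beta_reduce
    rw [Int.cast_zero, twist_of_profile_eq_zero (zero_mul _), chart.symm_apply_apply]
  · beta_reduce
    rw [chart.apply_symm_apply, Int.cast_add, twist_add]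
  · have e : (chart ∘ (fun z => chart.symm (twist (chart z₀) R n (chart z))) ∘ chart.symm)
        = twist (chart z₀) R n := by ext1 v; simp
    rw [SmoothAt, e]
    exact (contDiff_twist _).contDiffAt
  · beta_reduce
    rw [twist_of_le hR (hball z hz), chart.symm_apply_apply]
  · beta_reduce
    rw [twist_center, chart.symm_apply_apply]
  · obtain ⟨v, hv⟩ := exists_twist_ne (P := chart z₀) hR hn
    refine ⟨chart.symm v, fun h => hv ?_⟩
    beta_reduce at h
    rw [chart.apply_symm_apply] at h
    exact chart.symm.injective h

end

end TriangleReflection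

/-! ### The Seifert group acting on the plane by diffeomorphisms -/

namespace TriangleReflection

open UpperHalfPlane PresentedGroup Topology
open scoped MatrixGroups

noncomputable section

/-- A set-theoretic section of the projection to the triangle group. -/
def sec (x : Triangle237) : Seifert237 := Function.surjInv proj_surjective x

lemma proj_sec (x : Triangle237) : proj (sec x) = x := Function.surjInv_eq _ _

lemma exists_cocycle (g : Seifert237) (x : Triangle237) :
    ∃ k : ℤ, g * sec x = sec (proj g * x) * tt ^ k := by
  obtain ⟨k, hk⟩ := exists_tt_zpow (g := (sec (proj g * x))⁻¹ * (g * sec x)) (by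
    rw [map_mul proj, map_inv proj, map_mul proj, proj_sec, proj_sec, inv_mul_cancel])
  exact ⟨k, by rw [hk, mul_inv_cancel_left]⟩

/-- The cocycle of the permutation representation of `G` on the cosets of the fibre subgroup. -/
def cocycle (g : Seifert237) (x : Triangle237) : ℤ := (exists_cocycle g x).choose

lemma mul_sec (g : Seifert237) (x : Triangle237) :
    g * sec x = sec (proj g * x) * tt ^ cocycle g x := (exists_cocycle g x).choose_spec

lemma cocycle_eq {g : Seifert237} {x : Triangle237} {k : ℤ}
    (h : g * sec x = sec (proj g * x) * tt ^ k) : cocycle g x = k :=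
  tt_zpow_injective (mul_left_cancel ((mul_sec g x).symm.trans h))

lemma cocycle_one (x : Triangle237) : cocycle 1 x = 0 :=
  cocycle_eq (by rw [map_one proj, one_mul, one_mul, zpow_zero, mul_one])

lemma cocycle_mul (g h : Seifert237) (x : Triangle237) :
    cocycle (g * h) x = cocycle g (proj h * x) + cocycle h x := by
  refine cocycle_eq ?_
  rw [mul_assoc g, mul_sec h, ← mul_assoc g, mul_sec g, map_mul proj, ← mul_assoc (proj g),
    mul_assoc, zpow_add tt]

lemma cocycle_tt_zpow (k : ℤ) (x : Triangle237) : cocycle (tt ^ k) x = k :=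
  cocycle_eq (by rw [proj_tt_zpow, one_mul, tt_zpow_comm])

/-- The points with positive heights are moved off each other by the triangle group. -/
lemma eq_one_of_ht_pos {x : Triangle237} {z : ℍ} (h : ∀ i, 0 < ht i z)
    (h' : ∀ i, 0 < ht i (x • z)) : x = 1 := by
  have h1 : x • z = z := by
    have : fold (x • z) = fold z := fold_smul (toW x) z
    rwa [fold_of_nonneg fun i => (h i).le, fold_of_nonneg fun i => (h' i).le] at this
  have h2 : toW x ∈ parab z := mem_parab_of_smul_eq (fun i => (h i).le) h1
  have h3 : parab z = ⊥ := by
    rw [parab, Subgroup.closure_eq_bot_iff]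
    rintro w ⟨i, hi, -⟩
    exact absurd hi (h i).ne'
  rw [h3, Subgroup.mem_bot] at h2
  exact toW_injective (by rw [h2, map_one toW])

lemma exists_ht_pos : ∃ z : ℍ, ∀ i, 0 < ht i z := by
  have hd := del_pos
  have hd1 := del_lt_one
  have hr := rr_lt
  have hs := rr_add_qq
  have hy : 0 < 1 - del / 4 - (del / 4) ^ 2 := by nlinarith
  let z : ℍ := ⟨⟨-(del / 4), √(1 - del / 4 - (del / 4) ^ 2)⟩, Real.sqrt_pos.2 hy⟩
  have hre : z.re = -(del / 4) := rfl
  have him : z.im ^ 2 = 1 - del / 4 - (del / 4) ^ 2 := Real.sq_sqrt hy.le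
  have hp := z.im_pos
  refine ⟨z, fun i => ?_⟩
  fin_cases i
  · change 0 < ht 0 z
    rw [ht_zero, hre]
    exact div_pos (by linarith) hp
  · change 0 < ht 1 z
    rw [ht_one, him, hre]
    exact div_pos (by nlinarith) (by linarith)
  · change 0 < ht 2 z
    rw [ht_two, him, hre]
    exact div_pos (by nlinarith) (by linarith)

/-- Letting `G` act on `ℍ` through the triangle group and, in addition, inserting powers of a twist
into the translates of a small disc according to the cocycle, yields a faithful action by
diffeomorphisms. -/
lemma exists_faithful_action :
    ∃ F : Seifert237 → ℍ → ℍ, (∀ z, F 1 z = z) ∧ (∀ g h z, F (g * h) z = F g (F h z)) ∧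
      (∀ g z, SmoothAt (F g) z) ∧ ∀ g, (∀ z, F g z = z) → g = 1 := by
  obtain ⟨z₀, hz₀⟩ := exists_ht_pos
  obtain ⟨r, hr, hball⟩ := exists_ball_ht_pos z₀
  obtain ⟨τ, τ_zero, τ_add, τ_smooth, τ_far, τ_fix, τ_ne⟩ := exists_twist z₀ (half_pos hr)
  have hdisj : ∀ (x : Triangle237) (z : ℍ), dist z z₀ < r → dist (x • z) z₀ < r → x = 1 :=
    fun x z h1 h2 => eq_one_of_ht_pos (fun i => hball z h1 i (hz₀ i))
      (fun i => hball _ h2 i (hz₀ i))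
  have τ_near : ∀ n z, dist z z₀ < r → dist (τ n z) z₀ < r := fun n z h => by
    by_contra! h1
    have h2 := τ_far (-n) _ ((half_le_self hr.le).trans h1)
    rw [← τ_add, neg_add_cancel, τ_zero] at h2
    rw [← h2] at h1
    exact absurd h (not_lt.2 h1)
  -- the index of the translate of the disc containing a given point
  have hidx : ∀ z : ℍ, ∃ x : Triangle237, ∀ y : Triangle237, dist (y⁻¹ • z) z₀ < r → x = y := by
    intro z
    by_cases h : ∃ y : Triangle237, dist (y⁻¹ • z) z₀ < r
    · obtain ⟨x, hx⟩ := h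
      refine ⟨x, fun y hy => ?_⟩
      have := hdisj (y⁻¹ * x) (x⁻¹ • z) hx (by rwa [mul_smul, smul_inv_smul])
      exact (inv_mul_eq_one.1 this).symm
    · exact ⟨1, fun y hy => absurd ⟨y, hy⟩ h⟩
  choose idx hidx using hidx
  let F : Seifert237 → ℍ → ℍ := fun g z =>
    proj g • idx z • τ (cocycle g (idx z)) ((idx z)⁻¹ • z)
  -- the value on a translate of the disc, and away from the translates
  have F_in : ∀ (g : Seifert237) (x : Triangle237) (z : ℍ), dist (x⁻¹ • z) z₀ < r →
      F g z = proj g • x • τ (cocycle g x) (x⁻¹ • z) := fun g x z h => by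
    simp only [F, hidx z x h]
  have F_out : ∀ (g : Seifert237) (z : ℍ), (∀ x : Triangle237, r / 2 ≤ dist (x⁻¹ • z) z₀) →
      F g z = proj g • z := fun g z h => by
    simp only [F]
    rw [τ_far _ _ (h _), smul_inv_smul]
  refine ⟨F, fun z => ?_, fun g h z => ?_, fun g z => ?_, fun g hg => ?_⟩
  · simp only [F, cocycle_one, τ_zero, map_one proj, one_smul, smul_inv_smul]
  · by_cases hz : ∃ x : Triangle237, dist (x⁻¹ • z) z₀ < r
    · obtain ⟨x, hx⟩ := hz
      have e : (proj h * x)⁻¹ • proj h • x • τ (cocycle h x) (x⁻¹ • z)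
          = τ (cocycle h x) (x⁻¹ • z) := by
        rw [smul_smul (proj h), inv_smul_smul]
      rw [F_in (g * h) x z hx, F_in h x z hx, F_in g (proj h * x) _ (by
        rw [e]; exact τ_near _ _ hx), e, cocycle_mul, τ_add, map_mul proj, mul_smul, mul_smul]
    · push Not at hz
      have hz' : ∀ (y x : Triangle237), r / 2 ≤ dist (x⁻¹ • y • z) z₀ := fun y x => by
        have := hz (y⁻¹ * x)
        rw [mul_inv_rev, inv_inv, mul_smul] at this
        linarith
      have hz1 : ∀ x : Triangle237, r / 2 ≤ dist (x⁻¹ • z) z₀ := fun x => by linarith [hz x]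
      rw [F_out _ z hz1, F_out _ z hz1, F_out _ _ (hz' _), map_mul proj, mul_smul]
  · by_cases hz : ∃ x : Triangle237, dist (x⁻¹ • z) z₀ < r
    · obtain ⟨x, hx⟩ := hz
      have h1 : SmoothAt (fun y => proj g • x • τ (cocycle g x) (x⁻¹ • y)) z :=
        (smoothAt_tri_smul (proj g) _).comp ((smoothAt_tri_smul x _).comp
          ((τ_smooth _ _).comp (smoothAt_tri_smul x⁻¹ z)))
      refine h1.congr ?_
      have hopen : IsOpen {y : ℍ | dist (x⁻¹ • y) z₀ < r} :=
        isOpen_lt (by fun_prop) continuous_const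
      filter_upwards [hopen.mem_nhds hx] with y hy using F_in g x y hy
    · push Not at hz
      refine (smoothAt_tri_smul (proj g) z).congr ?_
      filter_upwards [Metric.ball_mem_nhds z (half_pos hr)] with y hy
      refine F_out g y fun x => ?_
      -- the group acts by isometries
      have h1 := dist_triangle (x⁻¹ • z) (x⁻¹ • y) z₀
      rw [dist_smul, dist_comm z y] at h1
      linarith [hz x, Metric.mem_ball.1 hy]
  · have h0 : proj g = 1 := by
      have h1 : dist ((1 : Triangle237)⁻¹ • z₀) z₀ < r := by simpa using hr
      have h2 := F_in g 1 z₀ h1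
      rw [hg, inv_one, one_smul, one_smul, τ_fix] at h2
      exact hdisj (proj g) z₀ (by simpa using hr) (by rw [← h2]; simpa using hr)
    obtain ⟨k, rfl⟩ := exists_tt_zpow h0
    by_contra hne
    obtain ⟨z, hz⟩ := τ_ne k (by rintro rfl; exact hne (zpow_zero tt))
    have h1 : dist ((1 : Triangle237)⁻¹ • z) z₀ < r := by
      rw [inv_one, one_smul]
      by_contra! h
      exact hz (τ_far _ _ ((half_le_self hr.le).trans h))
    have h2 := F_in (tt ^ k) 1 z h1
    rw [hg, proj_tt_zpow, cocycle_tt_zpow, inv_one, one_smul, one_smul, one_smul] at h2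
    exact hz h2.symm

lemma det_fderiv_ne_zero {f : Equiv.Perm Plane} (hf : ContDiff ℝ ∞ (f : Plane → Plane))
    (hf' : ContDiff ℝ ∞ (f.symm : Plane → Plane)) (v : Plane) :
    (fderiv ℝ (f : Plane → Plane) v).det ≠ 0 := by
  have hc : (f.symm : Plane → Plane) ∘ (f : Plane → Plane) = id := by
    funext y; simp
  have h : (fderiv ℝ f.symm (f v)).comp (fderiv ℝ f v) = ContinuousLinearMap.id ℝ Plane := by
    rw [← fderiv_comp v (hf'.differentiable (by simp) _) (hf.differentiable (by simp) _), hc,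
      fderiv_id]
  have h1 : (fderiv ℝ f.symm (f v)).det * (fderiv ℝ f v).det = 1 := by
    rw [ContinuousLinearMap.det, ContinuousLinearMap.det, ← LinearMap.det_comp,
      ← ContinuousLinearMap.toLinearMap_comp, h, ContinuousLinearMap.coe_id, LinearMap.det_id]
  exact right_ne_zero_of_mul_eq_one h1

/-- The square of a diffeomorphism preserves the orientation: the sign of the Jacobian is
constant. -/
lemma sq_mem_diffeoPlus {f : Equiv.Perm Plane} (hf : ContDiff ℝ ∞ (f : Plane → Plane))
    (hf' : ContDiff ℝ ∞ (f.symm : Plane → Plane)) : f * f ∈ DiffeoPlus := by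
  refine ⟨hf.comp hf, hf'.comp hf', fun v => ?_⟩
  have h : fderiv ℝ ((f * f : Equiv.Perm Plane) : Plane → Plane) v
      = (fderiv ℝ f (f v)).comp (fderiv ℝ f v) :=
    fderiv_comp v (hf.differentiable (by simp) _) (hf.differentiable (by simp) _)
  rw [h, ContinuousLinearMap.det, ContinuousLinearMap.toLinearMap_comp, LinearMap.det_comp]
  have hcont : Continuous fun v => (fderiv ℝ (f : Plane → Plane) v).det :=
    ContinuousLinearMap.continuous_det.comp (hf.continuous_fderiv (by simp))
  have hne := det_fderiv_ne_zero hf hf'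
  by_contra! hle
  change (fderiv ℝ f (f v)).det * (fderiv ℝ f v).det ≤ 0 at hle
  rcases mul_nonpos_iff.1 hle with ⟨h1, h2⟩ | ⟨h1, h2⟩
  · obtain ⟨u, hu⟩ := mem_range_of_exists_le_of_exists_ge hcont ⟨v, h2⟩ ⟨f v, h1⟩
    exact hne u hu
  · obtain ⟨u, hu⟩ := mem_range_of_exists_le_of_exists_ge hcont ⟨f v, h1⟩ ⟨v, h2⟩
    exact hne u hu

lemma exists_injective_diffeoPlus : ∃ ρ : Seifert237 →* DiffeoPlus, Function.Injective ρ := by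
  obtain ⟨F, F_one, F_mul, F_smooth, F_inj⟩ := exists_faithful_action
  let Φ : Seifert237 →* Equiv.Perm Plane := MonoidHom.mk' (fun g =>
    { toFun := fun v => chart (F g (chart.symm v))
      invFun := fun v => chart (F g⁻¹ (chart.symm v))
      left_inv := fun v => by
        simp only [chart.symm_apply_apply, ← F_mul, inv_mul_cancel, F_one, chart.apply_symm_apply]
      right_inv := fun v => by
        simp only [chart.symm_apply_apply, ← F_mul, mul_inv_cancel, F_one,
          chart.apply_symm_apply] }) fun g h => by
        ext1 v
        change chart (F (g * h) (chart.symm v)) = chart (F g (chart.symm (chart (F h _))))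
        rw [chart.symm_apply_apply, F_mul]
  have hsmooth : ∀ g, ContDiff ℝ ∞ (fun v => chart (F g (chart.symm v))) := fun g =>
    contDiff_iff_contDiffAt.2 fun v => by
      have := F_smooth g (chart.symm v)
      rwa [SmoothAt, chart.apply_symm_apply] at this
  have hmem : ∀ g, Φ g ∈ DiffeoPlus := fun g =>
    sei_mem_of_sq_mem (H := DiffeoPlus.comap Φ) (fun k => by
      rw [Subgroup.mem_comap, pow_two k, map_mul]
      exact sq_mem_diffeoPlus (hsmooth k) (hsmooth k⁻¹)) g
  refine ⟨Φ.codRestrict _ hmem, (injective_iff_map_eq_one _).2 fun g hg => F_inj g fun z => ?_⟩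
  have h1 : Φ g = 1 := congrArg Subtype.val hg
  have h2 : chart (F g (chart.symm (chart z))) = chart z :=
    congrArg (fun f : Equiv.Perm Plane => f (chart z)) h1
  rw [chart.symm_apply_apply] at h2
  exact chart.injective h2

lemma TorsionFreeGroup.of_mulEquiv {K L : Type*} [Group K] [Group L] (e : K ≃* L)
    (h : TorsionFreeGroup K) : TorsionFreeGroup L := fun g hg hfin =>
  h (e.symm g) (fun h1 => hg (by simpa using h1)) (e.symm.toMonoidHom.isOfFinOrder hfin)

lemma LeftOrderable.of_mulEquiv {K L : Type*} [Group K] [Group L] (e : K ≃* L)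
    (h : LeftOrderable L) : LeftOrderable K := by
  obtain ⟨lt, hlt, hmul⟩ := h
  exact ⟨fun x y => lt (e x) (e y),
    (RelEmbedding.preimage e.toEquiv.toEmbedding lt).isStrictTotalOrder,
    fun x y z => by
      beta_reduce
      rw [map_mul, map_mul]
      exact hmul _ _ _⟩

instance : Finite SeifertGen :=
  Finite.of_surjective (![.a, .b, .c, .t] : Fin 4 → SeifertGen) fun g => match g with
    | .a => ⟨0, rfl⟩
    | .b => ⟨1, rfl⟩
    | .c => ⟨2, rfl⟩
    | .t => ⟨3, rfl⟩

instance : Group.IsFinitelyPresented Seifert237 := by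
  unfold Seifert237
  infer_instance

end

end TriangleReflection

/-! ### The quotient of the upper half-plane by the triangle group is the sphere -/

namespace TriangleReflection

open UpperHalfPlane PresentedGroup Topology
open scoped MatrixGroups

noncomputable section

/-- The smallest height of a point. -/
def inradius (z : ℍ) : ℝ := min (ht 0 z) (min (ht 1 z) (ht 2 z))

lemma continuous_inradius : Continuous inradius := by
  unfold inradius
  fun_prop

lemma inradius_le (z : ℍ) (i : Fin 3) : inradius z ≤ ht i z := by
  unfold inradius
  fin_cases i <;> simp

lemma inradius_fold_nonneg (z : ℍ) : 0 ≤ inradius (fold z) :=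
  le_min (fold_nonneg z 0) (le_min (fold_nonneg z 1) (fold_nonneg z 2))

lemma exists_ht_eq_zero {z : ℍ} (h : inradius z = 0) : ∃ i, ht i z = 0 := by
  unfold inradius at h
  rcases min_choice (ht 0 z) (min (ht 1 z) (ht 2 z)) with e | e
  · exact ⟨0, e ▸ h⟩
  · rcases min_choice (ht 1 z) (ht 2 z) with e' | e'
    · exact ⟨1, by rw [← h, e, e']⟩
    · exact ⟨2, by rw [← h, e, e']⟩

lemma parab_eq_bot {z : ℍ} (h : 0 < inradius z) : parab z = ⊥ := by
  rw [parab, Subgroup.closure_eq_bot_iff]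
  rintro w ⟨i, hi, -⟩
  exact absurd hi (h.trans_le (inradius_le z i)).ne'

/-- Near `x`, folding preserves the distance to `x`. -/
lemma dist_fold_eq (x : ℍ) : ∃ ε > 0, ∀ z, dist z x < ε → dist (fold z) (fold x) = dist z x := by
  obtain ⟨ε, hε, H⟩ := exists_loc_near x
  refine ⟨ε, hε, fun z hz => ?_⟩
  have h1 := smul_eq_of_mem_parab (H z hz)
  have h2 : fold x = (loc z)⁻¹ • x := by
    rw [mul_smul, inv_smul_eq_iff, loc_smul_fold] at h1
    exact eq_inv_smul_iff.2 h1
  rw [h2, fold, dist_smul]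

lemma continuous_fold : Continuous fold := by
  refine Metric.continuous_iff.2 fun x ε hε => ?_
  obtain ⟨δ, hδ, H⟩ := dist_fold_eq x
  refine ⟨min δ ε, lt_min hδ hε, fun z hz => ?_⟩
  rw [H z (hz.trans_le (min_le_left _ _))]
  exact hz.trans_le (min_le_right _ _)

/-- The sign of the reflection group element which locates the triangle of `z`, as a number. -/
def par (z : ℍ) : ℝ := ((sgn (loc z) : ℤ) : ℝ)

lemma par_cases (z : ℍ) : par z = 1 ∨ par z = -1 := by
  rcases Int.units_eq_one_or (sgn (loc z)) with h | h <;> simp [par, h]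

lemma sgn_eq_of_par_eq {z w : ℍ} (h : par z = par w) : sgn (loc z) = sgn (loc w) := by
  refine Units.ext ?_
  unfold par at h
  exact_mod_cast h

/-- The signed smallest height. -/
def signed (z : ℍ) : ℝ := par z * inradius (fold z)

lemma abs_signed (z : ℍ) : |signed z| = inradius (fold z) := by
  rw [signed, abs_mul, abs_of_nonneg (inradius_fold_nonneg z)]
  rcases par_cases z with h | h <;> simp [h]

lemma loc_smul_of_pos {w : W} {z : ℍ} (h : 0 < inradius (fold z)) : loc (w • z) = w * loc z := by
  have h1 := loc_smul_mem w z
  rw [parab_eq_bot h, Subgroup.mem_bot, inv_mul_eq_one] at h1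
  exact h1

/-- Points on a wall have no well-defined sign, but there the height vanishes. -/
lemma signed_smul (w : W) (z : ℍ) : signed (w • z) = (sgn w : ℤ) * signed z := by
  unfold signed
  rw [fold_smul]
  rcases (inradius_fold_nonneg z).eq_or_lt with h | h
  · rw [← h]; ring
  · rw [par, par, loc_smul_of_pos h, map_mul]
    push_cast
    ring

lemma continuous_signed : Continuous signed := by
  have hin : Continuous fun z => inradius (fold z) := continuous_inradius.comp continuous_fold
  refine continuous_iff_continuousAt.2 fun x => ?_
  rcases (inradius_fold_nonneg x).eq_or_lt with h | h
  · have hx : signed x = 0 := by rw [signed, ← h, mul_zero]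
    rw [ContinuousAt, hx]
    refine (tendsto_zero_iff_abs_tendsto_zero _).2 ?_
    have := hin.tendsto x
    rw [← h] at this
    simpa only [Function.comp_def, abs_signed] using this
  · obtain ⟨ε, hε, H⟩ := exists_loc_near x
    have h1 : ∀ᶠ z in 𝓝 x, signed z = par x * inradius (fold z) := by
      filter_upwards [Metric.ball_mem_nhds x hε] with z hz
      have h2 := H z hz
      rw [parab_eq_bot h, Subgroup.mem_bot, inv_mul_eq_one] at h2
      rw [signed, par, par, h2]
    exact ContinuousAt.congr (continuous_const.mul hin).continuousAt
      (h1.mono fun _ h => h.symm)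

/-- The deviation of the `i`-th height of the folded point from the mean height. -/
def dev (i : Fin 3) (z : ℍ) : ℝ :=
  ht i (fold z) - (ht 0 (fold z) + ht 1 (fold z) + ht 2 (fold z)) / 3

lemma sum_dev (z : ℍ) : dev 0 z + dev 1 z + dev 2 z = 0 := by
  unfold dev; ring

lemma continuous_dev (i : Fin 3) : Continuous (dev i) := by
  unfold dev
  have h := fun i => (continuous_ht i).comp continuous_fold
  exact (h i).sub ((((h 0).add (h 1)).add (h 2)).div_const 3)

lemma dev_smul (w : W) (i : Fin 3) (z : ℍ) : dev i (w • z) = dev i z := by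
  unfold dev
  rw [fold_smul]

/-- The heights are recovered from the deviations and the smallest height. -/
lemma ht_fold_eq (i : Fin 3) (z : ℍ) :
    ht i (fold z) = dev i z + |signed z| - min (dev 0 z) (min (dev 1 z) (dev 2 z)) := by
  rw [abs_signed, inradius]
  unfold dev
  rw [min_sub_sub_right, min_sub_sub_right]
  ring

/-- The triangle group invariant map to `ℝ³ ∖ {0}`: the two halves of the fundamental domain are
flattened onto the plane and pushed off it in opposite directions. -/
def raw (z : ℍ) : EuclideanSpace ℝ (Fin 3) := !₂[dev 1 z, dev 2 z, signed z]

lemma raw_ne_zero (z : ℍ) : raw z ≠ 0 := fun h => by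
  have h1 : dev 1 z = 0 := congrArg (fun v : EuclideanSpace ℝ (Fin 3) => v 0) h
  have h2 : dev 2 z = 0 := congrArg (fun v : EuclideanSpace ℝ (Fin 3) => v 1) h
  have h3 : signed z = 0 := congrArg (fun v : EuclideanSpace ℝ (Fin 3) => v 2) h
  have h0 : dev 0 z = 0 := by linarith [sum_dev z]
  obtain ⟨i, hi⟩ := exists_ht_ne_zero (fold z)
  refine hi ?_
  rw [ht_fold_eq, h0, h1, h2, h3]
  fin_cases i <;> simp [h0, h1, h2]

lemma continuous_raw : Continuous raw := by
  refine (PiLp.continuous_toLp 2 _).comp (continuous_pi fun i => ?_)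
  fin_cases i
  · exact continuous_dev 1
  · exact continuous_dev 2
  · exact continuous_signed

/-- The orbit map of the triangle group, with values in the sphere. -/
def orbitMap (z : ℍ) : Sphere2 :=
  ⟨‖raw z‖⁻¹ • raw z, by
    rw [mem_sphere_zero_iff_norm, norm_smul, norm_inv, norm_norm,
      inv_mul_cancel₀ (norm_ne_zero_iff.2 (raw_ne_zero z))]⟩

lemma continuous_orbitMap : Continuous orbitMap := by
  refine Continuous.subtype_mk ?_ _
  exact (continuous_raw.norm.inv₀ fun z => norm_ne_zero_iff.2 (raw_ne_zero z)).smul continuous_raw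

lemma orbitMap_smul (x : Triangle237) (z : ℍ) : orbitMap (x • z) = orbitMap z := by
  have : raw (x • z) = raw z := by
    change raw (toW x • z) = raw z
    simp only [raw, dev_smul, signed_smul, sgn_toW, Units.val_one, Int.cast_one, one_mul]
  refine Subtype.ext ?_
  change ‖raw (x • z)‖⁻¹ • raw (x • z) = ‖raw z‖⁻¹ • raw z
  rw [this]

lemma orbitMap_eq_iff_exists_pos {z : ℍ} {v : Sphere2} :
    orbitMap z = v ↔ ∃ c : ℝ, 0 < c ∧ raw z = c • (v : EuclideanSpace ℝ (Fin 3)) := by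
  have hn : 0 < ‖raw z‖ := norm_pos_iff.2 (raw_ne_zero z)
  constructor
  · rintro rfl
    exact ⟨‖raw z‖, hn, (smul_inv_smul₀ hn.ne' _).symm⟩
  · rintro ⟨c, hc, h⟩
    refine Subtype.ext ?_
    change ‖raw z‖⁻¹ • raw z = _
    have hv : ‖(v : EuclideanSpace ℝ (Fin 3))‖ = 1 := mem_sphere_zero_iff_norm.1 v.2
    rw [h, norm_smul, hv, mul_one, Real.norm_of_nonneg hc.le, inv_smul_smul₀ hc.ne']

/-- The quadratic form which is constant on the hyperboloid. -/
def hyp (p : Fin 3 → ℝ) : ℝ :=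
  (2 * p 2 + p 0 + 2 * rr * p 1) * (2 * p 2 + p 0 - 2 * qq * p 1) - del ^ 2 * p 0 ^ 2

lemma hyp_ht (z : ℍ) : hyp (fun i => ht i z) = del ^ 2 := by
  unfold hyp
  linear_combination ht_quadratic z

lemma hyp_smul (c : ℝ) (p : Fin 3 → ℝ) : hyp (fun i => c * p i) = c ^ 2 * hyp p := by
  unfold hyp; ring

/-- Points with the same image have proportional height vectors after folding, hence the same folded
point, as the hyperboloid meets a ray only once; and their signs agree. -/
lemma exists_smul_eq_of_orbitMap_eq {z w : ℍ} (h : orbitMap z = orbitMap w) :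
    ∃ x : Triangle237, x • w = z := by
  obtain ⟨c, hc, h1⟩ := orbitMap_eq_iff_exists_pos.1 h
  have hw : 0 < ‖raw w‖ := norm_pos_iff.2 (raw_ne_zero w)
  obtain ⟨c, hc, h1⟩ : ∃ c : ℝ, 0 < c ∧ raw z = c • raw w :=
    ⟨c * ‖raw w‖⁻¹, by positivity, by rw [h1, mul_smul]; rfl⟩
  have e1 : dev 1 z = c * dev 1 w := congrArg (fun v : EuclideanSpace ℝ (Fin 3) => v 0) h1
  have e2 : dev 2 z = c * dev 2 w := congrArg (fun v : EuclideanSpace ℝ (Fin 3) => v 1) h1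
  have e3 : signed z = c * signed w := congrArg (fun v : EuclideanSpace ℝ (Fin 3) => v 2) h1
  have e0 : dev 0 z = c * dev 0 w := by linear_combination sum_dev z - c * sum_dev w - e1 - e2
  have e : ∀ i, ht i (fold z) = c * ht i (fold w) := fun i => by
    rw [ht_fold_eq, ht_fold_eq, e0, e1, e2, e3, abs_mul, abs_of_pos hc, mul_sub, mul_add,
      mul_min_of_nonneg _ _ hc.le, mul_min_of_nonneg _ _ hc.le]
    fin_cases i <;> simp [e0, e1, e2]
  -- both points are on the hyperboloid
  have hc1 : c = 1 := by
    have h2 := hyp_ht (fold z)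
    simp only [e] at h2
    rw [hyp_smul, hyp_ht] at h2
    have hd : del ^ 2 ≠ 0 := (pow_pos del_pos 2).ne'
    have h3 : c ^ 2 = 1 := by
      refine mul_right_cancel₀ hd ?_
      rw [h2, one_mul]
    nlinarith
  rw [hc1] at e e3
  have hfold : fold z = fold w := eq_of_ht_eq fun i => by rw [e, one_mul]
  rcases (inradius_fold_nonneg w).eq_or_lt with h | h
  · obtain ⟨i, hi⟩ := exists_ht_eq_zero h.symm
    obtain ⟨x, hx⟩ := exists_tri_smul_eq hi hfold
    obtain ⟨y, hy⟩ := exists_tri_smul_eq hi (rfl : fold w = fold w)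
    exact ⟨x * y⁻¹, by rw [mul_smul, inv_smul_eq_iff.2 hy.symm, hx]⟩
  · have hpar : par z = par w := by
      unfold signed at e3
      rw [hfold, one_mul] at e3
      exact mul_right_cancel₀ h.ne' e3
    have hs : sgn (loc z * (loc w)⁻¹) = 1 := by
      rw [map_mul, map_inv, sgn_eq_of_par_eq hpar, mul_inv_cancel]
    obtain ⟨x, hx⟩ := mem_range_toW_of_sgn hs
    exact ⟨x, by rw [tri_smul_def, hx, smul_eq_of_fold_eq hfold]⟩

lemma orbitMap_eq_iff {z w : ℍ} : orbitMap z = orbitMap w ↔ ∃ x : Triangle237, x • w = z :=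
  ⟨exists_smul_eq_of_orbitMap_eq, fun ⟨x, hx⟩ => hx ▸ orbitMap_smul x w⟩

/-- Every nonzero vector with nonnegative entries is proportional to the height vector of a point
of the triangle. -/
lemma exists_ht_eq {p : Fin 3 → ℝ} (hp : ∀ i, 0 ≤ p i) (hne : ∃ i, p i ≠ 0) :
    ∃ (z : ℍ) (c : ℝ), 0 < c ∧ ∀ i, ht i z = c * p i := by
  have hd := del_pos
  have hd1 := del_lt_one
  have hr := rr_pos
  have hq := qq_neg
  have h0 := hp 0
  have h1 := hp 1
  have h2 := hp 2
  have hrq := rr_mul_qq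
  set A := 2 * p 2 + p 0 + 2 * rr * p 1 with hA
  set B := 2 * p 2 + p 0 - 2 * qq * p 1 with hB
  have hpos : 0 < p 0 ∨ 0 < p 1 ∨ 0 < p 2 := by
    obtain ⟨i, hi⟩ := hne
    have := lt_of_le_of_ne (hp i) (Ne.symm hi)
    fin_cases i
    · exact Or.inl this
    · exact Or.inr (Or.inl this)
    · exact Or.inr (Or.inr this)
  have hAB : A * B = (2 * p 2 + p 0) ^ 2 + 2 * (rr - qq) * (p 1 * (2 * p 2 + p 0))
      + 3 * p 1 ^ 2 := by
    rw [hA, hB]; linear_combination -4 * p 1 ^ 2 * hrq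
  have hApos : 0 < A := by
    have : 0 ≤ rr * p 1 := mul_nonneg hr.le h1
    rcases hpos with h | h | h
    · linarith
    · have : 0 < rr * p 1 := mul_pos hr h
      linarith
    · linarith
  have hQ : 0 < A * B - del ^ 2 * p 0 ^ 2 := by
    have e1 : 0 ≤ (rr - qq) * (p 1 * (2 * p 2 + p 0)) :=
      mul_nonneg (by linarith) (mul_nonneg h1 (by linarith))
    have e2 : 0 < 1 - del ^ 2 := by nlinarith
    have e3 : (2 * p 2 + p 0) ^ 2 - del ^ 2 * p 0 ^ 2 =
      4 * p 2 ^ 2 + 4 * (p 2 * p 0) + (1 - del ^ 2) * p 0 ^ 2 := by ring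
    have e4 : 0 ≤ (1 - del ^ 2) * p 0 ^ 2 := by positivity
    have e5 : 0 ≤ p 2 * p 0 := mul_nonneg h2 h0
    rw [hAB]
    rcases hpos with h | h | h
    · have : 0 < (1 - del ^ 2) * p 0 ^ 2 := by positivity
      nlinarith [sq_nonneg (p 1), sq_nonneg (p 2)]
    · have : 0 < p 1 ^ 2 := by positivity
      nlinarith [sq_nonneg (p 2)]
    · have : 0 < p 2 ^ 2 := by positivity
      nlinarith [sq_nonneg (p 1)]
  set Q := A * B - del ^ 2 * p 0 ^ 2 with hQdef
  set c := del / √Q with hc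
  have hsq : 0 < √Q := Real.sqrt_pos.2 hQ
  have hcpos : 0 < c := div_pos hd hsq
  have hc2 : c ^ 2 * Q = del ^ 2 := by
    rw [hc, div_pow, Real.sq_sqrt hQ.le, div_mul_cancel₀ _ hQ.ne']
  have hy : 0 < del / (c * A) := div_pos hd (mul_pos hcpos hApos)
  let z : ℍ := ⟨⟨-(c * p 0) * (del / (c * A)), del / (c * A)⟩, hy⟩
  have hre : z.re = -(c * p 0) * (del / (c * A)) := rfl
  have him : z.im = del / (c * A) := rfl
  have z0 : ht 0 z = c * p 0 := by
    rw [ht_zero, hre, him, neg_mul, neg_neg, mul_div_cancel_right₀ _ hy.ne']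
  have zA : 2 * ht 2 z + ht 0 z + 2 * rr * ht 1 z = c * A := by
    rw [ht_linear_combination, him, div_div_cancel₀ hd.ne']
  have zB : 2 * ht 2 z + ht 0 z - 2 * qq * ht 1 z = c * B := by
    have h3 := ht_quadratic z
    rw [zA, z0] at h3
    refine mul_left_cancel₀ (mul_pos hcpos hApos).ne' ?_
    rw [z0, h3]
    linear_combination -hc2 + c ^ 2 * hQdef
  have hsum := rr_add_qq
  have z1 : ht 1 z = c * p 1 := by
    have : 2 * del * ht 1 z = 2 * del * (c * p 1) := by
      rw [← hsum]
      rw [hA] at zA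
      rw [hB] at zB
      linear_combination zA - zB
    exact mul_left_cancel₀ (by positivity) this
  have z2 : ht 2 z = c * p 2 := by
    rw [hA, z0, z1] at zA
    linarith
  refine ⟨z, c, hcpos, fun i => ?_⟩
  fin_cases i
  · exact z0
  · exact z1
  · exact z2

/-- The closed triangle. -/
def triangle : Set ℍ := {z | ∀ i, 0 ≤ ht i z}

/-- The triangle and its mirror image cover the sphere. -/
lemma exists_orbitMap_eq (v : Sphere2) :
    ∃ z, (z ∈ triangle ∨ cs.simple 0 • z ∈ triangle) ∧ orbitMap z = v := by
  -- `a` consists of the deviations and `p` of the heights of the wanted point, up to a factor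
  set a : Fin 3 → ℝ := ![-(v.1 0) - v.1 1, v.1 0, v.1 1] with ha
  set μ := min (a 0) (min (a 1) (a 2)) with hμ
  have hsum : a 0 + a 1 + a 2 = 0 := by simp [ha]; ring
  have hμle : ∀ i, μ ≤ a i := fun i => by
    rw [hμ]
    fin_cases i <;> simp
  set u := v.1 2 with hu
  set p : Fin 3 → ℝ := fun i => a i + |u| - μ with hp
  have hmin : min (p 0) (min (p 1) (p 2)) = |u| := by
    simp only [hp, add_sub_assoc]
    rw [min_add_add_right, min_add_add_right, ← hμ]
    ring
  have hpnn : ∀ i, 0 ≤ p i := fun i => by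
    have := hμle i
    have := abs_nonneg u
    simp only [hp]
    linarith
  have hpne : ∃ i, p i ≠ 0 := by
    by_contra! hall
    have hu0 : u = 0 := by
      rw [hall, hall, hall, min_self, min_self] at hmin
      exact abs_eq_zero.1 hmin.symm
    have haμ : ∀ i, a i = μ := fun i => by
      have := hall i
      simp only [hp, hu0, abs_zero] at this
      linarith
    have hμ0 : μ = 0 := by linarith [haμ 0, haμ 1, haμ 2]
    have hv : (v : EuclideanSpace ℝ (Fin 3)) = 0 := by
      ext i
      fin_cases i
      · exact (haμ 1).trans hμ0
      · exact (haμ 2).trans hμ0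
      · exact hu0
    have := mem_sphere_zero_iff_norm.1 v.2
    rw [hv, norm_zero] at this
    exact zero_ne_one this
  obtain ⟨z, c, hc, hz⟩ := exists_ht_eq hpnn hpne
  have hT : z ∈ triangle := fun i => by rw [hz]; exact mul_nonneg hc.le (hpnn i)
  have hfold : fold z = z := fold_of_nonneg hT
  have hin : inradius (fold z) = c * |u| := by
    rw [hfold, inradius, hz, hz, hz, ← hmin, mul_min_of_nonneg _ _ hc.le,
      mul_min_of_nonneg _ _ hc.le]
  have hdev : ∀ i, dev i z = c * a i := fun i => by
    rw [dev, hfold, hz, hz, hz, hz]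
    simp only [hp]
    linear_combination (-c / 3) * hsum
  have hsig : signed z = c * |u| := by
    rw [signed, hin, par, loc_of_nonneg hT, map_one]
    simp
  rcases le_or_gt 0 u with h | h
  · refine ⟨z, Or.inl hT, orbitMap_eq_iff_exists_pos.2 ⟨c, hc, ?_⟩⟩
    ext i
    fin_cases i
    · exact hdev 1
    · exact hdev 2
    · rw [abs_of_nonneg h] at hsig
      exact hsig
  · refine ⟨cs.simple 0 • z, Or.inr ?_, orbitMap_eq_iff_exists_pos.2 ⟨c, hc, ?_⟩⟩
    · rwa [smul_smul, cs.simple_mul_simple_self, one_smul]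
    · ext i
      fin_cases i
      · exact (dev_smul _ 1 z).trans (hdev 1)
      · exact (dev_smul _ 2 z).trans (hdev 2)
      · change signed (cs.simple 0 • z) = c * u
        rw [signed_smul, hsig, sgn_simple, abs_of_neg h]
        simp

/-- The heights over the first two sides confine the triangle to the unit disc, and the third keeps
it away from the real axis. -/
lemma isCompact_triangle : IsCompact triangle := by
  have hd := del_pos
  have hd1 := del_lt_one
  have hr := rr_pos
  have hq := qq_neg
  have hclosed : IsClosed triangle := by
    have : triangle = ⋂ i, {z | 0 ≤ ht i z} := by ext z; simp [triangle]
    rw [this]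
    exact isClosed_iInter fun i => isClosed_le continuous_const (continuous_ht i)
  set m := min (-qq) (1 - del) with hm
  have hmpos : 0 < m := lt_min (by linarith) (by linarith)
  refine Metric.isCompact_of_isClosed_isBounded hclosed
    (Metric.isBounded_closedBall (x := I) (r := 2 / √(m / rr)) |>.subset fun z hz => ?_)
  have hy := z.im_pos
  have z0 := hz 0
  have z1 := hz 1
  have z2 := hz 2
  rw [ht_zero, le_div_iff₀ hy, zero_mul] at z0
  rw [ht_one, le_div_iff₀ (by linarith), zero_mul] at z1
  rw [ht_two, le_div_iff₀ (by linarith), zero_mul] at z2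
  have hx1 : -1 ≤ z.re := by nlinarith
  -- the quadratic polynomial of the third side is negative on `[-1, 0]`
  have hm1 : m ≤ -qq := min_le_left _ _
  have hm2 : m ≤ 1 - del := min_le_right _ _
  have hsum := rr_add_qq
  have key : rr * z.re ^ 2 + z.re + qq ≤ -m := by
    have e1 : rr * z.re ^ 2 ≤ -(rr * z.re) := by
      have : rr * (z.re * (z.re + 1)) ≤ 0 :=
        mul_nonpos_of_nonneg_of_nonpos hr.le (mul_nonpos_of_nonpos_of_nonneg (by linarith)
          (by linarith))
      linarith
    have e2 : 0 ≤ (-z.re) * (1 - del - m) := mul_nonneg (by linarith) (by linarith)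
    have e3 : 0 ≤ (1 + z.re) * (-qq - m) := mul_nonneg (by linarith) (by linarith)
    have e4 : -(rr * z.re) + z.re + qq = -m - (-z.re) * (1 - del - m) - (1 + z.re) * (-qq - m) := by
      rw [← hsum]; ring
    linarith
  have hy2 : m / rr ≤ z.im ^ 2 := by
    rw [div_le_iff₀ hr]
    linarith
  have hy3 : √(m / rr) ≤ z.im := Real.sqrt_le_iff.2 ⟨hy.le, hy2⟩
  have hpos : 0 < √(m / rr) := Real.sqrt_pos.2 (div_pos hmpos hr)
  rw [Metric.mem_closedBall]
  refine (dist_I_le z).trans ?_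
  have e : lin heightVec z = ((z.re ^ 2 + z.im ^ 2) + del / 2 * z.re + (1 - del / 4)) / z.im := by
    simp [lin, heightVec]
  rw [e]
  refine div_le_div₀ (by norm_num) ?_ hpos hy3
  nlinarith

/-- The orbit map is open, since a compact set meets all orbits. -/
lemma isOpenMap_orbitMap : IsOpenMap orbitMap := by
  intro U hU
  have hs : Continuous fun z : ℍ => cs.simple 0 • z := continuous_const_smul _
  have hK : IsCompact (triangle ∪ (fun z : ℍ => cs.simple 0 • z) '' triangle) :=
    isCompact_triangle.union (isCompact_triangle.image hs)
  set K := triangle ∪ (fun z : ℍ => cs.simple 0 • z) '' triangle with hKdef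
  have hsat : orbitMap ⁻¹' (orbitMap '' U) = ⋃ x : Triangle237, (fun z : ℍ => x • z) ⁻¹' U := by
    ext z
    simp only [Set.mem_preimage, Set.mem_image, Set.mem_iUnion]
    constructor
    · rintro ⟨w, hw, h⟩
      obtain ⟨x, rfl⟩ := orbitMap_eq_iff.1 h
      exact ⟨x, hw⟩
    · rintro ⟨x, hx⟩
      exact ⟨_, hx, orbitMap_smul x z⟩
  have hopen : IsOpen (orbitMap ⁻¹' (orbitMap '' U)) := by
    rw [hsat]
    exact isOpen_iUnion fun x => hU.preimage (continuous_const_smul x)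
  have hcompl : (orbitMap '' U)ᶜ = orbitMap '' (K \ orbitMap ⁻¹' (orbitMap '' U)) := by
    ext v
    constructor
    · intro hv
      obtain ⟨z, hz, rfl⟩ := exists_orbitMap_eq v
      refine ⟨z, ⟨?_, hv⟩, rfl⟩
      rcases hz with hz | hz
      · exact Or.inl hz
      · refine Or.inr ⟨_, hz, ?_⟩
        change cs.simple 0 • cs.simple 0 • z = z
        rw [smul_smul, cs.simple_mul_simple_self, one_smul]
    · rintro ⟨z, ⟨-, hz⟩, rfl⟩
      exact hz
  rw [← isClosed_compl_iff, hcompl]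
  exact ((hK.diff hopen).image continuous_orbitMap).isClosed

end

end TriangleReflection

/-! ### Disc coordinates around a point of the upper half-plane -/

namespace TriangleReflection

open UpperHalfPlane PresentedGroup Topology
open scoped MatrixGroups

noncomputable section

/-- The disc coordinate centred at `z`. -/
def cayley (z v : ℍ) : ℂ := ((v : ℂ) - z) / (v - (starRingEnd ℂ) (z : ℂ))

lemma sub_conj_ne_zero (z v : ℍ) : (v : ℂ) - (starRingEnd ℂ) (z : ℂ) ≠ 0 := fun h => by
  have h1 := congrArg Complex.im h
  have := z.im_pos
  have := v.im_pos
  simp at h1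
  linarith

lemma continuous_cayley (z : ℍ) : Continuous (cayley z) := by
  have h : Continuous fun v : ℍ => (v : ℂ) := UpperHalfPlane.continuous_coe
  exact (h.sub continuous_const).div (h.sub continuous_const) (sub_conj_ne_zero z)

lemma cayley_injective (z : ℍ) : Function.Injective (cayley z) := fun v w h => by
  have hv := sub_conj_ne_zero z v
  have hw := sub_conj_ne_zero z w
  have hz := sub_conj_ne_zero z z
  unfold cayley at h
  rw [div_eq_div_iff hv hw] at h
  refine UpperHalfPlane.ext (mul_left_cancel₀ hz ?_)
  linear_combination h

lemma im_uncayley_pos (z : ℍ) {w : ℂ} (hw : ‖w‖ < 1) :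
    0 < ((z - (starRingEnd ℂ) (z : ℂ) * w) / (1 - w)).im := by
  have hne : (1 : ℂ) - w ≠ 0 := fun h => by
    rw [← sub_eq_zero.1 h, norm_one] at hw
    exact lt_irrefl _ hw
  have hsq : w.re ^ 2 + w.im ^ 2 < 1 := by
    have h1 : Complex.normSq w < 1 := by
      rw [Complex.normSq_eq_norm_sq]
      nlinarith [norm_nonneg w]
    rw [Complex.normSq_apply] at h1
    linarith
  have hN : 0 < Complex.normSq (1 - w) := Complex.normSq_pos.2 hne
  have e : ((z - (starRingEnd ℂ) (z : ℂ) * w) / (1 - w)).im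
      = z.im * (1 - (w.re ^ 2 + w.im ^ 2)) / Complex.normSq (1 - w) := by
    rw [Complex.div_im]
    simp
    field_simp
    ring
  rw [e]
  exact div_pos (mul_pos z.im_pos (by linarith)) hN

/-- The open unit disc. -/
abbrev Disc : Type := Metric.ball (0 : ℂ) 1

/-- A chart of the upper half-plane around `z`, defined on the unit disc: a multiple of the disc
coordinate. -/
lemma exists_disc_chart (z : ℍ) {ε : ℝ} (hε : 0 < ε) :
    ∃ (ψ : Disc → ℍ) (ρ : ℝ), 0 < ρ ∧ IsOpenEmbedding ψ ∧ (∀ w, dist (ψ w) z < ε) ∧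
      ∀ w, cayley z (ψ w) = ρ * w := by
  let Ψ : Disc → ℍ := fun w =>
    ⟨(z - (starRingEnd ℂ) (z : ℂ) * w) / (1 - w), im_uncayley_pos z (mem_ball_zero_iff.1 w.2)⟩
  have hne : ∀ w : Disc, (1 : ℂ) - w ≠ 0 := fun w h => by
    have hw := mem_ball_zero_iff.1 w.2
    rw [← sub_eq_zero.1 h, norm_one] at hw
    exact lt_irrefl _ hw
  have hΨ : Continuous Ψ := by
    rw [UpperHalfPlane.isEmbedding_coe.continuous_iff]
    change Continuous fun w : Disc => (z - (starRingEnd ℂ) (z : ℂ) * w) / (1 - w : ℂ)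
    exact Continuous.div (by fun_prop) (by fun_prop) hne
  have hcay : ∀ w, cayley z (Ψ w) = w := fun w => by
    have h1 := hne w
    have hz := sub_conj_ne_zero z z
    change ((z - (starRingEnd ℂ) (z : ℂ) * w) / (1 - w) - z)
      / ((z - (starRingEnd ℂ) (z : ℂ) * w) / (1 - w) - (starRingEnd ℂ) (z : ℂ)) = w
    have e1 : (z - (starRingEnd ℂ) (z : ℂ) * w) / (1 - w) - (z : ℂ)
        = (z - (starRingEnd ℂ) (z : ℂ)) * w / (1 - w) := by field_simp; ring
    have e2 : (z - (starRingEnd ℂ) (z : ℂ) * w) / (1 - w) - (starRingEnd ℂ) (z : ℂ)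
        = (z - (starRingEnd ℂ) (z : ℂ)) / (1 - w) := by field_simp; ring
    rw [e1, e2, div_div_div_cancel_right₀ h1, mul_div_cancel_left₀ _ hz]
  have hzero : Ψ ⟨0, by simp⟩ = z := cayley_injective z (by rw [hcay]; simp [cayley])
  obtain ⟨δ, hδ, H⟩ := Metric.continuousAt_iff.1 (hΨ.continuousAt (x := ⟨0, by simp⟩)) ε hε
  set ρ := min (δ / 2) 1 with hρ
  have hρ0 : 0 < ρ := lt_min (by positivity) one_pos
  have hscale : ∀ w : Disc, ‖(ρ : ℂ) * w‖ < ρ := fun w => by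
    rw [norm_mul, Complex.norm_real, Real.norm_of_nonneg hρ0.le]
    exact mul_lt_of_lt_one_right hρ0 (mem_ball_zero_iff.1 w.2)
  let m : Disc → Disc := fun w =>
    ⟨ρ * w, mem_ball_zero_iff.2 ((hscale w).trans_le (min_le_right _ _))⟩
  have hm : Continuous m := Continuous.subtype_mk (by fun_prop) _
  have hcay' : ∀ w, cayley z (Ψ (m w)) = ρ * w := fun w => hcay (m w)
  have hρC : (ρ : ℂ) ≠ 0 := by exact_mod_cast hρ0.ne'
  refine ⟨Ψ ∘ m, ρ, hρ0, ?_, fun w => ?_, hcay'⟩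
  · refine IsOpenEmbedding.of_continuous_injective_isOpenMap (hΨ.comp hm) (fun w w' h => ?_)
      fun U hU => ?_
    · have h1 := congrArg (cayley z) h
      simp only [Function.comp_apply, hcay'] at h1
      exact Subtype.ext (mul_left_cancel₀ hρC h1)
    · have e : (Ψ ∘ m) '' U = (fun v => cayley z v / ρ) ⁻¹' (Subtype.val '' U) := by
        ext v
        constructor
        · rintro ⟨w, hw, rfl⟩
          refine ⟨w, hw, ?_⟩
          simp only [Function.comp_apply, hcay']
          rw [mul_div_cancel_left₀ _ hρC]
        · rintro ⟨w, hw, h⟩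
          refine ⟨w, hw, cayley_injective z ?_⟩
          simp only [Function.comp_apply, hcay']
          rw [h, mul_div_cancel₀ _ hρC]
      rw [e]
      exact (Metric.isOpen_ball.isOpenMap_subtype_val U hU).preimage
        ((continuous_cayley z).div_const _)
  · have h1 := H (x := m w) (by
      rw [Subtype.dist_eq, dist_zero_right]
      exact (hscale w).trans (lt_of_le_of_lt (min_le_left _ _) (half_lt_self hδ)))
    rwa [hzero] at h1

/-- A matrix fixing `z` acts on the disc coordinate at `z` as a rotation, by minus twice the
argument of its automorphy factor. -/
lemma cayley_smul {M : GL (Fin 2) ℝ} (hM : M.val.det = 1) {z : ℍ} (hz : M • z = z) (v : ℍ) :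
    cayley z (M • v) = Complex.exp (-(2 * ang M z : ℝ) * Complex.I) * cayley z v := by
  have hdet : 0 < M.det.val := by
    change 0 < M.val.det
    rw [hM]; norm_num
  have hMC : (M 0 0 : ℂ) * M 1 1 - M 0 1 * M 1 0 = 1 := by
    rw [Matrix.det_fin_two] at hM
    exact_mod_cast hM
  have hv := coe_smul_of_det_pos hdet v
  have hzz := coe_smul_of_det_pos hdet z
  rw [hz] at hzz
  set j := denom M z with hj
  set k := denom M v with hk
  have hj0 : j ≠ 0 := denom_ne_zero M z
  have hk0 : k ≠ 0 := denom_ne_zero M v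
  have hjc : (starRingEnd ℂ) j ≠ 0 := (map_ne_zero _).2 hj0
  have ez : (z : ℂ) * j = num M z := (eq_div_iff hj0).1 hzz
  have ezc : (starRingEnd ℂ) (z : ℂ) * (starRingEnd ℂ) j = (starRingEnd ℂ) (num M z) := by
    rw [← map_mul, ez]
  have ev : ((M • v : ℍ) : ℂ) * k = num M v := (eq_div_iff hk0).1 hv
  have e1 : ((M • v : ℍ) : ℂ) - z = (v - z) / (k * j) := by
    rw [eq_div_iff (mul_ne_zero hk0 hj0)]
    have : ((M • v : ℍ) : ℂ) * k * j - z * j * k = (v - z) := by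
      rw [ev, ez, hj, hk]
      simp only [num, denom]
      linear_combination (v - z : ℂ) * hMC
    linear_combination this
  have e2 : ((M • v : ℍ) : ℂ) - (starRingEnd ℂ) (z : ℂ)
      = (v - (starRingEnd ℂ) (z : ℂ)) / (k * (starRingEnd ℂ) j) := by
    rw [eq_div_iff (mul_ne_zero hk0 hjc)]
    have : ((M • v : ℍ) : ℂ) * k * (starRingEnd ℂ) j
        - (starRingEnd ℂ) (z : ℂ) * (starRingEnd ℂ) j * k = (v - (starRingEnd ℂ) (z : ℂ)) := by
      rw [ev, ezc, hj, hk]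
      simp only [num, denom, map_add, map_mul, Complex.conj_ofReal]
      linear_combination (v - (starRingEnd ℂ) (z : ℂ)) * hMC
    linear_combination this
  have hrot : (starRingEnd ℂ) j = Complex.exp (-(2 * ang M z : ℝ) * Complex.I) * j := by
    have h1 : j = ‖j‖ * Complex.exp (ang M z * Complex.I) :=
      (Complex.norm_mul_exp_arg_mul_I j).symm
    have h2 : (starRingEnd ℂ) j = ‖j‖ * Complex.exp (-(ang M z * Complex.I)) := by
      conv_lhs => rw [h1]
      rw [map_mul, Complex.conj_ofReal, ← Complex.exp_conj, map_mul, Complex.conj_ofReal,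
        Complex.conj_I, mul_neg]
    rw [h2]
    conv_rhs => rw [h1]
    rw [mul_left_comm, ← Complex.exp_add]
    congr 2
    push_cast
    ring
  have hd := sub_conj_ne_zero z v
  unfold cayley
  rw [e1, e2, div_div_div_eq, hrot]
  field_simp

/-- `RotAt p x z`: in the disc coordinate at `z` the element `x` of the triangle group is the
clockwise rotation by `2 π / p`. -/
def RotAt (p : ℕ) (x : Triangle237) (z : ℍ) : Prop :=
  ∀ v : ℍ, cayley z (x • v) = ((Circle.exp (2 * Real.pi / p))⁻¹ : Circle) * cayley z v

lemma rotAt_of_ang {M : GL (Fin 2) ℝ} (hM : M.val.det = 1) {x : Triangle237} {z : ℍ} {p : ℕ}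
    (hx : ∀ v : ℍ, M • v = x • v) (hz : x • z = z) (ha : ang M z = Real.pi / p) :
    RotAt p x z := fun v => by
  rw [← hx, cayley_smul hM ((hx z).trans hz), ha, ← Circle.exp_neg, Circle.coe_exp]
  congr 3
  push_cast
  ring

lemma rotAt_a : RotAt 2 (proj (of .a)) vA := by
  rw [proj_a]
  exact rotAt_of_ang (det_neg_wallMatrix_mul 1 0) rotA_smul tri_smul_vA ang_rotA_vA

lemma rotAt_b : RotAt 3 (proj (of .b)) vB := by
  rw [proj_b]
  exact rotAt_of_ang (det_neg_wallMatrix_mul 0 2) rotB_smul tri_smul_vB ang_rotB_vB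

lemma rotAt_c : RotAt 7 (proj (of .c)) vC := by
  rw [proj_c]
  exact rotAt_of_ang (det_neg_wallMatrix_mul 2 1) rotC_smul tri_smul_vC ang_rotC_vC

lemma rotAt_tt (z : ℍ) : RotAt 1 (proj tt) z := fun v => by
  rw [proj_tt, one_smul, Nat.cast_one, div_one, Circle.exp_two_pi, inv_one, Circle.coe_one, one_mul]

lemma RotAt.zpow {p : ℕ} {x : Triangle237} {z : ℍ} (h : RotAt p x z) (n : ℤ) (v : ℍ) :
    cayley z (x ^ n • v) = ((Circle.exp (2 * Real.pi / p) ^ (-n) : Circle) : ℂ) * cayley z v := by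
  set c := Circle.exp (2 * Real.pi / p) with hc
  have hnat : ∀ (n : ℕ) (v : ℍ),
      cayley z (x ^ n • v) = ((c ^ (-(n : ℤ)) : Circle) : ℂ) * cayley z v := by
    intro n v
    induction n with
    | zero => simp
    | succ n ih =>
      rw [pow_succ' x, mul_smul, h, ih, ← mul_assoc, ← Circle.coe_mul, ← hc]
      congr 2
      rw [Nat.cast_succ, neg_add, add_comm, zpow_add, zpow_neg_one]
  obtain ⟨n, rfl | rfl⟩ := n.eq_nat_or_neg
  · rw [zpow_natCast x]
    exact hnat n v
  · have h1 := hnat n (x ^ (-(n : ℤ)) • v)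
    rw [zpow_neg x, zpow_natCast x, smul_inv_smul] at h1
    rw [zpow_neg x, zpow_natCast x, h1, ← mul_assoc, ← Circle.coe_mul, neg_neg, zpow_neg,
      mul_inv_cancel, Circle.coe_one, one_mul]

end

end TriangleReflection

/-! ### The Seifert fibration -/

namespace TriangleReflection

open UpperHalfPlane PresentedGroup Topology
open scoped MatrixGroups

noncomputable section

/-- Two quotient maps with the same fibres have homeomorphic targets. -/
lemma exists_homeomorph_of_fibres {X Y Z : Type*} [TopologicalSpace X] [TopologicalSpace Y]
    [TopologicalSpace Z] {f : X → Y} {g : X → Z} (hf : IsQuotientMap f) (hg : IsQuotientMap g)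
    (h : ∀ x x', f x = f x' ↔ g x = g x') : ∃ e : Y ≃ₜ Z, ∀ x, e (f x) = g x := by
  let e : Y → Z := fun y => g (Function.surjInv hf.surjective y)
  let e' : Z → Y := fun z => f (Function.surjInv hg.surjective z)
  have he : ∀ x, e (f x) = g x := fun x => (h _ _).1 (Function.surjInv_eq hf.surjective _)
  have he' : ∀ x, e' (g x) = f x := fun x => (h _ _).2 (Function.surjInv_eq hg.surjective _)
  refine ⟨{ toFun := e, invFun := e', left_inv := fun y => ?_, right_inv := fun z => ?_,
            continuous_toFun := ?_, continuous_invFun := ?_ }, he⟩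
  · obtain ⟨x, rfl⟩ := hf.surjective y
    rw [he, he']
  · obtain ⟨x, rfl⟩ := hg.surjective z
    rw [he', he]
  · rw [hf.continuous_iff, show e ∘ f = g from funext he]
    exact hg.continuous
  · rw [hg.continuous_iff, show e' ∘ g = f from funext he']
    exact hf.continuous

/-- The rotations of the unit disc. -/
def turn (c : Circle) (w : Disc) : Disc :=
  ⟨c * w, by
    have := w.2
    rw [mem_ball_zero_iff] at this ⊢
    rwa [norm_mul, Circle.norm_coe, one_mul]⟩

lemma coe_turn (c : Circle) (w : Disc) : (turn c w : ℂ) = c * w := rfl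

lemma turn_turn (c d : Circle) (w : Disc) : turn c (turn d w) = turn (c * d) w :=
  Subtype.ext (by simp only [coe_turn, Circle.coe_mul, mul_assoc])

lemma turn_one (w : Disc) : turn 1 w = w := Subtype.ext (by simp [coe_turn])

/-- The power map of the unit disc. -/
def discPow (p : ℕ) (hp : p ≠ 0) (w : Disc) : Disc :=
  ⟨(w : ℂ) ^ p, by
    have := w.2
    rw [mem_ball_zero_iff] at this ⊢
    rw [norm_pow]
    exact pow_lt_one₀ (norm_nonneg _) this hp⟩

lemma isQuotientMap_discPow {p : ℕ} (hp : p ≠ 0) : IsQuotientMap (discPow p hp) := by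
  have hopen : IsOpenMap fun w : ℂ => w ^ p := by
    rcases AnalyticOnNhd.is_constant_or_isOpenMap (g := fun w : ℂ => w ^ p)
      (fun w _ => by fun_prop) with ⟨c, hc⟩ | h
    · have h0 := hc 0
      have h1 := hc 1
      rw [zero_pow hp] at h0
      rw [one_pow, ← h0] at h1
      exact absurd h1 one_ne_zero
    · exact h
  refine IsOpenMap.isQuotientMap ?_ (Continuous.subtype_mk (by fun_prop) _) fun v => ?_
  · exact (hopen.comp Metric.isOpen_ball.isOpenMap_subtype_val).subtype_mk _
  · obtain ⟨w, hw⟩ := IsAlgClosed.exists_pow_nat_eq (v : ℂ) (Nat.pos_of_ne_zero hp)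
    refine ⟨⟨w, ?_⟩, Subtype.ext hw⟩
    have := v.2
    rw [mem_ball_zero_iff] at this ⊢
    rw [← hw, norm_pow] at this
    exact (pow_lt_one_iff_of_nonneg (norm_nonneg _) hp).1 this

lemma discPow_eq_iff {p : ℕ} (hp : p ≠ 0) {w w' : Disc} :
    discPow p hp w = discPow p hp w' ↔
      ∃ n : ℤ, w = turn (Circle.exp (2 * Real.pi / p) ^ (-n)) w' := by
  have hpR : (p : ℝ) ≠ 0 := Nat.cast_ne_zero.2 hp
  constructor
  · intro h
    have h1 : (w : ℂ) ^ p = (w' : ℂ) ^ p := congrArg Subtype.val h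
    by_cases h0 : (w' : ℂ) = 0
    · rw [h0, zero_pow hp] at h1
      exact ⟨0, Subtype.ext (by rw [coe_turn, h0, mul_zero, eq_zero_of_pow_eq_zero h1])⟩
    · have h2 : ((w : ℂ) / w') ^ p = 1 := by rw [div_pow, h1, div_self (pow_ne_zero _ h0)]
      have : NeZero p := ⟨hp⟩
      obtain ⟨i, -, hi⟩ := (Complex.isPrimitiveRoot_exp p hp).eq_pow_of_pow_eq_one h2
      refine ⟨-i, Subtype.ext ?_⟩
      rw [coe_turn, neg_neg, zpow_natCast, Circle.coe_pow, Circle.coe_exp]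
      rw [eq_div_iff h0] at hi
      rw [← hi]
      congr 3
      push_cast
      ring
  · rintro ⟨n, rfl⟩
    refine Subtype.ext ?_
    change ((turn _ w' : Disc) : ℂ) ^ p = (w' : ℂ) ^ p
    have hc : Circle.exp (2 * Real.pi / p) ^ p = 1 := by
      rw [← Circle.exp_natCast_mul, mul_div_cancel₀ _ hpR, Circle.exp_two_pi]
    have h1 : (Circle.exp (2 * Real.pi / p) ^ (-n)) ^ p = 1 := by
      rw [← zpow_natCast, zpow_comm, zpow_natCast, hc, one_zpow]
    rw [coe_turn, mul_pow, ← Circle.coe_pow, h1, Circle.coe_one, one_mul]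

/-- The covering `(w, s) ↦ (exp (2 π i s) w, exp (2 π i p s))` of the solid torus. -/
def torusCover (p : ℕ) (x : Disc × ℝ) : Disc × Circle :=
  (turn (Circle.exp (2 * Real.pi * x.2)) x.1, Circle.exp (2 * Real.pi * p * x.2))

lemma continuous_turn {X : Type*} [TopologicalSpace X] {c : X → Circle} {w : X → Disc}
    (hc : Continuous c) (hw : Continuous w) : Continuous fun x => turn (c x) (w x) :=
  Continuous.subtype_mk ((continuous_subtype_val.comp hc).mul (continuous_subtype_val.comp hw)) _

lemma isQuotientMap_torusCover {p : ℕ} (hp : p ≠ 0) : IsQuotientMap (torusCover p) := by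
  have hpR : (p : ℝ) ≠ 0 := Nat.cast_ne_zero.2 hp
  have hE : ∀ r : ℝ, Continuous fun s : ℝ => Circle.exp (r * s) := fun r =>
    Circle.exp.continuous.comp (by fun_prop)
  -- the twisting of the disc factor is a homeomorphism
  let T : Disc × ℝ ≃ₜ Disc × ℝ :=
    { toFun := fun x => (turn (Circle.exp (2 * Real.pi * x.2)) x.1, x.2)
      invFun := fun x => (turn (Circle.exp (2 * Real.pi * x.2))⁻¹ x.1, x.2)
      left_inv := fun x => by simp only [turn_turn, inv_mul_cancel, turn_one]
      right_inv := fun x => by simp only [turn_turn, mul_inv_cancel, turn_one]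
      continuous_toFun := (continuous_turn ((hE _).comp continuous_snd) continuous_fst).prodMk
        continuous_snd
      continuous_invFun := (continuous_turn ((hE _).comp continuous_snd).inv
        continuous_fst).prodMk continuous_snd }
  have hexp : IsOpenMap fun s : ℝ => Circle.exp (2 * Real.pi * p * s) := by
    have hne : 2 * Real.pi * p ≠ 0 := mul_ne_zero Real.two_pi_pos.ne' hpR
    exact isLocalHomeomorph_circleExp.isOpenMap.comp (Homeomorph.mulLeft₀ _ hne).isOpenMap
  have h : torusCover p = Prod.map id (fun s : ℝ => Circle.exp (2 * Real.pi * p * s)) ∘ T := rfl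
  refine IsOpenMap.isQuotientMap ?_ ?_ ?_
  · rw [h]
    exact (IsOpenMap.id.prodMap hexp).comp T.isOpenMap
  · rw [h]
    exact (continuous_id.prodMap (hE _)).comp T.continuous
  · rw [h]
    refine (Function.surjective_id.prodMap fun c => ?_).comp T.surjective
    obtain ⟨s, rfl⟩ := Circle.exp_surjective c
    refine ⟨s / (2 * Real.pi * p), ?_⟩
    congr 1
    have := Real.pi_ne_zero
    field_simp

lemma torusCover_eq_iff {p : ℕ} (hp : p ≠ 0) {x y : Disc × ℝ} :
    torusCover p x = torusCover p y ↔
      ∃ n : ℤ, x.1 = turn (Circle.exp (2 * Real.pi / p) ^ (-n)) y.1 ∧ x.2 = y.2 + n / p := by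
  have hpR : (p : ℝ) ≠ 0 := Nat.cast_ne_zero.2 hp
  have hpi := Real.pi_ne_zero
  have hpow : ∀ n : ℤ,
      Circle.exp (2 * Real.pi / p) ^ (-n) = Circle.exp (-(2 * Real.pi * (n / p))) :=
    fun n => by
      rw [← Circle.exp_intCast_mul]
      congr 1
      push_cast
      field_simp
  constructor
  · intro h
    obtain ⟨h1, h2⟩ := Prod.ext_iff.1 h
    obtain ⟨n, hn⟩ := Circle.exp_eq_exp.1 h2
    have hs : x.2 = y.2 + n / p := by
      field_simp at hn ⊢
      linarith
    refine ⟨n, ?_, hs⟩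
    have h3 := congrArg (turn (Circle.exp (2 * Real.pi * x.2))⁻¹) h1
    simp only [torusCover, turn_turn, inv_mul_cancel, turn_one] at h3
    rw [h3, hpow, ← Circle.exp_neg, ← Circle.exp_add, hs]
    congr 2
    ring
  · rintro ⟨n, h1, h2⟩
    refine Prod.ext ?_ ?_
    · change turn _ x.1 = turn _ y.1
      rw [h1, turn_turn, hpow, ← Circle.exp_add, h2]
      congr 2
      ring
    · refine Circle.exp_eq_exp.2 ⟨n, ?_⟩
      rw [h2]
      field_simp

/-- The Seifert fibration. -/
def fibration : SeifertManifold → Sphere2 :=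
  Quotient.lift (fun x : ℍ × ℝ => orbitMap x.1) fun x y h => by
    obtain ⟨g, rfl⟩ : ∃ g : Seifert237, g • y = x := h
    rw [cover_smul, orbitMap_smul]

lemma continuous_fibration : Continuous fibration :=
  Continuous.quotient_lift (continuous_orbitMap.comp continuous_fst) _

lemma quot_eq_iff {x y : ℍ × ℝ} : quot x = quot y ↔ ∃ g : Seifert237, g • y = x :=
  isQuotientCoveringMap_quot.apply_eq_iff_mem_orbit

lemma isOpenMap_quot : IsOpenMap quot := isQuotientCoveringMap_quot.isOpenQuotientMap.isOpenMap

/-- The fibred solid torus around the fibre over `z`. -/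
lemma exists_solid_torus {p : ℕ} {g : Seifert237} {z : ℍ} (hg : ConeAt p g z)
    (hrot : RotAt p (proj g) z) :
    ∃ q : ℤ, IsCoprime (p : ℤ) q ∧
      ∃ U : Set Sphere2, IsOpen U ∧ ∃ hb : orbitMap z ∈ U,
        ∃ (e : U ≃ₜ Metric.ball (0 : ℂ) 1)
          (E : (fibration ⁻¹' U : Set SeifertManifold) ≃ₜ (Metric.ball (0 : ℂ) 1) × Circle),
          (e ⟨orbitMap z, hb⟩ : ℂ) = 0 ∧
          ∀ x : (fibration ⁻¹' U : Set SeifertManifold),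
            (e ⟨fibration x, x.2⟩ : ℂ) = ((E x).1 : ℂ) ^ p * (((E x).2 ^ q : Circle) : ℂ) := by
  have hp := hg.pos
  obtain ⟨ε, hε, H⟩ := exists_smul_eq_of_dist_lt z
  obtain ⟨ψ, ρ, hρ, hψ, hψε, hcay⟩ := exists_disc_chart z hε
  have hρC : (ρ : ℂ) ≠ 0 := by exact_mod_cast hρ.ne'
  have hψ0 : ψ ⟨0, by simp⟩ = z := cayley_injective z (by rw [hcay]; simp [cayley])
  -- the stabilizer of `z` acts on the disc by rotations
  have hturn : ∀ (n : ℤ) (w : Disc),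
      proj (g ^ n) • ψ w = ψ (turn (Circle.exp (2 * Real.pi / p) ^ (-n)) w) := fun n w => by
    refine cayley_injective z ?_
    rw [map_zpow proj g n, hrot.zpow, hcay, hcay, coe_turn]
    ring
  have hstab : ∀ (h : Seifert237) (w w' : Disc), proj h • ψ w' = ψ w → ∃ n : ℤ, h = g ^ n :=
    fun h w w' e => by
      obtain ⟨n, hn⟩ := Subgroup.mem_zpowers_iff.1 (hg.stab h (H (toW (proj h)) (ψ w') (hψε _) (by
        change dist (proj h • ψ w') z < ε
        rw [e]
        exact hψε _)))
      exact ⟨n, hn.symm⟩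
  have hfib : ∀ w w' : Disc, orbitMap (ψ w) = orbitMap (ψ w') ↔
      ∃ n : ℤ, w = turn (Circle.exp (2 * Real.pi / p) ^ (-n)) w' := fun w w' => by
    rw [orbitMap_eq_iff]
    constructor
    · rintro ⟨x, hx⟩
      obtain ⟨h, rfl⟩ := proj_surjective x
      obtain ⟨n, rfl⟩ := hstab h w w' hx
      rw [hturn] at hx
      exact ⟨n, (hψ.injective hx).symm⟩
    · rintro ⟨n, rfl⟩
      exact ⟨proj (g ^ n), hturn n w'⟩
  set U : Set Sphere2 := Set.range (orbitMap ∘ ψ) with hU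
  have hUopen : IsOpen U := (isOpenMap_orbitMap.comp hψ.isOpenMap).isOpen_range
  -- the chart of the base
  let a : Disc → U := fun w => ⟨orbitMap (ψ w), ⟨w, rfl⟩⟩
  have ha : IsQuotientMap a := by
    refine IsOpenMap.isQuotientMap ((isOpenMap_orbitMap.comp hψ.isOpenMap).subtype_mk _)
      ((continuous_orbitMap.comp hψ.continuous).subtype_mk _) ?_
    rintro ⟨_, w, rfl⟩
    exact ⟨w, rfl⟩
  obtain ⟨e, he⟩ := exists_homeomorph_of_fibres ha (isQuotientMap_discPow hp) fun w w' => by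
    rw [discPow_eq_iff, ← hfib]
    exact Subtype.ext_iff
  -- the chart of the total space, with the fibre coordinate straightened
  let S : Disc × ℝ ≃ₜ Disc × ℝ :=
    { toFun := fun x => (x.1, x.2 - straight p g (ψ x.1))
      invFun := fun x => (x.1, x.2 + straight p g (ψ x.1))
      left_inv := fun x => by simp
      right_inv := fun x => by simp
      continuous_toFun := continuous_fst.prodMk (continuous_snd.sub
        ((continuous_straight p g).comp (hψ.continuous.comp continuous_fst)))
      continuous_invFun := continuous_fst.prodMk (continuous_snd.add
        ((continuous_straight p g).comp (hψ.continuous.comp continuous_fst))) }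
  let A : Disc × ℝ → ℍ × ℝ := Prod.map ψ id ∘ S
  have hAopen : IsOpenMap A := (hψ.isOpenMap.prodMap IsOpenMap.id).comp S.isOpenMap
  have hAcont : Continuous A := (hψ.continuous.prodMap continuous_id).comp S.continuous
  have hA : ∀ x, A x = (ψ x.1, x.2 - straight p g (ψ x.1)) := fun x => rfl
  let b : Disc × ℝ → (fibration ⁻¹' U : Set SeifertManifold) := fun x => ⟨quot (A x), ⟨x.1, rfl⟩⟩
  have hb : IsQuotientMap b := by
    refine IsOpenMap.isQuotientMap ((isOpenMap_quot.comp hAopen).subtype_mk _)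
      ((isQuotientCoveringMap_quot.continuous.comp hAcont).subtype_mk _) ?_
    rintro ⟨m, w, hm⟩
    obtain ⟨y, rfl⟩ := isQuotientCoveringMap_quot.surjective m
    obtain ⟨x, hx⟩ := orbitMap_eq_iff.1 hm
    obtain ⟨h, rfl⟩ := proj_surjective x
    refine ⟨(w, (h • y).2 + straight p g (ψ w)), Subtype.ext (quot_eq_iff.2 ⟨h, ?_⟩)⟩
    rw [hA, add_sub_cancel_right, ← hx, cover_smul]
  obtain ⟨E, hE⟩ := exists_homeomorph_of_fibres hb (isQuotientMap_torusCover hp) fun x y => by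
    rw [torusCover_eq_iff hp, Subtype.ext_iff]
    change quot (A x) = quot (A y) ↔ _
    rw [quot_eq_iff]
    constructor
    · rintro ⟨h, hh⟩
      have h1 : proj h • ψ y.1 = ψ x.1 := by
        have := congrArg Prod.fst hh
        rwa [cover_smul] at this
      obtain ⟨n, rfl⟩ := hstab h _ _ h1
      have h2 := straight_zpow_smul hp hg.pow n (A y)
      rw [hh, hA, hA] at h2
      simp only [sub_add_cancel] at h2
      rw [hturn] at h1
      exact ⟨n, (hψ.injective h1).symm, h2⟩
    · rintro ⟨n, h1, h2⟩
      refine ⟨g ^ n, ?_⟩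
      have h3 := straight_zpow_smul hp hg.pow n (A y)
      have h4 : (g ^ n • A y).1 = ψ x.1 := by
        rw [cover_smul, h1]
        exact hturn n y.1
      refine Prod.ext h4 ?_
      rw [h4, hA y] at h3
      simp only [sub_add_cancel] at h3
      rw [← h2] at h3
      rw [hA x, hA y]
      exact eq_sub_of_add_eq h3
  refine ⟨-1, isCoprime_one_right.neg_right, U, hUopen, ⟨⟨0, by simp⟩, by rw [Function.comp, hψ0]⟩,
    e, E, ?_, fun m => ?_⟩
  · have h1 : (⟨orbitMap z, ⟨⟨0, by simp⟩, by rw [Function.comp, hψ0]⟩⟩ : U) = a ⟨0, by simp⟩ :=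
      Subtype.ext (by simp only [a, hψ0])
    rw [h1, he]
    exact zero_pow hp
  · obtain ⟨x, rfl⟩ := hb.surjective m
    have h1 : (⟨fibration (b x), (b x).2⟩ : U) = a x.1 := Subtype.ext rfl
    rw [h1, he, hE]
    change (x.1 : ℂ) ^ p = ((Circle.exp (2 * Real.pi * x.2) : ℂ) * x.1) ^ p *
      ((Circle.exp (2 * Real.pi * p * x.2) ^ (-1 : ℤ) : Circle) : ℂ)
    have h2 : Circle.exp (2 * Real.pi * p * x.2) = Circle.exp (2 * Real.pi * x.2) ^ p := by
      rw [← Circle.exp_natCast_mul]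
      congr 1
      ring
    rw [h2, zpow_neg_one, Circle.coe_inv, Circle.coe_pow, mul_pow, mul_right_comm,
      mul_inv_cancel₀ (pow_ne_zero _ (Circle.coe_ne_zero _)), one_mul]

lemma orbitMap_ne_of_fold_ne {z w : ℍ} (h : fold z ≠ fold w) : orbitMap z ≠ orbitMap w := by
  intro h1
  obtain ⟨x, rfl⟩ := orbitMap_eq_iff.1 h1
  exact h (fold_smul (toW x) w)

open Classical in
/-- The multiplicity of the fibre over a point of the sphere. -/
def multiplicity (b : Sphere2) : ℕ :=
  if b = orbitMap vA then 2 else if b = orbitMap vB then 3 else if b = orbitMap vC then 7 else 1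

lemma isSeifertOver237_fibration : IsSeifertOver237 fibration := by
  have hA := fold_of_nonneg ht_vA_nonneg
  have hB := fold_of_nonneg ht_vB_nonneg
  have hC := fold_of_nonneg ht_vC_nonneg
  have hAB : orbitMap vA ≠ orbitMap vB := orbitMap_ne_of_fold_ne (by rw [hA, hB]; exact vA_ne_vB)
  have hAC : orbitMap vA ≠ orbitMap vC := orbitMap_ne_of_fold_ne (by rw [hA, hC]; exact vA_ne_vC)
  have hBC : orbitMap vB ≠ orbitMap vC := orbitMap_ne_of_fold_ne (by rw [hB, hC]; exact vB_ne_vC)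
  have mA : multiplicity (orbitMap vA) = 2 := by rw [multiplicity, if_pos rfl]
  have mB : multiplicity (orbitMap vB) = 3 := by rw [multiplicity, if_neg hAB.symm, if_pos rfl]
  have mC : multiplicity (orbitMap vC) = 7 := by
    rw [multiplicity, if_neg hAC.symm, if_neg hBC.symm, if_pos rfl]
  have mO : ∀ w, w ≠ orbitMap vA → w ≠ orbitMap vB → w ≠ orbitMap vC → multiplicity w = 1 :=
    fun w h1 h2 h3 => by rw [multiplicity, if_neg h1, if_neg h2, if_neg h3]
  refine ⟨multiplicity, orbitMap vA, orbitMap vB, orbitMap vC,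
    ⟨continuous_fibration, fun b => ?_⟩, hAB, hAC, hBC, mA, mB, mC, mO⟩
  by_cases h1 : b = orbitMap vA
  · subst h1
    rw [mA]
    exact ⟨by norm_num, exists_solid_torus coneAt_vA rotAt_a⟩
  by_cases h2 : b = orbitMap vB
  · subst h2
    rw [mB]
    exact ⟨by norm_num, exists_solid_torus coneAt_vB rotAt_b⟩
  by_cases h3 : b = orbitMap vC
  · subst h3
    rw [mC]
    exact ⟨by norm_num, exists_solid_torus coneAt_vC rotAt_c⟩
  rw [mO b h1 h2 h3]
  obtain ⟨z, -, rfl⟩ := exists_orbitMap_eq b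
  have key : ∀ {y : ℍ} {i : Fin 3}, ht i y = 0 → orbitMap z ≠ orbitMap y → fold z ≠ y :=
    fun hi hne h => by
      obtain ⟨x, rfl⟩ := exists_tri_smul_eq hi h
      exact hne (orbitMap_smul x _)
  have hz : ConeAt 1 tt z := (exists_vertex_or_coneAt z).resolve_left fun h => by
    rcases h with h | h | h
    · exact key ht_vA.1 h1 h
    · exact key ht_vB.1 h2 h
    · exact key ht_vC.1 h3 h
  exact ⟨le_rfl, exists_solid_torus hz (rotAt_tt z)⟩

end

end TriangleReflection

/-- There is a finitely presented, torsion-free subgroup `H` of `Diffeo⁺(ℝ²)` that is not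
left-orderable; `H` is isomorphic to `G = ⟨a, b, c, t ∣ a² = b³ = c⁷ = t, abc = t³⟩`. The group `G`
is the fundamental group of a Seifert fibered space over the `(2,3,7)` orbifold, and it is a
central extension `1 → ℤ → G → Δ → 1` of the `(2,3,7)` triangle group, with `ℤ` generated by `t`
and `G → Δ` sending `a, b, c` to `a, b, c`. -/
theorem mainTheorem6 :
    (∃ H : Subgroup DiffeoPlus,
      Group.IsFinitelyPresented H ∧ TorsionFreeGroup H ∧ ¬ LeftOrderable H ∧
        Nonempty (Seifert237 ≃* H)) ∧
    (∃ (M : Type) (_ : TopologicalSpace M) (f : M → Sphere2), IsSeifertOver237 f ∧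
      ∀ m : M, Nonempty (FundamentalGroup M m ≃* Seifert237)) ∧
    (∃ S : GroupExtension (Multiplicative ℤ) Seifert237 Triangle237,
      S.inl.range ≤ Subgroup.center Seifert237 ∧
      S.inl (Multiplicative.ofAdd 1) = PresentedGroup.of SeifertGen.t ∧
      S.rightHom (PresentedGroup.of SeifertGen.a) = PresentedGroup.of TriangleGen.a ∧
      S.rightHom (PresentedGroup.of SeifertGen.b) = PresentedGroup.of TriangleGen.b ∧
      S.rightHom (PresentedGroup.of SeifertGen.c) = PresentedGroup.of TriangleGen.c) := by
  open TriangleReflection in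
  obtain ⟨ρ, hρ⟩ := exists_injective_diffeoPlus
  let e : Seifert237 ≃* ρ.range := MonoidHom.ofInjective hρ
  exact ⟨⟨ρ.range, .equiv e, torsionFree.of_mulEquiv e,
      fun h => not_leftOrderable (h.of_mulEquiv e),
      ⟨e⟩⟩,
    ⟨SeifertManifold, inferInstance, fibration, isSeifertOver237_fibration,
      nonempty_fundamentalGroup_mulEquiv⟩,
    ⟨extension, by
      rintro _ ⟨k, rfl⟩
      exact Subgroup.zpow_mem _ tt_mem_center k.toAdd,
      zpow_one tt, proj_a, proj_b, proj_c⟩⟩
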